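/- Let $n\in\mathbb N$, $s\in(0,1)$, $T>0$. For $E\subset\mathbb R^n$ and $x\in\partial E$ let $$H_s(x,E):=\lim_{\delta\searrow0}\,s(1-s)\int_{\mathbb R^n\setminus B_\delta(x)}\frac{\chi_{\mathbb R^n\setminus E}(y)-\chi_E(y)}{|x-y|^{n+s}}\,dy$$ be the fractional mean curvature. Let $(E_t)_{t\in[0,T]}$ be a family of subsets of $\mathbb R^n$, possibly with unbounded boundaries, that is a classical solution of the fractional mean curvature flow $$\partial_t x\cdot\nu=-H_s(x,E_t)\qquad\text{for } x\in\partial E_t,\ t\in[0,T],$$ where $\nu$ is the outer unit normal of $E_t$. Here "classical" means two things. First, near every point $(x_0,t_0)$ of $\mathbb R^n\times[0,T]$ there is a $C^1$ function $u(x,t)$ such that, for $(x,t)$ near $(x_0,t_0)$ with $t\in[0,T]$, $x\in E_t$ where $u(x,t)<0$ and $x\notin E_t$ where $u(x,t)>0$, and such that $\nabla_xu(x_0,t_0)\neq0$ if $u(x_0,t_0)=0$. Second, through every $x_0\in\partial E_{t_0}$ passes a curve $t\mapsto x(t)\in\partial E_t$, defined for $t\in[0,T]$ near $t_0$ and differentiable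 at $t_0$, with $x(t_0)=x_0$, that satisfies the equation at $t_0$. Assume that 1. the function $(x,t)\mapsto H_s(x,E_t)$ is differentiable on $\{(x,t): t\in[0,T],\ x\in\partial E_t\}$; 2. $\partial E_t$ is uniformly spatially $C^2$ on $[0,T]$: there are $r>0$ and $C$ such that, for every $t\in[0,T]$ and $x\in\partial E_t$, in the cylinder of radius $r$ and half-height $r$ centred at $x$ with axis normal to $\partial E_t$ at $x$, the set $E_t$ is (up to its boundary points) the subgraph of a $C^2$ function $g$ over the tangent hyperplane at $x$, with $g(0)=0$, $\nabla g(0)=0$ and $|D^2g|\le C$; 3. $E_0$ has strictly positive fractional mean curvature, i.e. $H_s(x,E_0)>0$ for every $x\in\partial E_0$. Then $E_t$ has strictly positive fractional mean curvature for every $t\in[0,T]$, i.e. $H_s(x,E_t)$ exists and $H_s(x,E_t)>0$ for every $t\in[0,T]$ and every $x\in\partial E_t$. -/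

import Mathlib

open Set Filter Topology MeasureTheory

noncomputable section

namespace FracFlow

/-- Euclidean space `ℝⁿ`. -/
abbrev Space (n : ℕ) : Type := EuclideanSpace ℝ (Fin n)

/-- The signed indicator: `1` off `E` and `-1` on `E`. -/
def signedIndicator {n : ℕ} (E : Set (Space n)) (y : Space n) : ℝ :=
  Eᶜ.indicator (fun _ => (1 : ℝ)) y - E.indicator (fun _ => (1 : ℝ)) y

/-- The truncated integral `s (1 - s) ∫_{ℝⁿ ∖ B_δ(x)} χ̃_E(y) / |x - y|^{n+s} dy`. -/
def truncatedCurv {n : ℕ} (s : ℝ) (E : Set (Space n)) (x : Space n) (δ : ℝ) : ℝ :=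
  s * (1 - s) * ∫ y in (Metric.ball x δ)ᶜ, signedIndicator E y / ‖x - y‖ ^ ((n : ℝ) + s)

/-- The fractional mean curvature of `E` at `x` exists and equals `h`. -/
def HasFracMeanCurv {n : ℕ} (s : ℝ) (E : Set (Space n)) (x : Space n) (h : ℝ) : Prop :=
  Tendsto (truncatedCurv s E x) (𝓝[>] 0) (𝓝 h)

/-- The fractional mean curvature `H_s(x, E)`, as the limit of the truncated integrals. -/
def fracMeanCurv {n : ℕ} (s : ℝ) (E : Set (Space n)) (x : Space n) : ℝ :=
  limUnder (𝓝[>] 0) (truncatedCurv s E x)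

/-- At every boundary point of `E` the fractional mean curvature exists and is strictly positive. -/
def StrictlyPositiveCurv {n : ℕ} (s : ℝ) (E : Set (Space n)) : Prop :=
  ∀ x ∈ frontier E, ∃ h : ℝ, 0 < h ∧ HasFracMeanCurv s E x h

/-- `ν` is the outer unit normal of `E` at `x`: near `x`, the set `E` contains every cone around
`-ν` of opening less than `π`, and its complement contains every such cone around `ν`. -/
def IsOuterNormal {n : ℕ} (E : Set (Space n)) (x ν : Space n) : Prop :=
  ‖ν‖ = 1 ∧ ∀ η : ℝ, 0 < η → ∀ᶠ y in 𝓝 x,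
    (inner ℝ (y - x) ν < -(η * ‖y - x‖) → y ∈ E) ∧
    (η * ‖y - x‖ < inner ℝ (y - x) ν → y ∉ E)

/-- The track of the moving boundary in space-time, for times in `[0, T]`. -/
def boundaryTrack {n : ℕ} (T : ℝ) (E : ℝ → Set (Space n)) : Set (Space n × ℝ) :=
  {p | p.2 ∈ Icc 0 T ∧ p.1 ∈ frontier (E p.2)}

/-- The sets `E t`, `t ∈ [0, T]`, have boundaries that move in a `C¹` way: near every point of
space-time, `E t` is given by the sign of a `C¹` function `u` of `(x, t)`, negative inside and
positive outside, with nonzero spatial gradient at its zeros (points that lie on no boundary are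
included, with `u ≠ 0` there, so that no piece of boundary can appear, disappear or switch sides
abruptly). -/
def IsC1Family {n : ℕ} (T : ℝ) (E : ℝ → Set (Space n)) : Prop :=
  ∀ t₀ ∈ Icc 0 T, ∀ x₀ : Space n, ∃ u : Space n × ℝ → ℝ,
    ContDiff ℝ 1 u ∧
    (u (x₀, t₀) = 0 → fderiv ℝ (fun x => u (x, t₀)) x₀ ≠ 0) ∧
    ∀ᶠ p in 𝓝[univ ×ˢ Icc 0 T] (x₀, t₀),
      (u p < 0 → p.1 ∈ E p.2) ∧ (0 < u p → p.1 ∉ E p.2)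

/-- `E t`, `t ∈ [0, T]`, is a classical solution of `∂ₜ x · ν = -H_s`: the boundaries move in a
`C¹` way, and through every boundary point passes a trajectory `γ` of boundary points whose velocity
at that point has normal component `-H_s`. (The normal component of the velocity is the same for
all such trajectories.) -/
structure IsFracMeanCurvFlow {n : ℕ} (s T : ℝ) (E : ℝ → Set (Space n)) : Prop where
  isC1Family : IsC1Family T E
  motion : ∀ t₀ ∈ Icc 0 T, ∀ x₀ ∈ frontier (E t₀),
    ∃ (ν : Space n) (γ : ℝ → Space n) (v : Space n),
      IsOuterNormal (E t₀) x₀ ν ∧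
      γ t₀ = x₀ ∧
      (∀ᶠ t in 𝓝[Icc 0 T] t₀, γ t ∈ frontier (E t)) ∧
      HasDerivWithinAt γ v (Icc 0 T) t₀ ∧
      inner ℝ v ν = -fracMeanCurv s (E t₀) x₀

/-- In the cylinder of radius and half-height `r` around `x` with axis `ν`, the set `E` is the
subgraph of a `C²` function `g` over the hyperplane orthogonal to `ν`; the graph is tangent to this
hyperplane at `x`, and the second derivative of `g` is bounded by `C`. -/
def IsC2SubgraphAt {n : ℕ} (r C : ℝ) (E : Set (Space n)) (x ν : Space n) : Prop :=
  ‖ν‖ = 1 ∧ ∃ g : (Submodule.span ℝ {ν})ᗮ → ℝ,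
    ContDiffOn ℝ 2 g (Metric.ball 0 r) ∧ g 0 = 0 ∧ fderiv ℝ g 0 = 0 ∧
    (∀ w ∈ Metric.ball 0 r, ‖iteratedFDeriv ℝ 2 g w‖ ≤ C) ∧
    ∀ w ∈ Metric.ball 0 r, ∀ z ∈ Ioo (-r) r,
      (z < g w → x + (w : Space n) + z • ν ∈ E) ∧
      (g w < z → x + (w : Space n) + z • ν ∉ E)

/-- The boundaries of `E t` are uniformly `C²` in space for `t ∈ [0, T]`: one radius `r` and one
bound `C` serve for all times and all boundary points. -/
def UniformlyC2 {n : ℕ} (T : ℝ) (E : ℝ → Set (Space n)) : Prop :=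
  ∃ r C : ℝ, 0 < r ∧ ∀ t ∈ Icc 0 T, ∀ x ∈ frontier (E t),
    ∃ ν : Space n, IsC2SubgraphAt r C (E t) x ν

end FracFlow

end

/-!
On a time interval `[0, τ]` whose length depends only on the regularity of the boundaries, the flow
`F` is compared with its own time shift `F (h + ·)`. Let `X` be a smooth field pointing out of all
the sets `F t`, let `p` be a boundary point of `F τ`, and displace `F t` along `X` by `-h ε` times a
function that is about `1 - t L` near `p` and negative away from `p`. Since the curvature at time
`0` is positive, and bounded below near `p` by compactness, for small `ε` the displaced initial set
contains `F h`; the term with `L`, which pays for the change of curvature caused by the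
displacement, makes this inclusion persist. At time `τ`, letting `h` tend to `0`, one finds that
the normal velocity `-H_s` at `p` is at most a negative multiple of `ε (1 - τ L)`. All time steps
have the same length, so finitely many of them cover `[0, T]`.

The inclusion persists because at a first contact point of the two boundaries the velocities would
be ordered one way and the curvatures, up to an error that the barrier dominates, the other way.
The error is linear in the size of the displacement, as one sees by changing variables in the
singular integral, provided that the displacement varies slowly at large distances. As the
boundaries may be unbounded, a first contact exists only after adding a further displacement that
stays away from zero at infinity but is arbitrarily small at `p`.
-/

noncomputable section

namespace FracFlow

variable {n : ℕ}

section Flatness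

variable {r C K : ℝ} {A : Set (Space n)} {x ν : Space n}

/-- `A` is pinched at `x` between two tangent paraboloids: in the ball of radius `r` around `x`, it
contains what lies below `⟪z, ν⟫ = -K ‖z‖²` and nothing that lies above `⟪z, ν⟫ = K ‖z‖²`. This is
all of the `C²` regularity that the curvature estimates need. -/
def FlatAt (r K : ℝ) (A : Set (Space n)) (x ν : Space n) : Prop :=
  ‖ν‖ = 1 ∧ ∀ z : Space n, ‖z‖ < r →
    (inner ℝ z ν < -(K * ‖z‖ ^ 2) → x + z ∈ A) ∧ (K * ‖z‖ ^ 2 < inner ℝ z ν → x + z ∉ A)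

/-- `A` is flat at all of its boundary points, with the same constants. -/
def UniformlyFlat (r K : ℝ) (A : Set (Space n)) : Prop :=
  ∀ x ∈ frontier A, ∃ ν, FlatAt r K A x ν

theorem abs_le_mul_sq_of_norm_iteratedFDeriv_two_le {V : Type*} [NormedAddCommGroup V]
    [NormedSpace ℝ V] {g : V → ℝ} (hg : ContDiffOn ℝ 2 g (Metric.ball 0 r))
    (hg0 : g 0 = 0) (hg'0 : fderiv ℝ g 0 = 0)
    (hbound : ∀ w ∈ Metric.ball (0 : V) r, ‖iteratedFDeriv ℝ 2 g w‖ ≤ C) {w : V} (hw : ‖w‖ < r) :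
    |g w| ≤ C * ‖w‖ ^ 2 := by
  have hr : 0 < r := (norm_nonneg w).trans_lt hw
  have hC : 0 ≤ C := (norm_nonneg _).trans (hbound 0 (Metric.mem_ball_self hr))
  have hg2 : ∀ v ∈ Metric.ball (0 : V) r, ContDiffAt ℝ 2 g v := fun v hv =>
    hg.contDiffAt (Metric.isOpen_ball.mem_nhds hv)
  have hg' : ∀ v ∈ Metric.ball (0 : V) r, ‖fderiv ℝ g v‖ ≤ C * ‖v‖ := fun v hv => by
    simpa [hg'0] using (convex_ball (0 : V) r).norm_image_sub_le_of_norm_fderiv_le (𝕜 := ℝ)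
      (f := fderiv ℝ g) (C := C)
      (fun u hu => ((hg2 u hu).fderiv_right (m := 1) (by norm_num)).differentiableAt (by simp))
      (fun u hu => by
        rw [← norm_iteratedFDeriv_one, norm_iteratedFDeriv_fderiv]
        exact hbound u hu) (Metric.mem_ball_self hr) hv
  have := (convex_closedBall (0 : V) ‖w‖).norm_image_sub_le_of_norm_fderiv_le (𝕜 := ℝ)
    (f := g) (C := C * ‖w‖) (x := 0) (y := w)
    (fun u hu => (hg2 u (Metric.closedBall_subset_ball hw hu)).differentiableAt (by simp))
    (fun u hu => (hg' u (Metric.closedBall_subset_ball hw hu)).trans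
      (by gcongr; simpa using hu)) (by simp) (by simp)
  simpa [hg0, pow_two, mul_assoc] using this

theorem IsC2SubgraphAt.flatAt (h : IsC2SubgraphAt r C A x ν) : FlatAt r |C| A x ν := by
  obtain ⟨hν, g, hg, hg0, hg'0, hg2, hA⟩ := h
  refine ⟨hν, fun z hz => ?_⟩
  set w := (Submodule.span ℝ {ν})ᗮ.orthogonalProjectionOnto z
  have hwz : ‖w‖ ≤ ‖z‖ := Submodule.norm_orthogonalProjectionOnto_apply_le _ z
  have hdecomp : x + (w : Space n) + inner ℝ z ν • ν = x + z := by
    rw [add_assoc, add_comm (w : Space n), ← real_inner_comm,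
      ← Submodule.starProjection_unit_singleton ℝ hν z,
      Submodule.coe_orthogonalProjectionOnto_apply,
      Submodule.starProjection_add_starProjection_orthogonal]
  have hgw : |g w| ≤ |C| * ‖z‖ ^ 2 :=
    (abs_le_mul_sq_of_norm_iteratedFDeriv_two_le hg hg0 hg'0
      (fun u hu => (hg2 u hu).trans (le_abs_self C)) (hwz.trans_lt hz)).trans (by gcongr)
  have hheight : |inner ℝ z ν| < r :=
    (abs_real_inner_le_norm z ν).trans_lt (by rwa [hν, mul_one])
  have hmem := hA w (by simpa using hwz.trans_lt hz) _ (abs_lt.1 hheight)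
  rw [hdecomp] at hmem
  exact ⟨fun hlt => hmem.1 (by linarith [neg_abs_le (g w)]),
    fun hlt => hmem.2 (by linarith [le_abs_self (g w)])⟩

theorem FlatAt.dim_pos (h : FlatAt r K A x ν) : 0 < n := by
  rcases Nat.eq_zero_or_pos n with rfl | hn
  · simpa [Subsingleton.elim ν 0] using h.1
  · exact hn

theorem FlatAt.compl (h : FlatAt r K A x ν) : FlatAt r K Aᶜ x (-ν) := by
  refine ⟨by rw [norm_neg, h.1], fun z hz => ?_⟩
  rw [inner_neg_right]
  exact ⟨fun hlt => (h.2 z hz).2 (by linarith),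
    fun hlt => not_not.2 ((h.2 z hz).1 (by linarith))⟩

theorem FlatAt.inner_le_of_mem_closure {y : Space n} (h : FlatAt r K A x ν) (hy : y ∈ closure A)
    (hr : ‖y - x‖ < r) : inner ℝ (y - x) ν ≤ K * ‖y - x‖ ^ 2 := by
  by_contra! hlt
  have ho : IsOpen ({w | ‖w - x‖ < r} ∩ {w | K * ‖w - x‖ ^ 2 < inner ℝ (w - x) ν}) :=
    (isOpen_lt (by fun_prop) (by fun_prop)).inter (isOpen_lt (by fun_prop) (by fun_prop))
  obtain ⟨w, hw, hwA⟩ := mem_closure_iff.1 hy _ ho ⟨hr, hlt⟩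
  exact (h.2 (w - x) hw.1).2 hw.2 (by rwa [add_sub_cancel])

theorem FlatAt.le_inner_of_mem_closure_compl {y : Space n} (h : FlatAt r K A x ν)
    (hy : y ∈ closure Aᶜ) (hr : ‖y - x‖ < r) : -(K * ‖y - x‖ ^ 2) ≤ inner ℝ (y - x) ν := by
  have := h.compl.inner_le_of_mem_closure hy hr
  rw [inner_neg_right] at this
  linarith

theorem FlatAt.isOuterNormal (hr : 0 < r) (h : FlatAt r K A x ν) : IsOuterNormal A x ν := by
  refine ⟨h.1, fun η hη => ?_⟩
  have hpos : 0 < min r (η / (|K| + 1)) := lt_min hr (by positivity)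
  filter_upwards [Metric.ball_mem_nhds x hpos] with y hy
  rw [Metric.mem_ball, dist_eq_norm, lt_min_iff, lt_div_iff₀ (by positivity)] at hy
  have hK : K * ‖y - x‖ ≤ η := by nlinarith [le_abs_self K, norm_nonneg (y - x)]
  have hcone : K * ‖y - x‖ ^ 2 ≤ η * ‖y - x‖ := by nlinarith [norm_nonneg (y - x)]
  have hmem := h.2 (y - x) hy.1
  rw [add_sub_cancel] at hmem
  exact ⟨fun hlt => hmem.1 (by linarith), fun hlt => hmem.2 (by linarith)⟩

end Flatness

theorem inner_sub_pos_and_neg_of_ne {V : Type*} [NormedAddCommGroup V] [InnerProductSpace ℝ V]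
    {ν ν' : V} (h : ‖ν‖ = 1) (h' : ‖ν'‖ = 1) (hne : ν ≠ ν') :
    0 < inner ℝ (ν - ν') ν ∧ inner ℝ (ν - ν') ν' < 0 := by
  have hlt : inner ℝ ν ν' < (1 : ℝ) := (inner_lt_one_iff_real_of_norm_eq_one h h').2 hne
  rw [inner_sub_left, inner_sub_left, real_inner_self_eq_norm_sq, real_inner_self_eq_norm_sq, h, h',
    real_inner_comm]
  constructor <;> linarith

theorem tendsto_id_nhdsGT_zero : Tendsto (fun ε : ℝ => ε) (𝓝[>] 0) (𝓝 0) :=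
  tendsto_id.mono_left nhdsWithin_le_nhds

namespace IsOuterNormal

variable {A : Set (Space n)} {x ν ν' : Space n}

theorem eventually_mem_interior (h : IsOuterNormal A x ν) {ι : Type*} {l : Filter ι} {ε : ι → ℝ}
    {d : ι → Space n} {d₀ : Space n} (hε : ∀ᶠ i in l, 0 < ε i) (hε0 : Tendsto ε l (𝓝 0))
    (hd : Tendsto d l (𝓝 d₀)) (hd₀ : inner ℝ d₀ ν < 0) :
    ∀ᶠ i in l, x + ε i • d i ∈ interior A := by
  set η : ℝ := -inner ℝ d₀ ν / (2 * (‖d₀‖ + 1)) with hηdef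
  have hη : 0 < η := div_pos (by linarith) (by positivity)
  have hlim : Tendsto (fun i => x + ε i • d i) l (𝓝 x) := by
    simpa using tendsto_const_nhds.add (hε0.smul hd)
  have hcone : ∀ᶠ i in l, inner ℝ (d i) ν < -(η * ‖d i‖) := by
    refine (hd.inner tendsto_const_nhds).eventually_lt (hd.norm.const_mul η).neg ?_
    have : η * ‖d₀‖ < -inner ℝ d₀ ν := by
      rw [hηdef, div_mul_eq_mul_div, div_lt_iff₀ (by positivity)]
      nlinarith [norm_nonneg d₀]
    linarith
  filter_upwards [hlim.eventually (h.2 η hη).eventually_nhds, hε, hcone] with i hnear hεi hdi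
  have ho : IsOpen {y : Space n | inner ℝ (y - x) ν < -(η * ‖y - x‖)} :=
    isOpen_lt (by fun_prop) (by fun_prop)
  have hmem : x + ε i • d i ∈ {y : Space n | inner ℝ (y - x) ν < -(η * ‖y - x‖)} := by
    simp only [mem_ofPred_eq, add_sub_cancel_left, inner_smul_left, norm_smul, Real.norm_eq_abs,
      abs_of_pos hεi, RCLike.conj_to_real]
    nlinarith
  rw [mem_interior_iff_mem_nhds]
  filter_upwards [hnear, ho.mem_nhds hmem] with y hy hyc
  exact hy.1 hyc

theorem compl (h : IsOuterNormal A x ν) : IsOuterNormal Aᶜ x (-ν) := by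
  refine ⟨by rw [norm_neg, h.1], fun η hη => ?_⟩
  filter_upwards [h.2 η hη] with y hy
  rw [inner_neg_right]
  exact ⟨fun hlt => hy.2 (by linarith), fun hlt => not_not.2 (hy.1 (by linarith))⟩

theorem eventually_add_smul_mem_interior {d : Space n} (h : IsOuterNormal A x ν)
    (hd : inner ℝ d ν < 0) : ∀ᶠ ε : ℝ in 𝓝[>] 0, x + ε • d ∈ interior A :=
  h.eventually_mem_interior eventually_mem_nhdsWithin tendsto_id_nhdsGT_zero tendsto_const_nhds hd

theorem eventually_add_smul_mem_interior_compl {d : Space n} (h : IsOuterNormal A x ν)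
    (hd : 0 < inner ℝ d ν) : ∀ᶠ ε : ℝ in 𝓝[>] 0, x + ε • d ∈ interior Aᶜ :=
  h.compl.eventually_add_smul_mem_interior (by rwa [inner_neg_right, neg_lt_zero])

theorem unique (h : IsOuterNormal A x ν) (h' : IsOuterNormal A x ν') : ν = ν' := by
  by_contra hne
  obtain ⟨hpos, hneg⟩ := inner_sub_pos_and_neg_of_ne h.1 h'.1 hne
  obtain ⟨ε, hout, hin⟩ := ((h.eventually_add_smul_mem_interior_compl hpos).and
    (h'.eventually_add_smul_mem_interior hneg)).exists
  exact interior_subset hout (interior_subset hin)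

end IsOuterNormal

theorem eq_mul_inner_of_nonneg_on_halfspace {V : Type*} [NormedAddCommGroup V]
    [InnerProductSpace ℝ V] {ν : V} (hν : ‖ν‖ = 1) (l : V →ₗ[ℝ] ℝ)
    (h : ∀ d, 0 < inner ℝ d ν → 0 ≤ l d) (d : V) : l d = l ν * inner ℝ d ν := by
  have hνν : inner ℝ ν ν = (1 : ℝ) := by rw [real_inner_self_eq_norm_sq, hν, one_pow]
  have hker : ∀ e : V, inner ℝ e ν = (0 : ℝ) → l e = 0 := by
    intro e he
    by_contra hne
    have := h (ν + (-(l ν + 1) / l e) • e) (by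
      rw [inner_add_left, inner_smul_left, he, hνν]; norm_num)
    rw [map_add, map_smul, smul_eq_mul, div_mul_cancel₀ _ hne] at this
    linarith
  have := hker (d - inner ℝ d ν • ν) (by
    rw [inner_sub_left, real_inner_smul_left, hνν, mul_one, sub_self])
  rw [map_sub, map_smul, smul_eq_mul] at this
  linarith

theorem exists_orthonormalBasis_apply_eq {ν : Space n} (hν : ‖ν‖ = 1) (i : Fin n) :
    ∃ b : OrthonormalBasis (Fin n) ℝ (Space n), b i = ν := by
  obtain ⟨b, hb⟩ := Orthonormal.exists_orthonormalBasis_extension_of_card_eq (𝕜 := ℝ)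
    (E := Space n) (ι := Fin n) (by simp) (v := fun _ => ν) (s := {i})
    ⟨fun _ => hν, fun j k hjk => absurd (Subsingleton.elim j k) hjk⟩
  exact ⟨b, hb i rfl⟩

theorem volume_setOf_abs_repr_le_eq (b : OrthonormalBasis (Fin n) ℝ (Space n)) {f : Fin n → ℝ}
    (hf : ∀ i, 0 ≤ f i) :
    volume {z | ∀ i, |b.repr z i| ≤ f i} = ENNReal.ofReal (∏ i, 2 * f i) := by
  have hbox : {z | ∀ i, |b.repr z i| ≤ f i} =
      b.repr ⁻¹' ((MeasurableEquiv.toLp 2 (Fin n → ℝ)).symm ⁻¹' Icc (-f) f) := by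
    ext z
    simp only [mem_ofPred_eq, abs_le, mem_preimage, mem_Icc, Pi.le_def, ← forall_and]
    rfl
  rw [hbox, b.measurePreserving_repr.measure_preimage
      (((MeasurableEquiv.toLp 2 (Fin n → ℝ)).symm.measurable measurableSet_Icc).nullMeasurableSet),
    (EuclideanSpace.volume_preserving_symm_measurableEquiv_toLp (Fin n)).measure_preimage
      measurableSet_Icc.nullMeasurableSet, Real.volume_Icc_pi,
    ← ENNReal.ofReal_prod_of_nonneg fun i _ => by
      rw [Pi.neg_apply, sub_neg_eq_add]; exact add_nonneg (hf i) (hf i)]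
  simp only [Pi.neg_apply, sub_neg_eq_add, two_mul]

theorem volume_slab_le {ν : Space n} (hν : ‖ν‖ = 1) {ρ η : ℝ} (hρ : 0 ≤ ρ) (hη : 0 ≤ η) :
    volume {z : Space n | ‖z‖ ≤ ρ ∧ |inner ℝ z ν| ≤ η}
      ≤ ENNReal.ofReal (2 * η * (2 * ρ) ^ (n - 1)) := by
  cases n with
  | zero => simp [Subsingleton.elim ν 0] at hν
  | succ m =>
    obtain ⟨b, rfl⟩ := exists_orthonormalBasis_apply_eq hν 0
    have hsub : {z : Space (m + 1) | ‖z‖ ≤ ρ ∧ |inner ℝ z (b 0)| ≤ η} ⊆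
        {z | ∀ i, |b.repr z i| ≤ Fin.cons (α := fun _ => ℝ) η (fun _ => ρ) i} := by
      rintro z ⟨hzρ, hzη⟩ i
      rw [b.repr_apply_apply]
      refine Fin.cases ?_ (fun j => ?_) i
      · rwa [Fin.cons_zero, real_inner_comm]
      · rw [Fin.cons_succ]
        simpa using (abs_real_inner_le_norm (b j.succ) z).trans (by simpa using hzρ)
    refine (measure_mono hsub).trans_eq ?_
    rw [volume_setOf_abs_repr_le_eq b fun i => Fin.cases hη (fun _ => hρ) i, Fin.prod_univ_succ]
    simp

section PowerSingularity

theorem setOf_lt_rpow_neg_norm_subset_ball {V : Type*} [SeminormedAddGroup V] {q t : ℝ}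
    (hq : 0 < q) (ht : 0 < t) : {z : V | t < ‖z‖ ^ (-q)} ⊆ Metric.ball 0 (t ^ (-q⁻¹)) := by
  intro z hz
  rw [mem_ball_zero_iff]
  by_contra! hle
  have := Real.rpow_le_rpow_of_nonpos (by positivity) hle (neg_nonpos.2 hq.le)
  rw [← Real.rpow_mul ht.le, neg_mul_neg, inv_mul_cancel₀ hq.ne', Real.rpow_one] at this
  exact this.not_gt hz

variable {V : Type*} [NormedAddCommGroup V] [MeasurableSpace V] [BorelSpace V]
  {μ : Measure V} {c p q : ℝ}

theorem lintegral_rpow_neg_ball_le (hc : 0 ≤ c) (hq : 0 < q) (hqp : q < p)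
    (hμ : ∀ ρ : ℝ, 0 < ρ → ρ ≤ 1 → μ (Metric.ball 0 ρ) ≤ ENNReal.ofReal (c * ρ ^ p)) :
    ∫⁻ z in Metric.ball 0 1, ENNReal.ofReal (‖z‖ ^ (-q)) ∂μ
      ≤ ENNReal.ofReal (c * (p / (p - q))) := by
  have : 0 < p := hq.trans hqp
  have hexp : -(p / q) < -1 := neg_lt_neg ((one_lt_div hq).2 hqp)
  have hlow : ∀ t ∈ Ioc (0 : ℝ) 1,
      μ.restrict (Metric.ball 0 1) {z | t < ‖z‖ ^ (-q)} ≤ ENNReal.ofReal c := fun t _ => by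
    refine (measure_mono (subset_univ _)).trans ?_
    simpa using hμ 1 one_pos le_rfl
  have hhigh : ∀ t ∈ Ioi (1 : ℝ), μ.restrict (Metric.ball 0 1) {z | t < ‖z‖ ^ (-q)} ≤
      ENNReal.ofReal (c * t ^ (-(p / q))) := fun t (ht : 1 < t) => by
    have ht0 : 0 < t := one_pos.trans ht
    refine (Measure.restrict_le_self _).trans
      ((measure_mono (setOf_lt_rpow_neg_norm_subset_ball hq ht0)).trans ?_)
    refine (hμ _ (by positivity)
      (Real.rpow_le_one_of_one_le_of_nonpos ht.le (by simpa using hq.le))).trans_eq ?_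
    rw [← Real.rpow_mul ht0.le, neg_mul, inv_mul_eq_div]
  calc ∫⁻ z in Metric.ball 0 1, ENNReal.ofReal (‖z‖ ^ (-q)) ∂μ
      = ∫⁻ t in Ioc 0 1 ∪ Ioi 1, μ.restrict (Metric.ball 0 1) {z | t < ‖z‖ ^ (-q)} := by
        rw [lintegral_eq_lintegral_meas_lt _ (ae_of_all _ fun z => by positivity) (by fun_prop),
          Ioc_union_Ioi_eq_Ioi zero_le_one]
    _ ≤ (∫⁻ _ in Ioc (0 : ℝ) 1, ENNReal.ofReal c) +
          ∫⁻ t in Ioi (1 : ℝ), ENNReal.ofReal (c * t ^ (-(p / q))) :=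
        (lintegral_union_le _ _ _).trans (add_le_add (setLIntegral_mono' measurableSet_Ioc hlow)
          (setLIntegral_mono' measurableSet_Ioi hhigh))
    _ = ENNReal.ofReal (c * (p / (p - q))) := by
        have hint : 0 ≤ -1 / (-(p / q) + 1) :=
          div_nonneg_of_nonpos (by norm_num) (by linarith)
        rw [setLIntegral_const, Real.volume_Ioc, ← ofReal_integral_eq_lintegral_ofReal
            ((integrableOn_Ioi_rpow_of_lt hexp one_pos).const_mul c)
            (ae_restrict_of_forall_mem measurableSet_Ioi fun t (ht : 1 < t) => by
              have := one_pos.trans ht; positivity),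
          integral_const_mul, integral_Ioi_rpow_of_lt hexp one_pos, Real.one_rpow, sub_zero,
          ENNReal.ofReal_one, mul_one, ← ENNReal.ofReal_add hc (mul_nonneg hc hint)]
        have hpq : p - q ≠ 0 := (sub_pos.2 hqp).ne'
        have hqp' : -(p / q) + 1 ≠ 0 := by linarith
        congr 1
        have : -1 / (-(p / q) + 1) = q / (p - q) := by
          rw [div_eq_div_iff hqp' hpq]; field_simp; ring
        rw [this]; field_simp; ring

theorem integrableOn_rpow_neg_ball_of_measure_ball_le (hc : 0 ≤ c) (hq : 0 < q) (hqp : q < p)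
    (hμ : ∀ ρ : ℝ, 0 < ρ → ρ ≤ 1 → μ (Metric.ball 0 ρ) ≤ ENNReal.ofReal (c * ρ ^ p)) :
    IntegrableOn (fun z => ‖z‖ ^ (-q)) (Metric.ball 0 1) μ := by
  refine ⟨Measurable.aestronglyMeasurable (by fun_prop), ?_⟩
  rw [hasFiniteIntegral_iff_ofReal (ae_of_all _ fun z => by positivity)]
  exact (lintegral_rpow_neg_ball_le hc hq hqp hμ).trans_lt ENNReal.ofReal_lt_top

theorem setIntegral_rpow_neg_ball_le (hc : 0 ≤ c) (hq : 0 < q) (hqp : q < p)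
    (hμ : ∀ ρ : ℝ, 0 < ρ → ρ ≤ 1 → μ (Metric.ball 0 ρ) ≤ ENNReal.ofReal (c * ρ ^ p)) :
    ∫ z in Metric.ball 0 1, ‖z‖ ^ (-q) ∂μ ≤ c * (p / (p - q)) := by
  rw [integral_eq_lintegral_of_nonneg_ae (ae_of_all _ fun z => by positivity)
    (Measurable.aestronglyMeasurable (by fun_prop))]
  exact ENNReal.toReal_le_of_le_ofReal
    (mul_nonneg hc (div_nonneg (hq.trans hqp).le (sub_pos.2 hqp).le))
    (lintegral_rpow_neg_ball_le hc hq hqp hμ)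

end PowerSingularity

theorem integrableOn_rpow_neg_ball {q : ℝ} (hq : 0 < q) (hqn : q < n) :
    IntegrableOn (fun z : Space n => ‖z‖ ^ (-q)) (Metric.ball 0 1) := by
  refine integrableOn_rpow_neg_ball_of_measure_ball_le (p := n)
    (c := volume.real (Metric.ball (0 : Space n) 1)) measureReal_nonneg hq hqn fun ρ hρ _ => ?_
  rw [Measure.addHaar_ball_of_pos volume 0 hρ, finrank_euclideanSpace_fin,
    ENNReal.ofReal_mul measureReal_nonneg, ofReal_measureReal, Real.rpow_natCast, mul_comm]

theorem integrableOn_rpow_neg_compl_ball {q δ : ℝ} (hq : (n : ℝ) < q) (hδ : 0 < δ) :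
    IntegrableOn (fun z : Space n => ‖z‖ ^ (-q)) (Metric.ball 0 δ)ᶜ := by
  have hdom : Integrable (fun z : Space n => (1 + δ⁻¹) ^ q * (1 + ‖z‖) ^ (-q)) :=
    (integrable_one_add_norm (by simpa using hq)).const_mul _
  refine hdom.integrableOn.mono' (Measurable.aestronglyMeasurable (by fun_prop)) ?_
  refine ae_restrict_of_forall_mem measurableSet_ball.compl fun z hz => ?_
  have hδz : δ ≤ ‖z‖ := by rwa [mem_compl_iff, mem_ball_zero_iff, not_lt] at hz
  have hz0 : 0 < ‖z‖ := hδ.trans_le hδz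
  have hle : 1 + ‖z‖ ≤ (1 + δ⁻¹) * ‖z‖ := by
    have : 1 ≤ δ⁻¹ * ‖z‖ := by rwa [inv_mul_eq_div, one_le_div hδ]
    linarith
  rw [Real.norm_of_nonneg (by positivity), Real.rpow_neg hz0.le, Real.rpow_neg (by positivity),
    ← div_eq_mul_inv, ← one_div, div_le_div_iff₀ (by positivity) (by positivity), one_mul,
    ← Real.mul_rpow (by positivity) hz0.le]
  exact Real.rpow_le_rpow (by positivity) hle ((Nat.cast_nonneg n).trans hq.le)

theorem FlatAt.volume_frontier_inter_closedBall_le {r K ρ : ℝ} {A : Set (Space n)} {x ν : Space n}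
    (h : FlatAt r K A x ν) (hK : 0 ≤ K) (hρ : 0 ≤ ρ) (hρr : ρ < r) :
    volume (frontier A ∩ Metric.closedBall x ρ) ≤
      ENNReal.ofReal (2 * (K * ρ ^ 2) * (2 * ρ) ^ (n - 1)) := by
  have hsub : frontier A ∩ Metric.closedBall x ρ ⊆
      (fun y => y + -x) ⁻¹' {z : Space n | ‖z‖ ≤ ρ ∧ |inner ℝ z ν| ≤ K * ρ ^ 2} := by
    rintro y ⟨hyF, hy⟩
    rw [Metric.mem_closedBall, dist_eq_norm] at hy
    rw [frontier_eq_closure_inter_closure] at hyF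
    have hup := h.inner_le_of_mem_closure hyF.1 (hy.trans_lt hρr)
    have hlow := h.le_inner_of_mem_closure_compl hyF.2 (hy.trans_lt hρr)
    have hKρ : K * ‖y - x‖ ^ 2 ≤ K * ρ ^ 2 := by gcongr
    rw [mem_preimage, ← sub_eq_add_neg]
    exact ⟨hy, abs_le.2 ⟨by linarith, by linarith⟩⟩
  refine (measure_mono hsub).trans ?_
  rw [measure_preimage_add_right]
  exact volume_slab_le h.1 hρ (by positivity)

/-- At a density point the frontier would fill small balls, while flatness confines it to slabs of
relative volume `O(ρ)`. -/
theorem UniformlyFlat.volume_frontier {r K : ℝ} {A : Set (Space n)} (h : UniformlyFlat r K A)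
    (hr : 0 < r) (hK : 0 ≤ K) : volume (frontier A) = 0 := by
  rw [← Measure.restrict_eq_zero, ← ae_eq_bot, ← Filter.eventually_false_iff_eq_bot]
  filter_upwards [Besicovitch.ae_tendsto_measure_inter_div volume (frontier A),
    ae_restrict_mem isClosed_frontier.measurableSet] with x hdensity hxF
  obtain ⟨ν, hν⟩ := h x hxF
  set v := volume (Metric.ball (0 : Space n) 1)
  have hv : v ≠ 0 := (Metric.measure_ball_pos _ _ one_pos).ne'
  have hle : ∀ᶠ ρ : ℝ in 𝓝[>] 0,
      volume (frontier A ∩ Metric.closedBall x ρ) / volume (Metric.closedBall x ρ) ≤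
        ENNReal.ofReal (2 * K * 2 ^ (n - 1) * ρ) / v := by
    filter_upwards [Ioo_mem_nhdsGT hr] with ρ ⟨hρ, hρr⟩
    have hslab := hν.volume_frontier_inter_closedBall_le hK hρ.le hρr
    have hpow : 2 * (K * ρ ^ 2) * (2 * ρ) ^ (n - 1) = ρ ^ n * (2 * K * 2 ^ (n - 1) * ρ) := by
      obtain ⟨m, rfl⟩ := Nat.exists_eq_add_one.2 hν.dim_pos
      rw [Nat.add_sub_cancel, mul_pow]; ring
    rw [hpow, ENNReal.ofReal_mul (by positivity)] at hslab
    rw [Measure.addHaar_closedBall _ _ hρ.le, finrank_euclideanSpace_fin]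
    refine (ENNReal.div_le_div_right hslab _).trans_eq ?_
    exact ENNReal.mul_div_mul_left _ _ (ENNReal.ofReal_pos.2 (by positivity)).ne'
      ENNReal.ofReal_ne_top
  have hlim : Tendsto (fun ρ : ℝ => ENNReal.ofReal (2 * K * 2 ^ (n - 1) * ρ) / v) (𝓝[>] 0)
      (𝓝 0) := by
    simpa using ENNReal.Tendsto.div_const
      (ENNReal.tendsto_ofReal (tendsto_id_nhdsGT_zero.const_mul (2 * K * 2 ^ (n - 1)))) (Or.inr hv)
  exact absurd (le_of_tendsto_of_tendsto hdensity hlim hle) (by simp)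

section SignedIndicator

variable {A : Set (Space n)} {x y z ν : Space n}

theorem signedIndicator_of_mem (h : y ∈ A) : signedIndicator A y = -1 := by
  simp [signedIndicator, h]

theorem signedIndicator_of_notMem (h : y ∉ A) : signedIndicator A y = 1 := by
  simp [signedIndicator, h]

theorem abs_signedIndicator (A : Set (Space n)) (y : Space n) : |signedIndicator A y| = 1 := by
  by_cases h : y ∈ A
  · simp [signedIndicator_of_mem h]
  · simp [signedIndicator_of_notMem h]

theorem continuousAt_signedIndicator (h : y ∉ frontier A) :
    ContinuousAt (signedIndicator A) y :=
  (continuousOn_const.continuousAt_indicator (by rwa [frontier_compl])).sub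
    (continuousOn_const.continuousAt_indicator h)

theorem aestronglyMeasurable_signedIndicator_add (hA : NullMeasurableSet A) (x : Space n) :
    AEStronglyMeasurable (fun z => signedIndicator A (x + z)) volume :=
  ((aestronglyMeasurable_const.indicator₀ hA.compl).sub
    (aestronglyMeasurable_const.indicator₀ hA)).comp_quasiMeasurePreserving
    (quasiMeasurePreserving_add_left volume x)

theorem integrable_signedIndicator_add_mul (hA : NullMeasurableSet A) (x : Space n)
    {m : Space n → ℝ} (hm : Integrable m) :
    Integrable fun z => signedIndicator A (x + z) * m z :=
  hm.bdd_mul (c := 1) (aestronglyMeasurable_signedIndicator_add hA x)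
    (ae_of_all _ fun z => (abs_signedIndicator A (x + z)).le)

/-- The sum of the signed indicator at the two points `x ± z`. It vanishes for most small `z` when
`x` is a boundary point, which turns the principal value into an absolutely convergent integral. -/
def symIndicator (A : Set (Space n)) (x z : Space n) : ℝ :=
  signedIndicator A (x + z) + signedIndicator A (x - z)

theorem abs_symIndicator_le (A : Set (Space n)) (x z : Space n) : |symIndicator A x z| ≤ 2 := by
  refine (abs_add_le _ _).trans ?_
  rw [abs_signedIndicator, abs_signedIndicator, one_add_one_eq_two]

theorem aestronglyMeasurable_symIndicator (hA : NullMeasurableSet A) (x : Space n) :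
    AEStronglyMeasurable (symIndicator A x) volume := by
  have hadd := aestronglyMeasurable_signedIndicator_add hA x
  refine hadd.add ((hadd.comp_quasiMeasurePreserving
    (Measure.measurePreserving_neg volume).quasiMeasurePreserving).congr (ae_of_all _ fun z => ?_))
  simp only [Function.comp_apply, sub_eq_add_neg]

theorem integral_eq_half_integral_add_comp_neg {f : Space n → ℝ} (hf : Integrable f) :
    ∫ z, f z = 2⁻¹ * ∫ z, (f z + f (-z)) := by
  rw [integral_add hf hf.comp_neg, integral_neg_eq_self f, ← two_mul,
    inv_mul_cancel_left₀ two_ne_zero]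

theorem integral_signedIndicator_mul_even {m : Space n → ℝ} (hm : ∀ z, m (-z) = m z)
    (hi : Integrable fun z => signedIndicator A (x + z) * m z) :
    ∫ z, signedIndicator A (x + z) * m z = 2⁻¹ * ∫ z, symIndicator A x z * m z := by
  simp only [integral_eq_half_integral_add_comp_neg hi, hm, symIndicator, add_mul, sub_eq_add_neg]

end SignedIndicator

section SymmetrizedIntegral

variable {r K s : ℝ} {A : Set (Space n)} {x z ν : Space n}

/-- The points at which the symmetrized indicator of a set that is flat in the direction `ν` can be
nonzero: those outside the ball of radius `r` and those between the two paraboloids. -/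
def cuspRegion (r K : ℝ) (ν : Space n) : Set (Space n) :=
  {z | ‖z‖ < r → |inner ℝ z ν| ≤ K * ‖z‖ ^ 2}

theorem FlatAt.symIndicator_eq_zero (h : FlatAt r K A x ν) (hz : z ∉ cuspRegion r K ν) :
    symIndicator A x z = 0 := by
  obtain ⟨hzr, hzK⟩ := Classical.not_imp.1 hz
  have hpos := h.2 z hzr
  have hneg := h.2 (-z) (by rwa [norm_neg])
  rw [norm_neg, inner_neg_left, ← sub_eq_add_neg] at hneg
  rcases lt_abs.1 (not_le.1 hzK) with habove | hbelow
  · rw [symIndicator, signedIndicator_of_notMem (hpos.2 habove),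
      signedIndicator_of_mem (hneg.1 (neg_lt_neg habove)), add_neg_cancel]
  · rw [symIndicator, signedIndicator_of_mem (hpos.1 (lt_neg.1 hbelow)),
      signedIndicator_of_notMem (hneg.2 hbelow), neg_add_cancel]

theorem volume_paraboloid_inter_ball_le (hν : ‖ν‖ = 1) (hK : 0 ≤ K) {ρ : ℝ} (hρ : 0 < ρ) :
    volume ({z : Space n | |inner ℝ z ν| ≤ K * ‖z‖ ^ 2} ∩ Metric.ball 0 ρ) ≤
      ENNReal.ofReal (2 * K * 2 ^ (n - 1) * ρ ^ ((n : ℝ) + 1)) := by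
  have hsub : {z : Space n | |inner ℝ z ν| ≤ K * ‖z‖ ^ 2} ∩ Metric.ball 0 ρ ⊆
      {z : Space n | ‖z‖ ≤ ρ ∧ |inner ℝ z ν| ≤ K * ρ ^ 2} := by
    rintro z ⟨hzK, hz⟩
    rw [mem_ball_zero_iff] at hz
    exact ⟨hz.le, (mem_ofPred_eq ▸ hzK).trans (by gcongr)⟩
  refine (measure_mono hsub).trans ((volume_slab_le hν hρ.le (by positivity)).trans_eq ?_)
  cases n with
  | zero => simp [Subsingleton.elim ν 0] at hν
  | succ m =>
    rw [show ((m + 1 : ℕ) : ℝ) + 1 = ((m + 2 : ℕ) : ℝ) by push_cast; ring, Real.rpow_natCast,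
      Nat.add_sub_cancel, mul_pow]
    ring_nf

theorem integrableOn_paraboloid_and_setIntegral_le (hs : s ∈ Ioo (0 : ℝ) 1) (hν : ‖ν‖ = 1)
    (hK : 0 ≤ K) :
    IntegrableOn (fun z => ‖z‖ ^ (-((n : ℝ) + s)))
      (Metric.ball 0 1 ∩ {z : Space n | |inner ℝ z ν| ≤ K * ‖z‖ ^ 2}) ∧
    ∫ z in Metric.ball 0 1 ∩ {z : Space n | |inner ℝ z ν| ≤ K * ‖z‖ ^ 2},
      ‖z‖ ^ (-((n : ℝ) + s)) ≤ 2 * K * 2 ^ (n - 1) * ((n + 1) / (1 - s)) := by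
  have hq : 0 < (n : ℝ) + s := add_pos_of_nonneg_of_pos (Nat.cast_nonneg n) hs.1
  have hq' : (n : ℝ) + s < n + 1 := by simpa using hs.2
  have hc : 0 ≤ 2 * K * 2 ^ (n - 1) := by positivity
  have hvol (ρ : ℝ) (hρ : 0 < ρ) (_ : ρ ≤ 1) :
      volume.restrict {z : Space n | |inner ℝ z ν| ≤ K * ‖z‖ ^ 2} (Metric.ball 0 ρ) ≤
        ENNReal.ofReal (2 * K * 2 ^ (n - 1) * ρ ^ ((n : ℝ) + 1)) := by
    rw [Measure.restrict_apply measurableSet_ball, inter_comm]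
    exact volume_paraboloid_inter_ball_le hν hK hρ
  rw [IntegrableOn, ← Measure.restrict_restrict measurableSet_ball,
    ← add_sub_add_left_eq_sub (1 : ℝ) s n]
  exact ⟨integrableOn_rpow_neg_ball_of_measure_ball_le hc hq hq' hvol,
    setIntegral_rpow_neg_ball_le hc hq hq' hvol⟩

theorem cuspRegion_subset (r K : ℝ) (ν : Space n) :
    cuspRegion r K ν ⊆ (Metric.ball 0 1 ∩ {z : Space n | |inner ℝ z ν| ≤ K * ‖z‖ ^ 2}) ∪
      (Metric.ball 0 (min r 1))ᶜ := fun z hz => by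
  by_cases hzr : ‖z‖ < min r 1
  · exact Or.inl ⟨mem_ball_zero_iff.2 (hzr.trans_le (min_le_right _ _)),
      hz (hzr.trans_le (min_le_left _ _))⟩
  · exact Or.inr (by rwa [mem_compl_iff, mem_ball_zero_iff])

theorem exists_setIntegral_cuspRegion_le (n : ℕ) (hs : s ∈ Ioo (0 : ℝ) 1) (hr : 0 < r)
    (hK : 0 ≤ K) : ∃ C : ℝ, 0 ≤ C ∧ ∀ ν : Space n, ‖ν‖ = 1 →
      IntegrableOn (fun z => ‖z‖ ^ (-((n : ℝ) + s))) (cuspRegion r K ν) ∧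
      ∫ z in cuspRegion r K ν, ‖z‖ ^ (-((n : ℝ) + s)) ≤ C := by
  have hnonneg : ∀ z : Space n, 0 ≤ ‖z‖ ^ (-((n : ℝ) + s)) := fun z => by positivity
  have hfar := integrableOn_rpow_neg_compl_ball (n := n) (lt_add_of_pos_right _ hs.1)
    (lt_min hr one_pos)
  refine ⟨2 * K * 2 ^ (n - 1) * ((n + 1) / (1 - s)) +
      ∫ z in (Metric.ball (0 : Space n) (min r 1))ᶜ, ‖z‖ ^ (-((n : ℝ) + s)),
    add_nonneg (mul_nonneg (by positivity) (div_nonneg (by positivity) (sub_pos.2 hs.2).le))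
      (integral_nonneg hnonneg), fun ν hν => ?_⟩
  obtain ⟨hnear, hnear_le⟩ := integrableOn_paraboloid_and_setIntegral_le hs hν hK
  have hunion := hnear.union hfar
  refine ⟨hunion.mono_set (cuspRegion_subset r K ν), ?_⟩
  refine (setIntegral_mono_set hunion (ae_of_all _ hnonneg)
    (cuspRegion_subset r K ν).eventuallyLE).trans ?_
  refine (integral_mono_measure (Measure.restrict_union_le _ _)
    (ae_of_all _ hnonneg) (hnear.integrable.add_measure hfar.integrable)).trans ?_
  rw [integral_add_measure hnear hfar]
  exact add_le_add_left hnear_le _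

theorem exists_integral_abs_symIndicator_le (n : ℕ) (hs : s ∈ Ioo (0 : ℝ) 1) (hr : 0 < r)
    (hK : 0 ≤ K) : ∃ C : ℝ, 0 ≤ C ∧ ∀ (A : Set (Space n)) (x ν : Space n),
      FlatAt r K A x ν → NullMeasurableSet A →
      Integrable (fun z => symIndicator A x z * ‖z‖ ^ (-((n : ℝ) + s))) ∧
      ∫ z, |symIndicator A x z| * ‖z‖ ^ (-((n : ℝ) + s)) ≤ C := by
  obtain ⟨C, hC0, hC⟩ := exists_setIntegral_cuspRegion_le n hs hr hK
  refine ⟨2 * C, by positivity, fun A x ν h hA => ?_⟩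
  obtain ⟨hint, hle⟩ := hC ν h.1
  have hmeas := aestronglyMeasurable_symIndicator hA x
  have hzero : ∀ z ∉ cuspRegion r K ν, symIndicator A x z * ‖z‖ ^ (-((n : ℝ) + s)) = 0 :=
    fun z hz => by rw [h.symIndicator_eq_zero hz, zero_mul]
  have hprod := hint.bdd_mul hmeas.restrict (ae_of_all _ (abs_symIndicator_le A x))
  refine ⟨(integrableOn_iff_integrable_of_support_subset
    fun z hz => by_contra fun hz' => hz (hzero z hz')).1 hprod, ?_⟩
  calc ∫ z, |symIndicator A x z| * ‖z‖ ^ (-((n : ℝ) + s))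
      = ∫ z in cuspRegion r K ν, |symIndicator A x z| * ‖z‖ ^ (-((n : ℝ) + s)) :=
        (setIntegral_eq_integral_of_forall_compl_eq_zero fun z hz => by
          rw [h.symIndicator_eq_zero hz, abs_zero, zero_mul]).symm
    _ ≤ ∫ z in cuspRegion r K ν, 2 * ‖z‖ ^ (-((n : ℝ) + s)) :=
        integral_mono_of_nonneg (ae_of_all _ fun z => by positivity) (hint.const_mul 2)
          (ae_of_all _ fun z => mul_le_mul_of_nonneg_right (abs_symIndicator_le A x z)
            (by positivity))
    _ ≤ 2 * C := by rw [integral_const_mul]; gcongr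

/-- The absolutely convergent form of the singular integral `∫ χ̃_A(y) / |x - y|^{n+s} dy`. -/
def symCurv (s : ℝ) (A : Set (Space n)) (x : Space n) : ℝ :=
  2⁻¹ * ∫ z, symIndicator A x z * ‖z‖ ^ (-((n : ℝ) + s))

end SymmetrizedIntegral

section FractionalMeanCurvature

variable {r K s δ : ℝ} {A : Set (Space n)} {x ν : Space n}

theorem truncatedCurv_eq (s : ℝ) (A : Set (Space n)) (x : Space n) (δ : ℝ) :
    truncatedCurv s A x δ = s * (1 - s) * ∫ z, signedIndicator A (x + z) *
      (Metric.ball 0 δ)ᶜ.indicator (fun z => ‖z‖ ^ (-((n : ℝ) + s))) z := by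
  rw [truncatedCurv, ← integral_indicator measurableSet_ball.compl, ← integral_add_left_eq_self _ x]
  congr 2
  ext z
  by_cases hz : ‖z‖ < δ
  · simp [hz]
  · simp [hz, Real.rpow_neg (norm_nonneg z), div_eq_mul_inv, -neg_add_rev]

theorem integrable_indicator_rpow_neg (hs : 0 < s) (hδ : 0 < δ) :
    Integrable ((Metric.ball (0 : Space n) δ)ᶜ.indicator fun z => ‖z‖ ^ (-((n : ℝ) + s))) :=
  (integrable_indicator_iff measurableSet_ball.compl).2
    (integrableOn_rpow_neg_compl_ball (lt_add_of_pos_right _ hs) hδ)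

theorem continuous_truncatedCurv (hs : 0 < s) (hδ : 0 < δ) (hA : volume (frontier A) = 0) :
    Continuous fun x => truncatedCurv s A x δ := by
  simp only [truncatedCurv_eq]
  refine continuous_const.mul (continuous_iff_continuousAt.2 fun x => ?_)
  have hint := integrable_indicator_rpow_neg (n := n) hs hδ
  refine continuousAt_of_dominated (Eventually.of_forall fun y =>
    (integrable_signedIndicator_add_mul (nullMeasurableSet_of_null_frontier hA) y hint).1)
    (Eventually.of_forall fun y => ae_of_all _ fun z => ?_) hint.norm ?_
  · rw [norm_mul, Real.norm_eq_abs, abs_signedIndicator, one_mul]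
  · have hA' := measure_eq_zero_iff_ae_notMem.1 hA
    filter_upwards [(quasiMeasurePreserving_add_left volume x).ae hA'] with z hz
    exact ((continuousAt_signedIndicator hz).comp (f := fun y => y + z) (by fun_prop)).mul
      continuousAt_const

theorem abs_rpow_neg_sub_indicator_le {V : Type*} [NormedAddCommGroup V] {q ε : ℝ} (hδ : 0 < δ)
    (hε : 0 ≤ ε) (hq : 0 < q) (z : V) :
    |‖z‖ ^ (-q) - (Metric.ball 0 δ)ᶜ.indicator (fun z => ‖z‖ ^ (-q)) z| ≤
      δ ^ ε * ‖z‖ ^ (-(q + ε)) := by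
  by_cases hz : ‖z‖ < δ
  · rw [indicator_of_notMem (by simpa using hz), sub_zero, abs_of_nonneg (by positivity)]
    rcases (norm_nonneg z).eq_or_lt with h0 | h0
    · rw [← h0, Real.zero_rpow (neg_ne_zero.2 hq.ne'), Real.zero_rpow (by linarith), mul_zero]
    · rw [neg_add, Real.rpow_add h0, mul_left_comm]
      refine le_mul_of_one_le_right (by positivity) ?_
      rw [Real.rpow_neg h0.le, ← div_eq_mul_inv, one_le_div (by positivity)]
      exact Real.rpow_le_rpow h0.le hz.le hε
  · rw [indicator_of_mem (by simpa using hz), sub_self, abs_zero]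
    positivity

theorem exists_abs_symCurv_sub_truncatedCurv_le (n : ℕ) (hs : s ∈ Ioo (0 : ℝ) 1) (hr : 0 < r)
    (hK : 0 ≤ K) : ∃ C : ℝ, ∀ (A : Set (Space n)) (x ν : Space n), FlatAt r K A x ν →
      NullMeasurableSet A → ∀ δ > 0,
      |s * (1 - s) * symCurv s A x - truncatedCurv s A x δ| ≤ C * δ ^ ((1 - s) / 2) := by
  obtain ⟨h0, h1⟩ := hs
  have hc : 0 ≤ s * (1 - s) := mul_nonneg h0.le (sub_pos.2 h1).le
  have hε : 0 < (1 - s) / 2 := half_pos (sub_pos.2 h1)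
  obtain ⟨C, -, hC⟩ := exists_integral_abs_symIndicator_le n (s := s + (1 - s) / 2)
    ⟨by linarith, by linarith⟩ hr hK
  obtain ⟨_, -, hi⟩ := exists_integral_abs_symIndicator_le n ⟨h0, h1⟩ hr hK
  refine ⟨s * (1 - s) * (2⁻¹ * C), fun A x ν h hA δ hδ => ?_⟩
  have hm := integrable_indicator_rpow_neg (n := n) h0 hδ
  rw [truncatedCurv_eq, integral_signedIndicator_mul_even
    (fun z => by simp only [indicator, mem_compl_iff, mem_ball_zero_iff, norm_neg])
    (integrable_signedIndicator_add_mul hA x hm), symCurv, ← mul_sub, ← mul_sub,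
    ← integral_sub (hi A x ν h hA).1
      (hm.bdd_mul (aestronglyMeasurable_symIndicator hA x) (ae_of_all _ (abs_symIndicator_le A x))),
    abs_mul (s * (1 - s)), abs_mul (2⁻¹ : ℝ), abs_of_nonneg hc, abs_of_pos (by norm_num),
    mul_assoc (s * (1 - s)), mul_assoc (2⁻¹ : ℝ)]
  refine mul_le_mul_of_nonneg_left (mul_le_mul_of_nonneg_left ?_ (by norm_num)) hc
  obtain ⟨hint, hle⟩ := hC A x ν h hA
  have hdom : Integrable fun z => δ ^ ((1 - s) / 2) *
      (|symIndicator A x z| * ‖z‖ ^ (-((n : ℝ) + (s + (1 - s) / 2)))) := by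
    refine (hint.norm.congr (ae_of_all _ fun z => ?_)).const_mul _
    simp only [norm_mul, Real.norm_eq_abs, Real.abs_rpow_of_nonneg (norm_nonneg z), abs_norm]
  rw [← Real.norm_eq_abs]
  refine (norm_integral_le_of_norm_le hdom (ae_of_all _ fun z => ?_)).trans ?_
  · rw [← mul_sub, norm_mul, Real.norm_eq_abs, Real.norm_eq_abs, mul_left_comm, ← add_assoc]
    gcongr
    exact abs_rpow_neg_sub_indicator_le hδ hε.le (by positivity) z
  · rw [integral_const_mul, mul_comm]
    gcongr

theorem tendsto_const_mul_rpow_nhdsGT_zero (C : ℝ) {p : ℝ} (hp : 0 < p) :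
    Tendsto (fun δ : ℝ => C * δ ^ p) (𝓝[>] 0) (𝓝 0) := by
  simpa [Real.zero_rpow hp.ne'] using
    (tendsto_id_nhdsGT_zero.rpow_const (Or.inr hp.le)).const_mul C

theorem FlatAt.hasFracMeanCurv (hs : s ∈ Ioo (0 : ℝ) 1) (hr : 0 < r) (hK : 0 ≤ K)
    (h : FlatAt r K A x ν) (hA : NullMeasurableSet A) :
    HasFracMeanCurv s A x (s * (1 - s) * symCurv s A x) := by
  obtain ⟨C, hC⟩ := exists_abs_symCurv_sub_truncatedCurv_le n hs hr hK
  have hlim := tendsto_const_mul_rpow_nhdsGT_zero C (half_pos (sub_pos.2 hs.2))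
  rw [HasFracMeanCurv, tendsto_iff_norm_sub_tendsto_zero]
  refine squeeze_zero' (Eventually.of_forall fun δ => norm_nonneg _) ?_ hlim
  filter_upwards [self_mem_nhdsWithin] with δ hδ
  rw [norm_sub_rev]
  exact hC A x ν h hA δ hδ

theorem FlatAt.fracMeanCurv_eq (hs : s ∈ Ioo (0 : ℝ) 1) (hr : 0 < r) (hK : 0 ≤ K)
    (h : FlatAt r K A x ν) (hA : NullMeasurableSet A) :
    fracMeanCurv s A x = s * (1 - s) * symCurv s A x :=
  (h.hasFracMeanCurv hs hr hK hA).limUnder_eq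

theorem UniformlyFlat.continuousOn_fracMeanCurv (hs : s ∈ Ioo (0 : ℝ) 1) (hr : 0 < r)
    (hK : 0 ≤ K) (h : UniformlyFlat r K A) : ContinuousOn (fracMeanCurv s A) (frontier A) := by
  have hnull := h.volume_frontier hr hK
  have hA := nullMeasurableSet_of_null_frontier hnull
  obtain ⟨C, hC⟩ := exists_abs_symCurv_sub_truncatedCurv_le n hs hr hK
  have hlim := tendsto_const_mul_rpow_nhdsGT_zero C (half_pos (sub_pos.2 hs.2))
  have hunif : TendstoUniformlyOn (fun δ x => truncatedCurv s A x δ) (fracMeanCurv s A) (𝓝[>] 0)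
      (frontier A) := by
    refine Metric.tendstoUniformlyOn_iff.2 fun η hη => ?_
    filter_upwards [self_mem_nhdsWithin, hlim.eventually_lt_const hη] with δ hδ hδη x hx
    obtain ⟨ν, hν⟩ := h x hx
    rw [hν.fracMeanCurv_eq hs hr hK hA, Real.dist_eq]
    exact (hC A x ν hν hA δ hδ).trans_lt hδη
  refine hunif.continuousOn (Eventually.frequently ?_)
  filter_upwards [self_mem_nhdsWithin] with δ hδ
  exact (continuous_truncatedCurv hs.1 hδ hnull).continuousOn

theorem exists_abs_fracMeanCurv_le (n : ℕ) (hs : s ∈ Ioo (0 : ℝ) 1) (hr : 0 < r) (hK : 0 ≤ K) :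
    ∃ C : ℝ, 0 ≤ C ∧ ∀ (A : Set (Space n)) (x ν : Space n),
      FlatAt r K A x ν → NullMeasurableSet A → |fracMeanCurv s A x| ≤ C := by
  obtain ⟨C, hC0, hC⟩ := exists_integral_abs_symIndicator_le n hs hr hK
  have hc : 0 ≤ s * (1 - s) := mul_nonneg hs.1.le (sub_pos.2 hs.2).le
  refine ⟨s * (1 - s) * (2⁻¹ * C), by positivity, fun A x ν h hA => ?_⟩
  rw [h.fracMeanCurv_eq hs hr hK hA, symCurv, abs_mul (s * (1 - s)), abs_mul (2⁻¹ : ℝ),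
    abs_of_nonneg hc, abs_of_pos (by norm_num : (0 : ℝ) < 2⁻¹)]
  gcongr
  refine abs_integral_le_integral_abs.trans (le_of_eq_of_le ?_ (hC A x ν h hA).2)
  simp_rw [abs_mul, abs_of_nonneg (Real.rpow_nonneg (norm_nonneg _) _)]

end FractionalMeanCurvature

section RegularizedKernel

variable {s δ : ℝ} {z u v : Space n}

/-- The regularized kernel `(‖z‖² + δ²)^{-(n+s)/2}`. Integrals against it converge absolutely on
the whole space, so that variables can be changed before passing to the limit `δ → 0`. -/
def regKernel (n : ℕ) (s δ : ℝ) (z : Space n) : ℝ := (‖z‖ ^ 2 + δ ^ 2) ^ (-(((n : ℝ) + s) / 2))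

theorem regKernel_neg (s δ : ℝ) (z : Space n) : regKernel n s δ (-z) = regKernel n s δ z := by
  simp [regKernel]

theorem regKernel_nonneg (s δ : ℝ) (z : Space n) : 0 ≤ regKernel n s δ z := by
  unfold regKernel; positivity

theorem continuous_regKernel (s : ℝ) (hδ : 0 < δ) : Continuous (regKernel n s δ) := by
  unfold regKernel
  exact Continuous.rpow_const (by fun_prop) fun z => Or.inl (by positivity)

theorem integrable_regKernel (hs : 0 < s) (hδ : 0 < δ) : Integrable (regKernel n s δ) := by
  have hjapanese : Integrable (fun z : Space n => (1 + ‖z‖ ^ 2) ^ (-((n : ℝ) + s) / 2)) :=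
    integrable_rpow_neg_one_add_norm_sq (by simpa using hs)
  refine ((hjapanese.comp_smul (R := δ⁻¹) (by positivity)).const_mul
    ((δ ^ 2) ^ (-(((n : ℝ) + s) / 2)))).congr (ae_of_all _ fun z => ?_)
  simp only [regKernel]
  rw [norm_smul, mul_pow, norm_inv, Real.norm_of_nonneg hδ.le, neg_div,
    ← Real.mul_rpow (by positivity) (by positivity)]
  congr 1
  field_simp
  ring

theorem sq_rpow_neg_half {x q : ℝ} (hx : 0 ≤ x) : (x ^ 2) ^ (-(q / 2)) = x ^ (-q) := by
  rw [← Real.rpow_natCast x 2, ← Real.rpow_mul hx]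
  congr 1; push_cast; ring

theorem regKernel_le (hs : 0 < s) (hz : z ≠ 0) :
    regKernel n s δ z ≤ ‖z‖ ^ (-((n : ℝ) + s)) := by
  have hz0 : 0 < ‖z‖ := norm_pos_iff.2 hz
  rw [← sq_rpow_neg_half hz0.le, regKernel]
  exact Real.rpow_le_rpow_of_nonpos (by positivity) (le_add_of_nonneg_right (sq_nonneg δ))
    (neg_nonpos.2 (by positivity))

theorem tendsto_regKernel (s : ℝ) (hz : z ≠ 0) :
    Tendsto (fun δ => regKernel n s δ z) (𝓝[>] 0) (𝓝 (‖z‖ ^ (-((n : ℝ) + s)))) := by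
  have hz0 : 0 < ‖z‖ := norm_pos_iff.2 hz
  have hlim : Tendsto (fun δ : ℝ => ‖z‖ ^ 2 + δ ^ 2) (𝓝[>] 0) (𝓝 (‖z‖ ^ 2)) := by
    simpa using (tendsto_id_nhdsGT_zero.pow 2).const_add (‖z‖ ^ 2)
  rw [← sq_rpow_neg_half hz0.le]
  exact hlim.rpow_const (Or.inl (by positivity))

theorem FlatAt.ae_ne_zero {r K : ℝ} {A : Set (Space n)} {x ν : Space n} (h : FlatAt r K A x ν) :
    ∀ᵐ z : Space n, z ≠ 0 := by
  have : Nonempty (Fin n) := ⟨⟨0, h.dim_pos⟩⟩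
  exact Measure.ae_ne volume 0

theorem FlatAt.tendsto_integral_regKernel {r K : ℝ} {A : Set (Space n)} {x ν : Space n}
    (hs : s ∈ Ioo (0 : ℝ) 1) (hr : 0 < r) (hK : 0 ≤ K)
    (h : FlatAt r K A x ν) (hA : NullMeasurableSet A) :
    Tendsto (fun δ => ∫ z, signedIndicator A (x + z) * regKernel n s δ z) (𝓝[>] 0)
      (𝓝 (symCurv s A x)) := by
  obtain ⟨_, -, hi⟩ := exists_integral_abs_symIndicator_le n hs hr hK
  have heven : (fun δ => 2⁻¹ * ∫ z, symIndicator A x z * regKernel n s δ z) =ᶠ[𝓝[>] 0]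
      fun δ => ∫ z, signedIndicator A (x + z) * regKernel n s δ z := by
    filter_upwards [self_mem_nhdsWithin] with δ hδ
    exact (integral_signedIndicator_mul_even (regKernel_neg s δ)
      (integrable_signedIndicator_add_mul hA x (integrable_regKernel hs.1 hδ))).symm
  refine Tendsto.congr' heven (Tendsto.const_mul _ ?_)
  refine tendsto_integral_filter_of_dominated_convergence
    (fun z => ‖symIndicator A x z * ‖z‖ ^ (-((n : ℝ) + s))‖) ?_ ?_ (hi A x ν h hA).1.norm ?_
  · filter_upwards [self_mem_nhdsWithin] with δ hδ
    exact (aestronglyMeasurable_symIndicator hA x).mul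
      (continuous_regKernel s hδ).aestronglyMeasurable
  · filter_upwards with δ
    filter_upwards [h.ae_ne_zero] with z hz
    rw [norm_mul, norm_mul]
    gcongr
    rw [Real.norm_of_nonneg (regKernel_nonneg _ _ _), Real.norm_of_nonneg (by positivity)]
    exact regKernel_le hs.1 hz
  · filter_upwards [h.ae_ne_zero] with z hz
    exact (tendsto_regKernel s hz).const_mul _

theorem abs_rpow_neg_sub_le {p m a b : ℝ} (hp : 0 ≤ p) (hm : 0 < m) (ha : m ≤ a) (hb : m ≤ b) :
    |a ^ (-p) - b ^ (-p)| ≤ p * m ^ (-p - 1) * |a - b| := by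
  refine (convex_Ici m).norm_image_sub_le_of_norm_hasDerivWithin_le (f := fun t : ℝ => t ^ (-p))
    (f' := fun t => -p * t ^ (-p - 1))
    (fun t ht => (Real.hasDerivAt_rpow_const (Or.inl (hm.trans_le ht).ne')).hasDerivWithinAt)
    (fun t (ht : m ≤ t) => ?_) hb ha
  rw [norm_mul, norm_neg, Real.norm_of_nonneg hp,
    Real.norm_of_nonneg (Real.rpow_nonneg (hm.le.trans ht) _)]
  exact mul_le_mul_of_nonneg_left (Real.rpow_le_rpow_of_nonpos hm ht (by linarith)) hp

theorem half_rpow_neg {a : ℝ} (ha : 0 ≤ a) (q : ℝ) : (a / 2) ^ (-q) = 2 ^ q * a ^ (-q) := by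
  rw [Real.div_rpow ha two_pos.le, Real.rpow_neg two_pos.le, div_inv_eq_mul, mul_comm]

theorem regKernel_le_of_half_le (hs : 0 < s) (hz : z ≠ 0) (hu : ‖z‖ / 2 ≤ ‖u‖) :
    regKernel n s δ u ≤ 2 ^ ((n : ℝ) + s) * ‖z‖ ^ (-((n : ℝ) + s)) := by
  have hz0 : 0 < ‖z‖ := norm_pos_iff.2 hz
  have hu0 : u ≠ 0 := norm_pos_iff.1 ((half_pos hz0).trans_le hu)
  rw [← half_rpow_neg hz0.le]
  exact (regKernel_le hs hu0).trans
    (Real.rpow_le_rpow_of_nonpos (half_pos hz0) hu (neg_nonpos.2 (by positivity)))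

theorem abs_regKernel_sub_le (hs : 0 < s) (hz : z ≠ 0) (hu : ‖z‖ / 2 ≤ ‖u‖)
    (hv : ‖z‖ / 2 ≤ ‖v‖) :
    |regKernel n s δ u - regKernel n s δ v| ≤
      2 * ((n : ℝ) + s) * 2 ^ ((n : ℝ) + s) * ‖z‖ ^ (-((n : ℝ) + s)) *
        (|‖u‖ ^ 2 - ‖v‖ ^ 2| / ‖z‖ ^ 2) := by
  have hz0 : 0 < ‖z‖ := norm_pos_iff.2 hz
  have hm : 0 < (‖z‖ / 2) ^ 2 := by positivity
  have hle : ∀ w : Space n, ‖z‖ / 2 ≤ ‖w‖ → (‖z‖ / 2) ^ 2 ≤ ‖w‖ ^ 2 + δ ^ 2 := fun w hw =>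
    (pow_le_pow_left₀ (by positivity) hw 2).trans (le_add_of_nonneg_right (sq_nonneg δ))
  refine (abs_rpow_neg_sub_le (p := ((n : ℝ) + s) / 2) (by positivity) hm (hle u hu)
    (hle v hv)).trans_eq ?_
  rw [Real.rpow_sub_one hm.ne', sq_rpow_neg_half (by positivity), half_rpow_neg hz0.le,
    add_sub_add_right_eq_sub]
  field_simp

end RegularizedKernel

section Jacobian

theorem contDiff_det (V : Type*) [NormedAddCommGroup V] [NormedSpace ℝ V]
    [FiniteDimensional ℝ V] : ContDiff ℝ 1 fun B : V →L[ℝ] V => B.det := by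
  let b := Module.finBasis ℝ V
  let entry (i j) : (V →L[ℝ] V) →ₗ[ℝ] ℝ :=
    Matrix.entryLinearMap ℝ ℝ i j ∘ₗ (LinearMap.toMatrix b b).toLinearMap ∘ₗ
      ContinuousLinearMap.coeLM ℝ
  have hdet : (fun B : V →L[ℝ] V => B.det) = fun B =>
      ∑ σ : Equiv.Perm _, (Equiv.Perm.sign σ : ℝ) * ∏ i, entry (σ i) i B := by
    funext B
    rw [ContinuousLinearMap.det, ← LinearMap.det_toMatrix b, Matrix.det_apply']
    rfl
  rw [hdet]
  exact ContDiff.sum fun σ _ => contDiff_const.mul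
    (contDiff_prod fun i _ => (LinearMap.toContinuousLinearMap (entry (σ i) i)).contDiff)

theorem exists_abs_det_sub_le (V : Type*) [NormedAddCommGroup V] [NormedSpace ℝ V]
    [FiniteDimensional ℝ V] (M : ℝ) : ∃ C : ℝ, 0 ≤ C ∧ ∀ B B' : V →L[ℝ] V,
      ‖B‖ ≤ M → ‖B'‖ ≤ M → |B.det - B'.det| ≤ C * ‖B - B'‖ := by
  obtain ⟨L, hL⟩ := ((contDiff_det V).locallyLipschitz.locallyLipschitzOn
    (s := Metric.closedBall 0 M)).exists_lipschitzOnWith_of_compact (isCompact_closedBall _ _)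
  refine ⟨L, L.2, fun B B' hB hB' => ?_⟩
  simpa only [dist_eq_norm, Real.norm_eq_abs] using
    hL.dist_le_mul B (mem_closedBall_zero_iff.2 hB) B' (mem_closedBall_zero_iff.2 hB')

/-- The Jacobian of `id + Y`, the density in the change of variables along `id + Y`. -/
def jac (Y : Space n → Space n) (y : Space n) : ℝ :=
  |(ContinuousLinearMap.id ℝ (Space n) + fderiv ℝ Y y).det|

theorem jac_nonneg (Y : Space n → Space n) (y : Space n) : 0 ≤ jac Y y := abs_nonneg _

theorem exists_jac_bounds (n : ℕ) : ∃ C : ℝ, 0 ≤ C ∧ ∀ Y : Space n → Space n,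
    (∀ y, ‖fderiv ℝ Y y‖ ≤ 1 / 2) → (∀ y, |jac Y y - 1| ≤ C * ‖fderiv ℝ Y y‖) ∧
      ∀ y y', |jac Y y - jac Y y'| ≤ C * ‖fderiv ℝ Y y - fderiv ℝ Y y'‖ := by
  obtain ⟨C, hC0, hC⟩ := exists_abs_det_sub_le (Space n) 2
  have hid : ‖ContinuousLinearMap.id ℝ (Space n)‖ ≤ 1 := ContinuousLinearMap.norm_id_le
  refine ⟨C, hC0, fun Y hY => ?_⟩
  have hb : ∀ y, ‖ContinuousLinearMap.id ℝ (Space n) + fderiv ℝ Y y‖ ≤ 2 := fun y =>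
    (norm_add_le _ _).trans (by linarith [hY y])
  refine ⟨fun y => ?_, fun y y' => ?_⟩
  · have hdet := hC _ (ContinuousLinearMap.id ℝ (Space n)) (hb y) (by linarith)
    rw [add_sub_cancel_left,
      show (ContinuousLinearMap.id ℝ (Space n)).det = 1 from LinearMap.det_id] at hdet
    simpa only [jac, abs_one] using (abs_abs_sub_abs_le _ 1).trans hdet
  · have hdet := hC _ _ (hb y) (hb y')
    rw [add_sub_add_left_eq_sub] at hdet
    exact (abs_abs_sub_abs_le _ _).trans hdet

end Jacobian

section ChangeOfVariables

variable {Y : Space n → Space n}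

theorem norm_sub_le_of_norm_fderiv_le {V W : Type*} [NormedAddCommGroup V] [NormedSpace ℝ V]
    [NormedAddCommGroup W] [NormedSpace ℝ W] {f : V → W} {C : ℝ} (hd : Differentiable ℝ f)
    (hC : ∀ x, ‖fderiv ℝ f x‖ ≤ C) (x y : V) : ‖f x - f y‖ ≤ C * ‖x - y‖ :=
  convex_univ.norm_image_sub_le_of_norm_fderiv_le (𝕜 := ℝ) (fun z _ => hd z) (fun z _ => hC z)
    (mem_univ _) (mem_univ _)

theorem exists_homeomorph_id_add {V : Type*} [NormedAddCommGroup V] [NormedSpace ℝ V]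
    [CompleteSpace V] {Y : V → V} (hd : Differentiable ℝ Y) (hh : ∀ y, ‖fderiv ℝ Y y‖ ≤ 1 / 2) :
    ∃ Θ : V ≃ₜ V, ∀ y, Θ y = y + Y y := by
  have happrox : ApproximatesLinearOn (fun y => y + Y y)
      (ContinuousLinearEquiv.refl ℝ V : V →L[ℝ] V) univ (1 / 2) := fun x _ y _ => by
    simpa [add_sub_add_comm] using norm_sub_le_of_norm_fderiv_le hd hh x y
  refine ⟨happrox.toHomeomorph _ ?_, fun y => rfl⟩
  rcases subsingleton_or_nontrivial V with h | h
  · exact Or.inl h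
  · right
    have hnorm : ‖((ContinuousLinearEquiv.refl ℝ V).symm : V →L[ℝ] V)‖₊ = 1 := by simp
    rw [hnorm, inv_one]
    exact NNReal.coe_lt_coe.1 (by norm_num)

theorem hasFDerivAt_id_add {V : Type*} [NormedAddCommGroup V] [NormedSpace ℝ V] {Y : V → V}
    (hd : Differentiable ℝ Y) (y : V) :
    HasFDerivAt (fun y => y + Y y) (ContinuousLinearMap.id ℝ V + fderiv ℝ Y y) y :=
  (hasFDerivAt_id y).add (hd y).hasFDerivAt

theorem bijective_id_add {V : Type*} [NormedAddCommGroup V] [NormedSpace ℝ V]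
    [CompleteSpace V] {Y : V → V} (hd : Differentiable ℝ Y) (hh : ∀ y, ‖fderiv ℝ Y y‖ ≤ 1 / 2) :
    Function.Bijective fun y => y + Y y := by
  obtain ⟨Θ, hΘ⟩ := exists_homeomorph_id_add hd hh
  exact (funext hΘ : ⇑Θ = _) ▸ Θ.bijective

theorem integral_comp_id_add (hd : Differentiable ℝ Y) (hh : ∀ y, ‖fderiv ℝ Y y‖ ≤ 1 / 2)
    (φ : Space n → ℝ) : ∫ x, φ x = ∫ y, jac Y y * φ (y + Y y) := by
  have hbij := bijective_id_add hd hh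
  have hcov := integral_image_eq_integral_abs_det_fderiv_smul volume MeasurableSet.univ
    (fun y _ => (hasFDerivAt_id_add hd y).hasFDerivWithinAt) hbij.injective.injOn φ
  rwa [image_univ, hbij.surjective.range_eq, setIntegral_univ, setIntegral_univ] at hcov

theorem integrable_comp_id_add_iff (hd : Differentiable ℝ Y) (hh : ∀ y, ‖fderiv ℝ Y y‖ ≤ 1 / 2)
    (φ : Space n → ℝ) :
    Integrable φ ↔ Integrable fun y => jac Y y * φ (y + Y y) := by
  have hbij := bijective_id_add hd hh
  have hcov := integrableOn_image_iff_integrableOn_abs_det_fderiv_smul volume MeasurableSet.univ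
    (fun y _ => (hasFDerivAt_id_add hd y).hasFDerivWithinAt) hbij.injective.injOn φ
  rwa [image_univ, hbij.surjective.range_eq, integrableOn_univ, integrableOn_univ] at hcov

/-- The displacement `Θ (y₀ + z) - Θ y₀` of `Θ = id + Y`, that is, `Θ` in coordinates centred at
`y₀` and at `Θ y₀`. -/
def disp (Y : Space n → Space n) (y₀ z : Space n) : Space n := z + (Y (y₀ + z) - Y y₀)

theorem add_disp (Y : Space n → Space n) (y₀ z : Space n) :
    y₀ + Y y₀ + disp Y y₀ z = y₀ + z + Y (y₀ + z) := by
  rw [disp]; abel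

theorem norm_disp_sub_le (hd : Differentiable ℝ Y) (hh : ∀ y, ‖fderiv ℝ Y y‖ ≤ 1 / 2)
    (y₀ z : Space n) : ‖disp Y y₀ z - z‖ ≤ ‖z‖ / 2 := by
  rw [disp, add_sub_cancel_left]
  simpa [div_eq_inv_mul] using norm_sub_le_of_norm_fderiv_le hd hh (y₀ + z) y₀

theorem half_le_norm_disp (hd : Differentiable ℝ Y) (hh : ∀ y, ‖fderiv ℝ Y y‖ ≤ 1 / 2)
    (y₀ z : Space n) : ‖z‖ / 2 ≤ ‖disp Y y₀ z‖ := by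
  linarith [norm_disp_sub_le hd hh y₀ z, norm_sub_norm_le z (disp Y y₀ z),
    norm_sub_rev z (disp Y y₀ z)]

theorem norm_disp_le (hd : Differentiable ℝ Y) (hh : ∀ y, ‖fderiv ℝ Y y‖ ≤ 1 / 2)
    (y₀ z : Space n) : ‖disp Y y₀ z‖ ≤ 3 / 2 * ‖z‖ := by
  linarith [norm_disp_sub_le hd hh y₀ z, norm_sub_norm_le (disp Y y₀ z) z]

theorem fderiv_add_left_sub_const (Y : Space n → Space n) (y₀ z : Space n) :
    fderiv ℝ (fun z => Y (y₀ + z) - Y y₀) z = fderiv ℝ Y (y₀ + z) := by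
  rw [fderiv_sub_const, fderiv_comp_add_left]

theorem integral_comp_disp (hd : Differentiable ℝ Y) (hh : ∀ y, ‖fderiv ℝ Y y‖ ≤ 1 / 2)
    (y₀ : Space n) (φ : Space n → ℝ) : ∫ z, φ z = ∫ z, jac Y (y₀ + z) * φ (disp Y y₀ z) := by
  rw [integral_comp_id_add (Y := fun z => Y (y₀ + z) - Y y₀) (by fun_prop)
    (fun z => by rw [fderiv_add_left_sub_const]; exact hh _) φ]
  simp only [jac, fderiv_add_left_sub_const, disp]

theorem integrable_comp_disp_iff (hd : Differentiable ℝ Y) (hh : ∀ y, ‖fderiv ℝ Y y‖ ≤ 1 / 2)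
    (y₀ : Space n) (φ : Space n → ℝ) :
    Integrable φ ↔ Integrable fun z => jac Y (y₀ + z) * φ (disp Y y₀ z) := by
  rw [integrable_comp_id_add_iff (Y := fun z => Y (y₀ + z) - Y y₀) (by fun_prop)
    (fun z => by rw [fderiv_add_left_sub_const]; exact hh _) φ]
  simp only [jac, fderiv_add_left_sub_const, disp]

end ChangeOfVariables

section AlmostEvenKernels

variable {r K s M : ℝ} {A : Set (Space n)} {x z : Space n} {κ : Space n → ℝ}

theorem abs_signedIndicator_pairing_le_of_lt_one (hs : 0 < s) (hz : z ≠ 0) (hz1 : ‖z‖ < 1)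
    (hM : 0 ≤ M) (hsize : |κ z| ≤ M * (1 + ‖z‖ ^ (s / 2)) * ‖z‖ ^ (-((n : ℝ) + s)))
    (hodd : |κ (-z) - κ z| ≤ M * ‖z‖ * ‖z‖ ^ (-((n : ℝ) + s))) :
    |signedIndicator A (x + z) * κ z + signedIndicator A (x + -z) * κ (-z)| ≤
      M * (2 * (|symIndicator A x z| * ‖z‖ ^ (-((n : ℝ) + s))) +
        ‖z‖ ^ (-((n : ℝ) + s - 1))) := by
  have hpow : ‖z‖ ^ (-((n : ℝ) + s - 1)) = ‖z‖ * ‖z‖ ^ (-((n : ℝ) + s)) := by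
    rw [neg_sub, sub_eq_add_neg, Real.rpow_add (norm_pos_iff.2 hz), Real.rpow_one]
  have hgrow : ‖z‖ ^ (s / 2) ≤ 1 := Real.rpow_le_one (norm_nonneg z) hz1.le (by positivity)
  have hsym : |κ z| ≤ M * 2 * ‖z‖ ^ (-((n : ℝ) + s)) :=
    hsize.trans (by gcongr; linarith)
  calc |signedIndicator A (x + z) * κ z + signedIndicator A (x + -z) * κ (-z)|
      = |symIndicator A x z * κ z + signedIndicator A (x + -z) * (κ (-z) - κ z)| := by
        rw [symIndicator, sub_eq_add_neg x z]; ring_nf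
    _ ≤ |symIndicator A x z| * |κ z| + |κ (-z) - κ z| := by
        refine (abs_add_le _ _).trans_eq ?_
        rw [abs_mul, abs_mul, abs_signedIndicator, one_mul]
    _ ≤ |symIndicator A x z| * (M * 2 * ‖z‖ ^ (-((n : ℝ) + s))) +
          M * ‖z‖ * ‖z‖ ^ (-((n : ℝ) + s)) := by gcongr
    _ = _ := by rw [hpow]; ring

theorem abs_signedIndicator_pairing_le_of_one_le (hs : 0 < s) (hz1 : 1 ≤ ‖z‖) (hM : 0 ≤ M)
    (hsize : ∀ z ≠ 0, |κ z| ≤ M * (1 + ‖z‖ ^ (s / 2)) * ‖z‖ ^ (-((n : ℝ) + s))) :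
    |signedIndicator A (x + z) * κ z + signedIndicator A (x + -z) * κ (-z)| ≤
      M * (4 * ‖z‖ ^ (-((n : ℝ) + s / 2))) := by
  have hz0 : 0 < ‖z‖ := one_pos.trans_le hz1
  have hz := norm_pos_iff.1 hz0
  have hpow : ‖z‖ ^ (-((n : ℝ) + s / 2)) = ‖z‖ ^ (s / 2) * ‖z‖ ^ (-((n : ℝ) + s)) := by
    rw [← Real.rpow_add hz0]; ring_nf
  have hgrow : 1 ≤ ‖z‖ ^ (s / 2) := Real.one_le_rpow hz1 (by positivity)
  have hfar : ∀ w : Space n, ‖w‖ = ‖z‖ → |κ w| ≤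
      M * (2 * ‖z‖ ^ (s / 2)) * ‖z‖ ^ (-((n : ℝ) + s)) := fun w hw => by
    refine (hsize w (norm_pos_iff.1 (hw ▸ hz0))).trans ?_
    rw [hw]
    gcongr
    linarith
  calc |signedIndicator A (x + z) * κ z + signedIndicator A (x + -z) * κ (-z)|
      ≤ |κ z| + |κ (-z)| := by
        refine (abs_add_le _ _).trans_eq ?_
        rw [abs_mul, abs_mul, abs_signedIndicator, abs_signedIndicator, one_mul, one_mul]
    _ ≤ M * (2 * ‖z‖ ^ (s / 2)) * ‖z‖ ^ (-((n : ℝ) + s)) +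
          M * (2 * ‖z‖ ^ (s / 2)) * ‖z‖ ^ (-((n : ℝ) + s)) :=
        add_le_add (hfar z rfl) (hfar (-z) (norm_neg z))
    _ = _ := by rw [hpow]; ring

/-- An integrable majorant, up to the factor `M`, of the symmetrized integrand of a kernel that is
even up to an error `M ‖z‖ · ‖z‖^{-(n+s)}` near the origin. -/
def pairingMajorant (s : ℝ) (A : Set (Space n)) (x z : Space n) : ℝ :=
  2 * (|symIndicator A x z| * ‖z‖ ^ (-((n : ℝ) + s))) +
    ((Metric.ball (0 : Space n) 1).indicator (fun z => ‖z‖ ^ (-((n : ℝ) + s - 1))) z +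
      4 * (Metric.ball (0 : Space n) 1)ᶜ.indicator (fun z => ‖z‖ ^ (-((n : ℝ) + s / 2))) z)

theorem abs_signedIndicator_pairing_le (hs : 0 < s) (hz : z ≠ 0) (hM : 0 ≤ M)
    (hsize : ∀ z ≠ 0, |κ z| ≤ M * (1 + ‖z‖ ^ (s / 2)) * ‖z‖ ^ (-((n : ℝ) + s)))
    (hodd : ∀ z ≠ 0, ‖z‖ ≤ 1 → |κ (-z) - κ z| ≤ M * ‖z‖ * ‖z‖ ^ (-((n : ℝ) + s))) :
    |signedIndicator A (x + z) * κ z + signedIndicator A (x + -z) * κ (-z)| ≤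
      M * pairingMajorant s A x z := by
  rw [pairingMajorant]
  by_cases hz1 : ‖z‖ < 1
  · have hmem : z ∈ Metric.ball (0 : Space n) 1 := mem_ball_zero_iff.2 hz1
    rw [indicator_of_mem hmem, indicator_of_notMem (not_not.2 hmem), mul_zero, add_zero]
    exact abs_signedIndicator_pairing_le_of_lt_one hs hz hz1 hM (hsize z hz) (hodd z hz hz1.le)
  · have hmem : z ∉ Metric.ball (0 : Space n) 1 := fun h => hz1 (mem_ball_zero_iff.1 h)
    rw [indicator_of_notMem hmem, indicator_of_mem (mem_compl hmem), zero_add]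
    refine (abs_signedIndicator_pairing_le_of_one_le hs (not_lt.1 hz1) hM hsize).trans ?_
    gcongr
    exact le_add_of_nonneg_left (by positivity)

theorem exists_integral_pairingMajorant_le (n : ℕ) (hs : s ∈ Ioo (0 : ℝ) 1) (hr : 0 < r)
    (hK : 0 ≤ K) : ∃ C : ℝ, 0 ≤ C ∧ ∀ (A : Set (Space n)) (x ν : Space n), FlatAt r K A x ν →
      NullMeasurableSet A → Integrable (pairingMajorant s A x) ∧
        ∫ z, pairingMajorant s A x z ≤ C := by
  obtain ⟨C, hC0, hC⟩ := exists_integral_abs_symIndicator_le n hs hr hK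
  set near := (Metric.ball (0 : Space n) 1).indicator fun z => ‖z‖ ^ (-((n : ℝ) + s - 1))
  set far := (Metric.ball (0 : Space n) 1)ᶜ.indicator fun z => ‖z‖ ^ (-((n : ℝ) + s / 2))
  have hrest : 0 ≤ ∫ z, near z + 4 * far z := integral_nonneg fun z => by
    have h1 : 0 ≤ near z := indicator_nonneg (fun _ _ => by positivity) z
    have h2 : 0 ≤ far z := indicator_nonneg (fun _ _ => by positivity) z
    positivity
  refine ⟨2 * C + ∫ z, near z + 4 * far z, by positivity, fun A x ν h hA => ?_⟩
  obtain ⟨hint, hle⟩ := hC A x ν h hA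
  have hn : (1 : ℝ) ≤ n := by exact_mod_cast h.dim_pos
  have hnear : Integrable near := (integrable_indicator_iff measurableSet_ball).2
    (integrableOn_rpow_neg_ball (by linarith [hs.1]) (by linarith [hs.2]))
  have hfar : Integrable far := integrable_indicator_rpow_neg (half_pos hs.1) one_pos
  have hsym : Integrable fun z => |symIndicator A x z| * ‖z‖ ^ (-((n : ℝ) + s)) :=
    hint.norm.congr (ae_of_all _ fun z => by
      simp only [norm_mul, Real.norm_eq_abs, Real.abs_rpow_of_nonneg (norm_nonneg z), abs_norm])
  refine ⟨(hsym.const_mul 2).add (hnear.add (hfar.const_mul 4)), ?_⟩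
  have hsplit : ∫ z, pairingMajorant s A x z =
      2 * (∫ z, |symIndicator A x z| * ‖z‖ ^ (-((n : ℝ) + s))) + ∫ z, near z + 4 * far z := by
    rw [← integral_const_mul]
    exact integral_add (hsym.const_mul 2) (hnear.add (hfar.const_mul 4))
  rw [hsplit]
  gcongr

theorem exists_abs_integral_signedIndicator_mul_le (n : ℕ) (hs : s ∈ Ioo (0 : ℝ) 1) (hr : 0 < r)
    (hK : 0 ≤ K) : ∃ C : ℝ, 0 ≤ C ∧ ∀ (A : Set (Space n)) (x ν : Space n), FlatAt r K A x ν →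
      NullMeasurableSet A → ∀ (M : ℝ) (κ : Space n → ℝ), 0 ≤ M → Integrable κ →
      (∀ z ≠ 0, |κ z| ≤ M * (1 + ‖z‖ ^ (s / 2)) * ‖z‖ ^ (-((n : ℝ) + s))) →
      (∀ z ≠ 0, ‖z‖ ≤ 1 → |κ (-z) - κ z| ≤ M * ‖z‖ * ‖z‖ ^ (-((n : ℝ) + s))) →
      |∫ z, signedIndicator A (x + z) * κ z| ≤ C * M := by
  obtain ⟨C, hC0, hC⟩ := exists_integral_pairingMajorant_le n hs hr hK
  refine ⟨2⁻¹ * C, by positivity, fun A x ν h hA M κ hM hκ hsize hodd => ?_⟩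
  obtain ⟨hint, hle⟩ := hC A x ν h hA
  rw [integral_eq_half_integral_add_comp_neg (integrable_signedIndicator_add_mul hA x hκ), abs_mul,
    abs_of_pos (by norm_num : (0 : ℝ) < 2⁻¹), mul_assoc]
  gcongr
  have hbound : ∀ᵐ z, ‖signedIndicator A (x + z) * κ z + signedIndicator A (x + -z) * κ (-z)‖ ≤
      M * pairingMajorant s A x z :=
    h.ae_ne_zero.mono fun z hz => abs_signedIndicator_pairing_le hs.1 hz hM hsize hodd
  have hpair := norm_integral_le_of_norm_le (hint.const_mul M) hbound
  rw [integral_const_mul, mul_comm] at hpair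
  exact hpair.trans (by gcongr)

end AlmostEvenKernels

/-- A vector field which is small, together with its derivative, as seen from `y₀`: the number `N`
bounds the derivative up to the growth `‖z‖^{s/2}`, which the kernel `‖z‖^{-(n+s)}` can absorb, and
its Lipschitz constant near `y₀`. -/
structure SmallField {V : Type*} [NormedAddCommGroup V] [NormedSpace ℝ V] (s N : ℝ) (Y : V → V)
    (y₀ : V) : Prop where
  diff : Differentiable ℝ Y
  half : ∀ y, ‖fderiv ℝ Y y‖ ≤ 1 / 2
  lip : ∀ y y', ‖y - y₀‖ ≤ 1 → ‖y' - y₀‖ ≤ 1 →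
    ‖fderiv ℝ Y y - fderiv ℝ Y y'‖ ≤ N * ‖y - y'‖
  growth : ∀ z, ‖fderiv ℝ Y (y₀ + z)‖ ≤ N * (1 + ‖z‖ ^ (s / 2))
  sub : ∀ z, ‖Y (y₀ + z) - Y y₀‖ ≤ N * ‖z‖

/-- The difference between the regularized kernel transported by `id + Y` and the kernel itself. -/
def kernelDiff (s δ : ℝ) (Y : Space n → Space n) (y₀ z : Space n) : ℝ :=
  jac Y (y₀ + z) * regKernel n s δ (disp Y y₀ z) - regKernel n s δ z

namespace SmallField

variable {s N δ : ℝ} {Y : Space n → Space n} {y₀ z : Space n}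

theorem nonneg (h : SmallField s N Y y₀) : 0 ≤ N :=
  nonneg_of_mul_nonneg_left ((norm_nonneg _).trans (h.growth 0)) (by positivity)

theorem norm_sub_sub_fderiv_le (h : SmallField s N Y y₀) (hz : ‖z‖ ≤ 1) :
    ‖Y (y₀ + z) - Y y₀ - fderiv ℝ Y y₀ z‖ ≤ N * ‖z‖ * ‖z‖ := by
  have hN := h.nonneg
  simpa using (convex_closedBall y₀ ‖z‖).norm_image_sub_le_of_norm_hasFDerivWithin_le' (𝕜 := ℝ)
    (f := Y) (f' := fderiv ℝ Y) (φ := fderiv ℝ Y y₀) (C := N * ‖z‖) (x := y₀) (y := y₀ + z)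
    (fun x _ => (h.diff x).hasFDerivAt.hasFDerivWithinAt)
    (fun x hx => by
      rw [Metric.mem_closedBall, dist_eq_norm] at hx
      exact (h.lip x y₀ (hx.trans hz) (by simp)).trans (by gcongr)) (by simp) (by simp)

theorem norm_disp_add_disp_neg_le (h : SmallField s N Y y₀) (hz : ‖z‖ ≤ 1) :
    ‖disp Y y₀ z + disp Y y₀ (-z)‖ ≤ 2 * N * ‖z‖ ^ 2 := by
  have hpos := h.norm_sub_sub_fderiv_le hz
  have hneg := h.norm_sub_sub_fderiv_le (z := -z) (by rwa [norm_neg])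
  have hsum : disp Y y₀ z + disp Y y₀ (-z) = (Y (y₀ + z) - Y y₀ - fderiv ℝ Y y₀ z) +
      (Y (y₀ + -z) - Y y₀ - fderiv ℝ Y y₀ (-z)) := by
    rw [disp, disp, map_neg]; abel
  rw [hsum]
  refine (norm_add_le _ _).trans ?_
  rw [norm_neg] at hneg
  linarith

theorem abs_regKernel_disp_sub_le (h : SmallField s N Y y₀) (hs : 0 < s) (hz : z ≠ 0) :
    |regKernel n s δ (disp Y y₀ z) - regKernel n s δ z| ≤
      2 * ((n : ℝ) + s) * 2 ^ ((n : ℝ) + s) * ‖z‖ ^ (-((n : ℝ) + s)) * (3 * N) := by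
  have hz0 : 0 < ‖z‖ := norm_pos_iff.2 hz
  refine (abs_regKernel_sub_le hs hz (half_le_norm_disp h.diff h.half y₀ z)
    (half_le_self hz0.le)).trans ?_
  gcongr
  have hdiff : |‖disp Y y₀ z‖ - ‖z‖| ≤ N * ‖z‖ :=
    (abs_norm_sub_norm_le _ _).trans (by rw [disp, add_sub_cancel_left]; exact h.sub z)
  rw [div_le_iff₀ (by positivity), sq_sub_sq, abs_mul, abs_of_nonneg (by positivity)]
  calc (‖disp Y y₀ z‖ + ‖z‖) * |‖disp Y y₀ z‖ - ‖z‖| ≤ (3 * ‖z‖) * (N * ‖z‖) := by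
        gcongr
        linarith [norm_disp_le h.diff h.half y₀ z]
    _ = 3 * N * ‖z‖ ^ 2 := by ring

theorem abs_regKernel_disp_neg_sub_le (h : SmallField s N Y y₀) (hs : 0 < s) (hz : z ≠ 0)
    (hz1 : ‖z‖ ≤ 1) :
    |regKernel n s δ (disp Y y₀ (-z)) - regKernel n s δ (disp Y y₀ z)| ≤
      2 * ((n : ℝ) + s) * 2 ^ ((n : ℝ) + s) * ‖z‖ ^ (-((n : ℝ) + s)) * (6 * N * ‖z‖) := by
  have : 0 < ‖z‖ := norm_pos_iff.2 hz
  have := h.nonneg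
  have hle := norm_disp_le h.diff h.half y₀ z
  have hle' := norm_disp_le h.diff h.half y₀ (-z)
  have hhalf := half_le_norm_disp h.diff h.half y₀ (-z)
  rw [norm_neg] at hle' hhalf
  refine (abs_regKernel_sub_le hs hz hhalf (half_le_norm_disp h.diff h.half y₀ z)).trans ?_
  gcongr
  have hdiff : |‖disp Y y₀ (-z)‖ - ‖disp Y y₀ z‖| ≤ 2 * N * ‖z‖ ^ 2 := by
    have hsub := abs_norm_sub_norm_le (disp Y y₀ (-z)) (-disp Y y₀ z)
    rw [norm_neg, sub_neg_eq_add, add_comm] at hsub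
    exact hsub.trans (h.norm_disp_add_disp_neg_le hz1)
  rw [div_le_iff₀ (by positivity), sq_sub_sq, abs_mul, abs_of_nonneg (by positivity)]
  calc (‖disp Y y₀ (-z)‖ + ‖disp Y y₀ z‖) * |‖disp Y y₀ (-z)‖ - ‖disp Y y₀ z‖|
      ≤ (3 * ‖z‖) * (2 * N * ‖z‖ ^ 2) := by
        gcongr
        linarith
    _ = 6 * N * ‖z‖ * ‖z‖ ^ 2 := by ring

end SmallField

section Perturbation

variable {s N δ r K : ℝ} {Y : Space n → Space n} {y₀ : Space n} {G A : Set (Space n)}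

theorem exists_abs_kernelDiff_le (n : ℕ) (hs : 0 < s) :
    ∃ C : ℝ, 0 ≤ C ∧ ∀ (N δ : ℝ) (Y : Space n → Space n) (y₀ : Space n), SmallField s N Y y₀ →
      ∀ z ≠ 0, |kernelDiff s δ Y y₀ z| ≤
        C * N * (1 + ‖z‖ ^ (s / 2)) * ‖z‖ ^ (-((n : ℝ) + s)) := by
  obtain ⟨D, hD0, hD⟩ := exists_jac_bounds n
  set Q : ℝ := (n : ℝ) + s
  set P := 2 * Q * 2 ^ Q
  have : 0 ≤ P := by positivity
  refine ⟨D * 2 ^ Q + 3 * P, by positivity, fun N δ Y y₀ h z hz => ?_⟩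
  have hN := h.nonneg
  set k : ℝ := ‖z‖ ^ (-Q)
  have hjac : |(jac Y (y₀ + z) - 1) * regKernel n s δ (disp Y y₀ z)| ≤
      D * (N * (1 + ‖z‖ ^ (s / 2))) * (2 ^ Q * k) := by
    rw [abs_mul, abs_of_nonneg (regKernel_nonneg s δ _)]
    gcongr
    · exact regKernel_nonneg s δ _
    · exact ((hD Y h.half).1 _).trans (by gcongr; exact h.growth z)
    · exact regKernel_le_of_half_le hs hz (half_le_norm_disp h.diff h.half y₀ z)
  have hker : P * k * (3 * N) ≤ P * k * (3 * N) * (1 + ‖z‖ ^ (s / 2)) :=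
    le_mul_of_one_le_right (by positivity) (le_add_of_nonneg_right (by positivity))
  calc |kernelDiff s δ Y y₀ z|
      = |(jac Y (y₀ + z) - 1) * regKernel n s δ (disp Y y₀ z) +
          (regKernel n s δ (disp Y y₀ z) - regKernel n s δ z)| := by rw [kernelDiff]; ring_nf
    _ ≤ D * (N * (1 + ‖z‖ ^ (s / 2))) * (2 ^ Q * k) + P * k * (3 * N) :=
        (abs_add_le _ _).trans (add_le_add hjac (h.abs_regKernel_disp_sub_le hs hz))
    _ ≤ (D * 2 ^ Q + 3 * P) * N * (1 + ‖z‖ ^ (s / 2)) * k := by linarith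

theorem exists_abs_kernelDiff_neg_sub_le (n : ℕ) (hs : 0 < s) :
    ∃ C : ℝ, 0 ≤ C ∧ ∀ (N δ : ℝ) (Y : Space n → Space n) (y₀ : Space n), SmallField s N Y y₀ →
      ∀ z ≠ 0, ‖z‖ ≤ 1 → |kernelDiff s δ Y y₀ (-z) - kernelDiff s δ Y y₀ z| ≤
        C * N * ‖z‖ * ‖z‖ ^ (-((n : ℝ) + s)) := by
  obtain ⟨D, hD0, hD⟩ := exists_jac_bounds n
  set Q : ℝ := (n : ℝ) + s
  set P := 2 * Q * 2 ^ Q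
  refine ⟨2 * D * 2 ^ Q + 6 * (1 + D) * P, by positivity, fun N δ Y y₀ h z hz hz1 => ?_⟩
  have hN := h.nonneg
  obtain ⟨hone, hlip⟩ := hD Y h.half
  set k : ℝ := ‖z‖ ^ (-Q)
  have hhalf := half_le_norm_disp h.diff h.half y₀ (-z)
  rw [norm_neg] at hhalf
  have hjac_le : |jac Y (y₀ + z)| ≤ 1 + D := by
    have hjac := (hone (y₀ + z)).trans (mul_le_of_le_one_right hD0 ((h.half _).trans (by norm_num)))
    have htri := abs_sub_abs_le_abs_sub (jac Y (y₀ + z)) 1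
    rw [abs_one] at htri
    linarith
  have hjac : |(jac Y (y₀ + -z) - jac Y (y₀ + z)) * regKernel n s δ (disp Y y₀ (-z))| ≤
      D * (N * (2 * ‖z‖)) * (2 ^ Q * k) := by
    rw [abs_mul, abs_of_nonneg (regKernel_nonneg s δ _)]
    gcongr
    · exact regKernel_nonneg s δ _
    · refine (hlip _ _).trans ?_
      gcongr
      refine (h.lip _ _ (by simpa using hz1) (by simpa using hz1)).trans_eq ?_
      rw [show y₀ + -z - (y₀ + z) = (-2 : ℝ) • z by module, norm_smul]
      norm_num
    · exact regKernel_le_of_half_le hs hz hhalf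
  have hker : |jac Y (y₀ + z) *
      (regKernel n s δ (disp Y y₀ (-z)) - regKernel n s δ (disp Y y₀ z))| ≤
      (1 + D) * (P * k * (6 * N * ‖z‖)) := by
    rw [abs_mul]
    gcongr
    exact h.abs_regKernel_disp_neg_sub_le hs hz hz1
  calc |kernelDiff s δ Y y₀ (-z) - kernelDiff s δ Y y₀ z|
      = |(jac Y (y₀ + -z) - jac Y (y₀ + z)) * regKernel n s δ (disp Y y₀ (-z)) +
          jac Y (y₀ + z) *
            (regKernel n s δ (disp Y y₀ (-z)) - regKernel n s δ (disp Y y₀ z))| := by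
        rw [kernelDiff, kernelDiff, regKernel_neg]; ring_nf
    _ ≤ D * (N * (2 * ‖z‖)) * (2 ^ Q * k) + (1 + D) * (P * k * (6 * N * ‖z‖)) :=
        (abs_add_le _ _).trans (add_le_add hjac hker)
    _ = (2 * D * 2 ^ Q + 6 * (1 + D) * P) * N * ‖z‖ * k := by ring

theorem SmallField.integrable_jac_mul_regKernel (h : SmallField s N Y y₀) (hs : 0 < s)
    (hδ : 0 < δ) : Integrable fun z => jac Y (y₀ + z) * regKernel n s δ (disp Y y₀ z) :=
  (integrable_comp_disp_iff h.diff h.half y₀ _).1 (integrable_regKernel hs hδ)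

theorem exists_abs_integral_kernelDiff_le (n : ℕ) (hs : s ∈ Ioo (0 : ℝ) 1) (hr : 0 < r)
    (hK : 0 ≤ K) : ∃ C : ℝ, 0 ≤ C ∧ ∀ (G : Set (Space n)) (y₀ ν : Space n),
      FlatAt r K G y₀ ν → NullMeasurableSet G → ∀ (N δ : ℝ) (Y : Space n → Space n),
      SmallField s N Y y₀ → 0 < δ →
      |∫ z, signedIndicator G (y₀ + z) * kernelDiff s δ Y y₀ z| ≤ C * N := by
  obtain ⟨C, hC0, hC⟩ := exists_abs_integral_signedIndicator_mul_le n hs hr hK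
  obtain ⟨D, hD0, hD⟩ := exists_abs_kernelDiff_le n hs.1
  obtain ⟨D', _, hD'⟩ := exists_abs_kernelDiff_neg_sub_le n hs.1
  refine ⟨C * max D D', by positivity, fun G y₀ ν hflat hG N δ Y hY hδ => ?_⟩
  have hN := hY.nonneg
  rw [mul_assoc]
  refine hC G y₀ ν hflat hG (max D D' * N) _ (by positivity)
    ((hY.integrable_jac_mul_regKernel hs.1 hδ).sub (integrable_regKernel hs.1 hδ))
    (fun z hz => (hD N δ Y y₀ hY z hz).trans ?_)
    (fun z hz hz1 => (hD' N δ Y y₀ hY z hz hz1).trans ?_)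
  · gcongr
    exact le_max_left _ _
  · gcongr
    exact le_max_right _ _

theorem signedIndicator_le_of_imp {x y : Space n} (h : x ∈ A → y ∈ G) :
    signedIndicator G y ≤ signedIndicator A x := by
  by_cases hx : x ∈ A
  · rw [signedIndicator_of_mem hx, signedIndicator_of_mem (h hx)]
  · rw [signedIndicator_of_notMem hx]
    exact (abs_le.1 (abs_signedIndicator G y).le).2

/-- Removing the null set `frontier A` from `A` makes the comparison of the two indicators hold at
every point off `frontier G`, so that no image of a null set needs to be considered. -/
theorem SmallField.integral_regKernel_le (hY : SmallField s N Y y₀) (hs : 0 < s) (hδ : 0 < δ)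
    (hG : volume (frontier G) = 0) (hA : volume (frontier A) = 0)
    (hsub : ∀ y ∈ interior Gᶜ, y + Y y ∉ interior A) :
    ∫ z, signedIndicator G (y₀ + z) * (jac Y (y₀ + z) * regKernel n s δ (disp Y y₀ z)) ≤
      ∫ z, signedIndicator A (y₀ + Y y₀ + z) * regKernel n s δ z := by
  have hA' := nullMeasurableSet_of_null_frontier hA
  have hint : (fun z => signedIndicator A (y₀ + Y y₀ + z) * regKernel n s δ z) =ᵐ[volume]
      fun z => signedIndicator (interior A) (y₀ + Y y₀ + z) * regKernel n s δ z := by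
    filter_upwards [(quasiMeasurePreserving_add_left volume (y₀ + Y y₀)).ae
      (measure_eq_zero_iff_ae_notMem.1 hA)] with z hz
    have hle : signedIndicator (interior A) (y₀ + Y y₀ + z) ≤ signedIndicator A (y₀ + Y y₀ + z) :=
      signedIndicator_le_of_imp fun hzA => by_contra fun hzi => hz ⟨subset_closure hzA, hzi⟩
    rw [hle.antisymm' (signedIndicator_le_of_imp fun hzi => interior_subset hzi)]
  have hcov := (integral_congr_ae hint).trans (integral_comp_disp hY.diff hY.half y₀ _)
  simp only [add_disp] at hcov
  rw [hcov]
  refine integral_mono_ae (integrable_signedIndicator_add_mul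
    (nullMeasurableSet_of_null_frontier hG) y₀ (hY.integrable_jac_mul_regKernel hs hδ)) ?_ ?_
  · have hintA := (integrable_signedIndicator_add_mul hA' (y₀ + Y y₀)
      (integrable_regKernel hs hδ)).congr hint
    simpa only [add_disp] using (integrable_comp_disp_iff hY.diff hY.half y₀ _).1 hintA
  · filter_upwards [(quasiMeasurePreserving_add_left volume y₀).ae
      (measure_eq_zero_iff_ae_notMem.1 hG)] with z hz
    rw [mul_left_comm]
    refine mul_le_mul_of_nonneg_left (mul_le_mul_of_nonneg_right
      (signedIndicator_le_of_imp fun hzA => ?_) (regKernel_nonneg _ _ _)) (jac_nonneg _ _)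
    by_contra hzG
    refine hsub (y₀ + z) (by_contra fun hzi => hz ?_) hzA
    rw [← frontier_compl]
    exact ⟨subset_closure hzG, hzi⟩

/-- `C` bounds the drop of the curvature under perturbations: a perturbation of a flat set by a
field of size `N` lowers the curvature by at most `C * N`. -/
def IsPerturbationConst (n : ℕ) (s r K C : ℝ) : Prop :=
  ∀ (G A : Set (Space n)) (Y : Space n → Space n) (y₀ ν ν' : Space n) (N : ℝ),
    FlatAt r K G y₀ ν → FlatAt r K A (y₀ + Y y₀) ν' → volume (frontier G) = 0 →
    volume (frontier A) = 0 → SmallField s N Y y₀ →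
    (∀ y ∈ interior Gᶜ, y + Y y ∉ interior A) →
    fracMeanCurv s G y₀ - C * N ≤ fracMeanCurv s A (y₀ + Y y₀)

theorem exists_isPerturbationConst (n : ℕ) (hs : s ∈ Ioo (0 : ℝ) 1) (hr : 0 < r) (hK : 0 ≤ K) :
    ∃ C, 0 ≤ C ∧ IsPerturbationConst n s r K C := by
  obtain ⟨C, hC0, hC⟩ := exists_abs_integral_kernelDiff_le n hs hr hK
  refine ⟨s * (1 - s) * C, mul_nonneg (mul_nonneg hs.1.le (sub_pos.2 hs.2).le) hC0,
    fun G A Y y₀ ν ν' N hGf hAf hG0 hA0 hY hsub => ?_⟩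
  have hG := nullMeasurableSet_of_null_frontier hG0
  have hA := nullMeasurableSet_of_null_frontier hA0
  rw [hGf.fracMeanCurv_eq hs hr hK hG, hAf.fracMeanCurv_eq hs hr hK hA, mul_assoc _ C, ← mul_sub]
  refine mul_le_mul_of_nonneg_left ?_ (mul_nonneg hs.1.le (sub_pos.2 hs.2).le)
  refine le_of_tendsto_of_tendsto ((hGf.tendsto_integral_regKernel hs hr hK hG).sub_const (C * N))
    (hAf.tendsto_integral_regKernel hs hr hK hA) ?_
  filter_upwards [self_mem_nhdsWithin] with δ (hδ : 0 < δ)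
  have hsplit : ∫ z, signedIndicator G (y₀ + z) * kernelDiff s δ Y y₀ z =
      (∫ z, signedIndicator G (y₀ + z) *
        (jac Y (y₀ + z) * regKernel n s δ (disp Y y₀ z))) -
      ∫ z, signedIndicator G (y₀ + z) * regKernel n s δ z := by
    rw [← integral_sub
      (integrable_signedIndicator_add_mul hG y₀ (hY.integrable_jac_mul_regKernel hs.1 hδ))
      (integrable_signedIndicator_add_mul hG y₀ (integrable_regKernel hs.1 hδ))]
    simp only [kernelDiff, mul_sub]
  linarith [(abs_le.1 (hC G y₀ ν hGf hG N δ Y hY hδ)).1,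
    hY.integral_regKernel_le hs.1 hδ hG0 hA0 hsub]

end Perturbation

section Smoothing

variable {V F : Type*} [NormedAddCommGroup V] [NormedSpace ℝ V] [FiniteDimensional ℝ V]
  [MeasurableSpace V] [BorelSpace V] {μ : Measure V} [μ.IsAddHaarMeasure]
  [NormedAddCommGroup F] [NormedSpace ℝ F] {k : V → F} {A : Set V}

theorem hasFDerivAt_setIntegral_comp_sub (hk : ContDiff ℝ 1 k) (hkc : HasCompactSupport k)
    (hA : MeasurableSet A) (x : V) :
    HasFDerivAt (fun x => ∫ y in A, k (x - y) ∂μ) (∫ y in A, fderiv ℝ k (x - y) ∂μ) x := by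
  let f : V → ℝ := A.indicator fun _ => 1
  have hconv : convolution f k (ContinuousLinearMap.lsmul ℝ ℝ) μ =
      fun x => ∫ y in A, k (x - y) ∂μ := by
    ext x
    rw [convolution_def, ← integral_indicator hA]
    congr 1
    ext y
    by_cases hy : y ∈ A <;> simp [f, hy]
  have hconv' : convolution f (fderiv ℝ k)
      ((ContinuousLinearMap.lsmul ℝ ℝ).precompR V) μ x = ∫ y in A, fderiv ℝ k (x - y) ∂μ := by
    rw [convolution_def, ← integral_indicator hA]
    congr 1
    ext y v
    by_cases hy : y ∈ A <;> simp [f, hy]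
  rw [← hconv, ← hconv']
  exact hkc.hasFDerivAt_convolution_right _ ((locallyIntegrable_const 1).indicator hA) hk x

theorem norm_setIntegral_comp_sub_le (hk : Continuous k) (hkc : HasCompactSupport k) (x : V) :
    ‖∫ y in A, k (x - y) ∂μ‖ ≤ ∫ y, ‖k y‖ ∂μ :=
  calc ‖∫ y in A, k (x - y) ∂μ‖ ≤ ∫ y in A, ‖k (x - y)‖ ∂μ := norm_integral_le_integral_norm _
    _ ≤ ∫ y, ‖k (x - y)‖ ∂μ :=
      setIntegral_le_integral ((hk.integrable_of_hasCompactSupport hkc).comp_sub_left x).norm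
        (ae_of_all _ fun _ => norm_nonneg _)
    _ = ∫ y, ‖k y‖ ∂μ := integral_sub_left_eq_self (fun y => ‖k y‖) μ x

theorem norm_setIntegral_comp_sub_sub_le (hk : ContDiff ℝ 1 k) (hkc : HasCompactSupport k)
    (hA : MeasurableSet A) (x x' : V) :
    ‖(∫ y in A, k (x - y) ∂μ) - ∫ y in A, k (x' - y) ∂μ‖ ≤
      (∫ y, ‖fderiv ℝ k y‖ ∂μ) * ‖x - x'‖ :=
  convex_univ.norm_image_sub_le_of_norm_hasFDerivWithin_le (𝕜 := ℝ)
    (fun z _ => (hasFDerivAt_setIntegral_comp_sub hk hkc hA z).hasFDerivWithinAt)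
    (fun z _ => norm_setIntegral_comp_sub_le (hk.continuous_fderiv one_ne_zero)
      (hkc.fderiv (𝕜 := ℝ)) z) (mem_univ x') (mem_univ x)

end Smoothing

section OutField

variable {ρ δ : ℝ} {A : Set (Space n)} {p ν : Space n}

/-- A differentiable map that is bounded, together with its derivative and the Lipschitz constant of
the latter, by `M`: the quantitative regularity of the fields along which sets are displaced. -/
structure BoundedField {V W : Type*} [NormedAddCommGroup V] [NormedSpace ℝ V]
    [NormedAddCommGroup W] [NormedSpace ℝ W] (M : ℝ) (X : V → W) : Prop where
  diff : Differentiable ℝ X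
  norm_le : ∀ x, ‖X x‖ ≤ M
  fderiv_le : ∀ x, ‖fderiv ℝ X x‖ ≤ M
  lip : ∀ x y, ‖fderiv ℝ X x - fderiv ℝ X y‖ ≤ M * ‖x - y‖

/-- The smooth cutoff that equals `1` on the ball of radius `ρ / 2` and is supported in that of
radius `ρ`. -/
def cutoff (n : ℕ) (ρ : ℝ) (hρ : 0 < ρ) : ContDiffBump (0 : Space n) where
  rIn := ρ / 2
  rOut := ρ
  rIn_pos := by positivity
  rIn_lt_rOut := by linarith

/-- A smooth field pointing out of `A` near its boundary: the weighted sum of `x - y` over the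
points `y` of `A` near `x`. -/
def outField (ρ : ℝ) (hρ : 0 < ρ) (A : Set (Space n)) (x : Space n) : Space n :=
  ∫ y in A, cutoff n ρ hρ (x - y) • (x - y)

theorem exists_boundedField_outField (n : ℕ) (hρ : 0 < ρ) : ∃ M : ℝ, 1 ≤ M ∧
    ∀ A : Set (Space n), MeasurableSet A → BoundedField M (outField ρ hρ A) := by
  let k : Space n → Space n := fun z => cutoff n ρ hρ z • z
  have hk : ContDiff ℝ 2 k := (cutoff n ρ hρ).contDiff.smul contDiff_id
  have hkc : HasCompactSupport k := (cutoff n ρ hρ).hasCompactSupport.smul_right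
  have hk1 : ContDiff ℝ 1 k := hk.of_le (by norm_num)
  have hdk : ContDiff ℝ 1 (fderiv ℝ k) := hk.fderiv_right (by norm_num)
  have hdkc : HasCompactSupport (fderiv ℝ k) := hkc.fderiv (𝕜 := ℝ)
  have hM₀ : 0 ≤ ∫ y, ‖k y‖ := integral_nonneg fun y => norm_nonneg _
  have hM₁ : 0 ≤ ∫ y, ‖fderiv ℝ k y‖ := integral_nonneg fun y => norm_nonneg _
  have hM₂ : 0 ≤ ∫ y, ‖fderiv ℝ (fderiv ℝ k) y‖ := integral_nonneg fun y => by positivity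
  refine ⟨1 + (∫ y, ‖k y‖) + (∫ y, ‖fderiv ℝ k y‖) + ∫ y, ‖fderiv ℝ (fderiv ℝ k) y‖,
    by linarith, fun A hA => ?_⟩
  have hderiv : ∀ x, HasFDerivAt (outField ρ hρ A) (∫ y in A, fderiv ℝ k (x - y)) x :=
    hasFDerivAt_setIntegral_comp_sub hk1 hkc hA
  refine ⟨fun x => (hderiv x).differentiableAt, fun x => ?_, fun x => ?_, fun x x' => ?_⟩
  · exact (norm_setIntegral_comp_sub_le hk.continuous hkc x).trans (by linarith)
  · rw [(hderiv x).fderiv]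
    exact (norm_setIntegral_comp_sub_le hdk.continuous hdkc x).trans (by linarith)
  · rw [(hderiv x).fderiv, (hderiv x').fderiv]
    exact (norm_setIntegral_comp_sub_sub_le hdk hdkc hA x x').trans (by gcongr; linarith)

theorem integrable_cutoff_mul_inner (hρ : 0 < ρ) (p ν : Space n) :
    Integrable fun y => cutoff n ρ hρ (p - y) * inner ℝ (p - y) ν := by
  have hcont : Continuous fun z : Space n => cutoff n ρ hρ z * inner ℝ z ν :=
    (cutoff n ρ hρ).continuous.mul (by fun_prop)
  exact (hcont.integrable_of_hasCompactSupport
    (cutoff n ρ hρ).hasCompactSupport.mul_right).comp_sub_left p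

theorem inner_outField (hρ : 0 < ρ) (A : Set (Space n)) (p ν : Space n) :
    inner ℝ (outField ρ hρ A p) ν = ∫ y in A, cutoff n ρ hρ (p - y) * inner ℝ (p - y) ν := by
  have hcont : Continuous fun z : Space n => cutoff n ρ hρ z • z :=
    (cutoff n ρ hρ).continuous.smul continuous_id
  have hint : Integrable fun y => cutoff n ρ hρ (p - y) • (p - y) :=
    (hcont.integrable_of_hasCompactSupport
      (cutoff n ρ hρ).hasCompactSupport.smul_right).comp_sub_left p
  rw [real_inner_comm, outField, ← innerSL_apply_apply ℝ,
    ← (innerSL ℝ ν).integral_comp_comm hint.integrableOn]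
  simp only [innerSL_apply_apply, real_inner_smul_right, real_inner_comm ν]

theorem norm_le_and_inner_le_of_mem_ball_sub_smul (hρ : 0 < ρ) (hν : ‖ν‖ = 1) {y : Space n}
    (hy : y ∈ Metric.ball (p - (ρ / 4) • ν) (ρ / 8)) :
    ‖y - p‖ ≤ 3 * ρ / 8 ∧ inner ℝ (y - p) ν ≤ -(ρ / 8) := by
  rw [Metric.mem_ball, dist_eq_norm] at hy
  set e := y - (p - (ρ / 4) • ν) with he
  have hsub : y - p = e - (ρ / 4) • ν := by rw [he]; abel
  have hnorm : ‖(ρ / 4) • ν‖ = ρ / 4 := by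
    rw [norm_smul, hν, mul_one, Real.norm_of_nonneg (by positivity)]
  have he_inner : inner ℝ e ν ≤ ‖e‖ := by simpa [hν] using real_inner_le_norm e ν
  rw [hsub]
  constructor
  · linarith [norm_sub_le e ((ρ / 4) • ν)]
  · rw [inner_sub_left, real_inner_smul_left, real_inner_self_eq_norm_sq, hν]
    linarith

/-- The points of `A` deep below the tangent plane contribute a definite amount to
`⟪outField A p, ν⟫`, and those above it, which lie in a slab of thickness `δ`, little. -/
theorem indicator_sub_indicator_le (hρ : 0 < ρ) (hν : ‖ν‖ = 1) (hδ0 : 0 ≤ δ) (hδ : δ < ρ / 8)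
    (hbelow : ∀ y, ‖y - p‖ < ρ → inner ℝ (y - p) ν < -δ → y ∈ A)
    (habove : ∀ y, ‖y - p‖ < ρ → δ < inner ℝ (y - p) ν → y ∉ A) (y : Space n) :
    (Metric.ball (p - (ρ / 4) • ν) (ρ / 8)).indicator (fun _ => ρ / 8) y -
      (Metric.ball p ρ).indicator (fun _ => δ) y ≤
      A.indicator (fun y => cutoff n ρ hρ (p - y) * inner ℝ (p - y) ν) y := by
  set φ := cutoff n ρ hρ
  have hφ0 : 0 ≤ φ (p - y) := φ.nonneg
  have hφ1 : φ (p - y) ≤ 1 := φ.le_one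
  have hneg : inner ℝ (p - y) ν = -(inner ℝ (y - p) ν : ℝ) := by rw [← neg_sub, inner_neg_left]
  have hδind : 0 ≤ (Metric.ball p ρ).indicator (fun _ : Space n => δ) y :=
    indicator_nonneg (fun _ _ => hδ0) y
  by_cases hyball : y ∈ Metric.ball (p - (ρ / 4) • ν) (ρ / 8)
  · obtain ⟨hnorm, hinner⟩ := norm_le_and_inner_le_of_mem_ball_sub_smul hρ hν hyball
    have hφy : φ (p - y) = 1 := φ.one_of_mem_closedBall (by
      rw [mem_closedBall_zero_iff, norm_sub_rev]
      exact hnorm.trans (by simp only [φ, cutoff]; linarith))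
    rw [indicator_of_mem hyball,
      indicator_of_mem (hbelow y (by linarith) (by linarith)), hφy, hneg]
    linarith
  rw [indicator_of_notMem hyball]
  by_cases hyA : y ∈ A
  · rw [indicator_of_mem hyA]
    by_cases hyp : ‖y - p‖ < ρ
    · have hinner : inner ℝ (y - p) ν ≤ δ := not_lt.1 fun hlt => habove y hyp hlt hyA
      rw [indicator_of_mem (by rwa [Metric.mem_ball, dist_eq_norm]), hneg]
      nlinarith
    · rw [φ.zero_of_le_dist (by rw [dist_zero_right, norm_sub_rev]; exact not_lt.1 hyp), zero_mul]
      linarith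
  · rw [indicator_of_notMem hyA]
    linarith

theorem le_inner_outField (hρ : 0 < ρ) (hA : MeasurableSet A) (hν : ‖ν‖ = 1) (hδ0 : 0 ≤ δ)
    (hδ : δ < ρ / 8) (hbelow : ∀ y, ‖y - p‖ < ρ → inner ℝ (y - p) ν < -δ → y ∈ A)
    (habove : ∀ y, ‖y - p‖ < ρ → δ < inner ℝ (y - p) ν → y ∉ A) :
    ρ / 8 * volume.real (Metric.ball (0 : Space n) (ρ / 8)) -
      δ * volume.real (Metric.ball (0 : Space n) ρ) ≤ inner ℝ (outField ρ hρ A p) ν := by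
  have hint : ∀ (c : Space n) (R a : ℝ),
      Integrable ((Metric.ball c R).indicator fun _ : Space n => a) := fun c R a =>
    (integrable_indicator_iff measurableSet_ball).2 (integrableOn_const measure_ball_lt_top.ne)
  have hball : ∀ (c : Space n) (R a : ℝ), ∫ y, (Metric.ball c R).indicator (fun _ => a) y =
      a * volume.real (Metric.ball (0 : Space n) R) := fun c R a => by
    rw [integral_indicator measurableSet_ball, setIntegral_const, smul_eq_mul, mul_comm,
      Measure.real, Measure.real, Measure.addHaar_ball_center volume c]
  rw [inner_outField, ← integral_indicator hA, ← hball (p - (ρ / 4) • ν), ← hball p,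
    ← integral_sub (hint _ _ _) (hint _ _ _)]
  exact integral_mono ((hint _ _ _).sub (hint _ _ _))
    ((integrable_cutoff_mul_inner hρ p ν).indicator hA)
    (indicator_sub_indicator_le hρ hν hδ0 hδ hbelow habove)

end OutField

theorem tendsto_add_smul_nhdsGT_zero {V : Type*} [NormedAddCommGroup V] [NormedSpace ℝ V]
    (x d : V) : Tendsto (fun ε : ℝ => x + ε • d) (𝓝[>] 0) (𝓝 x) := by
  simpa using tendsto_const_nhds.add (tendsto_id_nhdsGT_zero.smul_const d)

theorem deriv_nonpos_of_eventually_le_left {f : ℝ → ℝ} {f' t : ℝ}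
    (hf : HasDerivWithinAt f f' (Iio t) t) (h : ∀ᶠ τ in 𝓝[<] t, f t ≤ f τ) : f' ≤ 0 := by
  rw [hasDerivWithinAt_iff_tendsto_slope' self_notMem_Iio] at hf
  refine le_of_tendsto hf ?_
  filter_upwards [h, self_mem_nhdsWithin] with τ hle hτ
  rw [slope_def_field]
  exact div_nonpos_of_nonneg_of_nonpos (sub_nonneg.2 hle) (sub_nonpos.2 (le_of_lt hτ))

theorem frequently_lt_zero_of_fderiv_ne_zero {V : Type*} [NormedAddCommGroup V] [NormedSpace ℝ V]
    {f : V → ℝ} {x : V} (hne : f x = 0 → fderiv ℝ f x ≠ 0) (hle : f x ≤ 0) :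
    ∃ᶠ y in 𝓝 x, f y < 0 := by
  intro hge
  simp only [not_lt] at hge
  have hzero : f x = 0 := le_antisymm hle hge.self_of_nhds
  exact hne hzero (IsLocalMin.fderiv_eq_zero (by filter_upwards [hge] with y hy; rwa [hzero]))

theorem tendsto_prodMk_right_nhdsWithin {X : Type*} [TopologicalSpace X] {I : Set ℝ} {t : ℝ}
    (ht : t ∈ I) (x : X) : Tendsto (fun y => (y, t)) (𝓝 x) (𝓝[univ ×ˢ I] (x, t)) :=
  tendsto_nhdsWithin_iff.2 ⟨(Continuous.prodMk_left t).tendsto x,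
    Eventually.of_forall fun _ => ⟨mem_univ _, ht⟩⟩

theorem tendsto_prodMk_nhdsLT {X : Type*} [TopologicalSpace X] {c t : ℝ} (ht : t ∈ Ioc 0 c)
    {γ : ℝ → X} {x : X} (hγ : Tendsto γ (𝓝[<] t) (𝓝 x)) :
    Tendsto (fun τ => (γ τ, τ)) (𝓝[<] t) (𝓝[univ ×ˢ Icc 0 c] (x, t)) :=
  tendsto_nhdsWithin_iff.2 ⟨hγ.prodMk_nhds (tendsto_id.mono_left nhdsWithin_le_nhds),
    mem_of_superset (Icc_mem_nhdsLT_of_mem ht) fun _ hτ => ⟨mem_univ _, hτ⟩⟩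

section C1Family

variable {c t : ℝ} {E : ℝ → Set (Space n)} {x : Space n}

theorem IsC1Family.compl (h : IsC1Family c E) : IsC1Family c fun t => (E t)ᶜ := by
  intro t₀ ht₀ x₀
  obtain ⟨u, hu, hne, hev⟩ := h t₀ ht₀ x₀
  refine ⟨fun p => -u p, hu.neg, fun h0 => ?_, ?_⟩
  · rw [fderiv_fun_neg]
    exact neg_ne_zero.2 (hne (neg_eq_zero.1 h0))
  · filter_upwards [hev] with p hp
    exact ⟨fun h => hp.2 (by linarith), fun h => not_not.2 (hp.1 (by linarith))⟩

theorem IsC1Family.exists_sign (h : IsC1Family c E) (ht : t ∈ Icc 0 c) (x : Space n) :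
    ∃ u : Space n × ℝ → ℝ, ContDiff ℝ 1 u ∧
      (u (x, t) = 0 → fderiv ℝ (fun y => u (y, t)) x ≠ 0) ∧
      ∀ᶠ p in 𝓝[univ ×ˢ Icc 0 c] (x, t),
        (u p < 0 → p.1 ∈ interior (E p.2)) ∧ (0 < u p → p.1 ∉ closure (E p.2)) := by
  obtain ⟨u, hu, hne, hev⟩ := h t ht x
  refine ⟨u, hu, hne, ?_⟩
  filter_upwards [eventually_eventually_nhdsWithin.2 hev, self_mem_nhdsWithin] with p hp hpI
  have hslice := (tendsto_prodMk_right_nhdsWithin hpI.2 p.1).eventually hp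
  have hcont : ContinuousAt (fun y => u (y, p.2)) p.1 :=
    (hu.continuous.comp (Continuous.prodMk_left p.2)).continuousAt
  constructor
  · intro hup
    rw [mem_interior_iff_mem_nhds]
    filter_upwards [hslice, hcont.eventually (gt_mem_nhds hup)] with y hy hlt using hy.1 hlt
  · intro hup
    rw [← mem_compl_iff, ← interior_compl, mem_interior_iff_mem_nhds]
    filter_upwards [hslice, hcont.eventually (lt_mem_nhds hup)] with y hy hlt using hy.2 hlt

theorem IsC1Family.closure_subset_closure_interior (h : IsC1Family c E) (ht : t ∈ Icc 0 c) :
    closure (E t) ⊆ closure (interior (E t)) := by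
  intro x hx
  obtain ⟨u, -, hne, hev⟩ := h.exists_sign ht x
  have hle : u (x, t) ≤ 0 :=
    not_lt.1 fun hlt => (hev.self_of_nhdsWithin ⟨mem_univ _, ht⟩).2 hlt hx
  rw [mem_closure_iff_frequently]
  exact (frequently_lt_zero_of_fderiv_ne_zero (f := fun y => u (y, t)) hne hle).mp
    (((tendsto_prodMk_right_nhdsWithin ht x).eventually hev).mono fun y hy hlt => hy.1 hlt)

theorem IsC1Family.eventually_mem_interior (h : IsC1Family c E) (ht : t ∈ Icc 0 c)
    (hx : x ∈ interior (E t)) : ∀ᶠ p in 𝓝[univ ×ˢ Icc 0 c] (x, t), p.1 ∈ interior (E p.2) := by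
  obtain ⟨u, hu, hne, hev⟩ := h.exists_sign ht x
  have hlt : u (x, t) < 0 := by
    by_contra! hle
    obtain ⟨y, hneg, hy, hyE⟩ := ((frequently_lt_zero_of_fderiv_ne_zero
      (f := fun y => -u (y, t)) (fun h0 => by
        rw [fderiv_fun_neg]
        exact neg_ne_zero.2 (hne (neg_eq_zero.1 h0))) (neg_nonpos.2 hle)).and_eventually
      (((tendsto_prodMk_right_nhdsWithin ht x).eventually hev).and
        (isOpen_interior.mem_nhds hx))).exists
    exact hy.2 (neg_lt_zero.1 hneg) (interior_subset_closure hyE)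
  filter_upwards [hev, mem_nhdsWithin_of_mem_nhds
    (hu.continuous.continuousAt.eventually (gt_mem_nhds hlt))] with p hp hup using hp.1 hup

theorem IsC1Family.isClosed_closure_track (h : IsC1Family c E) :
    IsClosed {p : Space n × ℝ | p.2 ∈ Icc 0 c ∧ p.1 ∈ closure (E p.2)} := by
  rw [← isOpen_compl_iff, isOpen_iff_mem_nhds]
  rintro ⟨x, t⟩ hp
  by_cases ht : t ∈ Icc 0 c
  · have hx : x ∈ interior (E t)ᶜ := by
      rw [interior_compl]
      exact fun hx => hp ⟨ht, hx⟩
    filter_upwards [eventually_nhdsWithin_iff.1 (h.compl.eventually_mem_interior ht hx)]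
      with p hpc hpE
    have := hpc ⟨mem_univ _, hpE.1⟩
    rw [interior_compl] at this
    exact this hpE.2
  · filter_upwards [(isClosed_Icc.isOpen_compl.preimage continuous_snd).mem_nhds ht]
      with p hpt hpE using hpt hpE.1

theorem IsC1Family.eventually_left_mem_interior (h : IsC1Family c E) (ht : t ∈ Ioc 0 c)
    (hx : x ∈ interior (E t)) {γ : ℝ → Space n} (hγ : Tendsto γ (𝓝[<] t) (𝓝 x)) :
    ∀ᶠ τ in 𝓝[<] t, γ τ ∈ interior (E τ) :=
  (tendsto_prodMk_nhdsLT ht hγ).eventually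
    (h.eventually_mem_interior (Ioc_subset_Icc_self ht) hx)

theorem IsC1Family.exists_defining_function (h : IsC1Family c E) (ht : t ∈ Icc 0 c)
    (hx : x ∈ frontier (E t)) {ν : Space n} (hν : IsOuterNormal (E t) x ν) :
    ∃ (u : Space n × ℝ → ℝ) (u' : Space n × ℝ →L[ℝ] ℝ) (κ : ℝ), u (x, t) = 0 ∧
      HasFDerivAt u u' (x, t) ∧ 0 < κ ∧ (∀ d, u' (d, 0) = κ * inner ℝ d ν) ∧
      ∀ᶠ p in 𝓝[univ ×ˢ Icc 0 c] (x, t),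
        (u p < 0 → p.1 ∈ interior (E p.2)) ∧ (0 < u p → p.1 ∉ closure (E p.2)) := by
  obtain ⟨u, hu, hne, hev⟩ := h.exists_sign ht x
  have hsign := hev.self_of_nhdsWithin ⟨mem_univ _, ht⟩
  have hu0 : u (x, t) = 0 := le_antisymm (not_lt.1 fun hlt => hsign.2 hlt hx.1)
    (not_lt.1 fun hlt => hx.2 (hsign.1 hlt))
  have hu' : HasFDerivAt u (fderiv ℝ u (x, t)) (x, t) :=
    (hu.differentiable one_ne_zero (x, t)).hasFDerivAt
  set m : Space n →L[ℝ] ℝ := (fderiv ℝ u (x, t)).comp (ContinuousLinearMap.inl ℝ (Space n) ℝ)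
  have hm : HasFDerivAt (fun z => u (z, t)) m x := hu'.comp x (hasFDerivAt_prodMk_left x t)
  have hm_nonneg : ∀ d, 0 < inner ℝ d ν → 0 ≤ m d := fun d hd => by
    refine ge_of_tendsto (hm.hasLineDerivAt d).tendsto_slope_zero_right ?_
    filter_upwards [hν.eventually_add_smul_mem_interior_compl hd, self_mem_nhdsWithin,
      (tendsto_add_smul_nhdsGT_zero x d).eventually
        ((tendsto_prodMk_right_nhdsWithin ht x).eventually hev)] with ε hout hε hsign
    have hnonneg : 0 ≤ u (x + ε • d, t) :=
      not_lt.1 fun hlt => interior_subset hout (interior_subset (hsign.1 hlt))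
    rw [hu0, sub_zero]
    exact smul_nonneg (inv_nonneg.2 (le_of_lt hε)) hnonneg
  have hm_eq := eq_mul_inner_of_nonneg_on_halfspace hν.1 m.toLinearMap hm_nonneg
  refine ⟨u, _, m ν, hu0, hu', lt_of_le_of_ne (hm_nonneg ν (by simp [hν.1])) fun h0 => ?_,
    hm_eq, hev⟩
  refine hne hu0 (hm.fderiv.trans (ContinuousLinearMap.ext fun d => ?_))
  simpa [← h0] using hm_eq d

end C1Family

section MovingFamily

variable {c t : ℝ} {E : ℝ → Set (Space n)} {V : ℝ → Space n → ℝ} {x ν : Space n}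

/-- A family of sets whose boundaries move in a `C¹` way with outward normal velocity `V`. Keeping
`V` arbitrary allows time shifts, complements and constant families. -/
structure MovingFamily (c : ℝ) (E : ℝ → Set (Space n)) (V : ℝ → Space n → ℝ) : Prop where
  isC1Family : IsC1Family c E
  motion : ∀ t ∈ Icc 0 c, ∀ x ∈ frontier (E t), ∃ (ν : Space n) (γ : ℝ → Space n) (v : Space n),
    IsOuterNormal (E t) x ν ∧ γ t = x ∧ (∀ᶠ τ in 𝓝[Icc 0 c] t, γ τ ∈ frontier (E τ)) ∧
    HasDerivWithinAt γ v (Icc 0 c) t ∧ inner ℝ v ν = V t x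

theorem MovingFamily.exists_trajectory (h : MovingFamily c E V) (ht : t ∈ Ioc 0 c)
    (hx : x ∈ frontier (E t)) : ∃ (ν : Space n) (γ : ℝ → Space n) (v : Space n),
      IsOuterNormal (E t) x ν ∧ γ t = x ∧ (∀ᶠ τ in 𝓝[<] t, γ τ ∈ frontier (E τ)) ∧
      HasDerivWithinAt γ v (Iio t) t ∧ inner ℝ v ν = V t x := by
  obtain ⟨ν, γ, v, hν, hγt, hγ, hγ', hv⟩ := h.motion t (Ioc_subset_Icc_self ht) x hx
  have hmem : Icc 0 c ∈ 𝓝[<] t := Icc_mem_nhdsLT_of_mem ht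
  exact ⟨ν, γ, v, hν, hγt, nhdsWithin_le_of_mem hmem hγ, hγ'.mono_of_mem_nhdsWithin hmem, hv⟩

theorem hasDerivWithinAt_comp_prodMk {u : Space n × ℝ → ℝ} {u' : Space n × ℝ →L[ℝ] ℝ} {s : Set ℝ}
    (hu : HasFDerivAt u u' (x, t)) {γ : ℝ → Space n} {w : Space n} (hγt : γ t = x)
    (hγ : HasDerivWithinAt γ w s t) :
    HasDerivWithinAt (fun τ => u (γ τ, τ)) (u' (w, 1)) s t := by
  subst hγt
  exact hu.comp_hasDerivWithinAt (f := fun τ => (γ τ, τ)) t (hγ.prodMk (hasDerivWithinAt_id t s))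

theorem MovingFamily.inner_le_of_eventually_notMem_interior (h : MovingFamily c E V)
    (ht : t ∈ Ioc 0 c) (hx : x ∈ frontier (E t)) (hν : IsOuterNormal (E t) x ν)
    {γ : ℝ → Space n} {w : Space n} (hγt : γ t = x) (hγ : HasDerivWithinAt γ w (Iio t) t)
    (hout : ∀ᶠ τ in 𝓝[<] t, γ τ ∉ interior (E τ)) : inner ℝ w ν ≤ V t x := by
  obtain ⟨u, u', κ, hu0, hu, hκ, hspace, hsign⟩ :=
    h.isC1Family.exists_defining_function (Ioc_subset_Icc_self ht) hx hν
  obtain ⟨ν', σ, v, hν', hσt, hσmem, hσ, hv⟩ := h.exists_trajectory ht hx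
  obtain rfl := hν.unique hν'
  have hsplit : ∀ d, u' (d, 1) = κ * inner ℝ d ν + u' (0, 1) := fun d => by
    rw [← hspace, ← map_add]; simp
  have htends : ∀ {f : ℝ → Space n} {d : Space n}, f t = x → HasDerivWithinAt f d (Iio t) t →
      Tendsto (fun τ => (f τ, τ)) (𝓝[<] t) (𝓝[univ ×ˢ Icc 0 c] (x, t)) := fun hft hf =>
    tendsto_prodMk_nhdsLT ht (hft ▸ hf.continuousWithinAt)
  have hw : u' (w, 1) ≤ 0 := by
    refine deriv_nonpos_of_eventually_le_left (hasDerivWithinAt_comp_prodMk hu hγt hγ) ?_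
    filter_upwards [hout, (htends hγt hγ).eventually hsign] with τ hτ hs
    rw [hγt, hu0]
    exact not_lt.1 fun hlt => hτ (hs.1 hlt)
  have hv' : 0 ≤ u' (v, 1) := by
    refine neg_nonpos.1 (deriv_nonpos_of_eventually_le_left
      (hasDerivWithinAt_comp_prodMk hu hσt hσ).neg ?_)
    filter_upwards [hσmem, (htends hσt hσ).eventually hsign] with τ hτ hs
    simp only [Pi.neg_apply, hσt, hu0]
    exact neg_le_neg (not_lt.1 fun hlt => hs.2 hlt hτ.1)
  rw [hsplit] at hw hv'
  exact hv ▸ le_of_mul_le_mul_left (by linarith) hκ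

theorem MovingFamily.compl (h : MovingFamily c E V) :
    MovingFamily c (fun t => (E t)ᶜ) fun t x => -V t x := by
  refine ⟨h.isC1Family.compl, fun t ht x hx => ?_⟩
  rw [frontier_compl] at hx
  obtain ⟨ν, γ, v, hν, hγt, hγ, hγ', hv⟩ := h.motion t ht x hx
  refine ⟨-ν, γ, v, hν.compl, hγt, ?_, hγ', by rw [inner_neg_right, hv]⟩
  simpa only [frontier_compl] using hγ

theorem IsOuterNormal.eq_of_forall_norm_sub_le {A : Set (Space n)} {p : Space n} (hpx : p ≠ x)
    (hν : IsOuterNormal A p ν) (hmin : ∀ y ∈ interior A, ‖p - x‖ ≤ ‖y - x‖) :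
    ν = ‖x - p‖⁻¹ • (x - p) := by
  by_contra hne
  have hR : 0 < ‖x - p‖ := norm_pos_iff.2 (sub_ne_zero.2 hpx.symm)
  have hunit : ‖‖x - p‖⁻¹ • (x - p)‖ = 1 := by
    rw [norm_smul, norm_inv, norm_norm, inv_mul_cancel₀ hR.ne']
  obtain ⟨htoward, hinward⟩ := inner_sub_pos_and_neg_of_ne hunit hν.1 (Ne.symm hne)
  set d := ‖x - p‖⁻¹ • (x - p) - ν
  rw [inner_smul_right] at htoward
  replace htoward : 0 < inner ℝ d (x - p) := (pos_iff_pos_of_mul_pos htoward).1 (by positivity)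
  have hsmall : ∀ᶠ ε : ℝ in 𝓝[>] 0, ε * ‖d‖ ^ 2 < 2 * inner ℝ d (x - p) := by
    refine (tendsto_id_nhdsGT_zero.mul_const (‖d‖ ^ 2)).eventually (gt_mem_nhds ?_)
    rw [zero_mul]
    positivity
  obtain ⟨ε, hmem, hεd, hε : 0 < ε⟩ := ((hν.eventually_add_smul_mem_interior hinward).and
    (hsmall.and self_mem_nhdsWithin)).exists
  have hexpand : ‖p + ε • d - x‖ ^ 2 =
      ‖p - x‖ ^ 2 - ε * (2 * inner ℝ d (x - p) - ε * ‖d‖ ^ 2) := by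
    rw [show p + ε • d - x = ε • d - (x - p) by abel, norm_sub_sq_real, real_inner_smul_left,
      norm_smul, norm_sub_rev x p, Real.norm_of_nonneg hε.le]
    ring
  have hfar : ‖p - x‖ ^ 2 ≤ ‖p + ε • d - x‖ ^ 2 := by gcongr; exact hmin _ hmem
  nlinarith [mul_pos hε (sub_pos.2 hεd)]

theorem IsC1Family.exists_first_entry (h : IsC1Family c E) {R : ℝ → ℝ} (hR : Continuous R)
    (hanti : Antitone R) {t₁ t₂ : ℝ} (ht₁ : 0 ≤ t₁) (ht₂ : t₂ ≤ c) (h12 : t₁ ≤ t₂)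
    (hR₂ : 0 ≤ R t₂) (hstart : ∀ y ∈ closure (E t₁), R t₁ < ‖y - x‖) (hx : x ∈ closure (E t₂)) :
    ∃ t ∈ Ioc t₁ t₂, ∃ p ∈ closure (E t), ‖p - x‖ ≤ R t ∧
      ∀ τ ∈ Ico t₁ t, ∀ y ∈ closure (E τ), R τ < ‖y - x‖ := by
  let K : Set (Space n × ℝ) := {p | p.2 ∈ Icc 0 c ∧ p.1 ∈ closure (E p.2)} ∩
    ({p | p.2 ∈ Icc t₁ t₂} ∩ {p | ‖p.1 - x‖ ≤ R p.2})
  have hK : IsCompact K := by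
    refine ((isCompact_closedBall x (R t₁)).prod
      (isCompact_Icc (a := t₁) (b := t₂))).of_isClosed_subset (h.isClosed_closure_track.inter
        ((isClosed_Icc.preimage continuous_snd).inter (isClosed_le (by fun_prop) (by fun_prop)))) ?_
    rintro ⟨p, t⟩ ⟨-, ht, hp⟩
    exact ⟨by rw [Metric.mem_closedBall, dist_eq_norm]; exact hp.trans (hanti ht.1), ht⟩
  obtain ⟨⟨p, t⟩, ⟨⟨htc, hpE⟩, ht, hpR⟩, hmin⟩ := hK.exists_isMinOn
    ⟨(x, t₂), ⟨⟨ht₁.trans h12, ht₂⟩, hx⟩, ⟨h12, le_rfl⟩, by simpa using hR₂⟩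
    continuous_snd.continuousOn
  refine ⟨t, ⟨lt_of_le_of_ne ht.1 ?_, ht.2⟩, p, hpE, hpR, fun τ hτ y hy => ?_⟩
  · rintro rfl
    exact (hstart p hpE).not_ge hpR
  · by_contra! hle
    exact hτ.2.not_ge (hmin (a := (y, τ))
      ⟨⟨⟨ht₁.trans hτ.1, hτ.2.le.trans htc.2⟩, hy⟩, ⟨hτ.1, hτ.2.le.trans ht.2⟩, hle⟩)

theorem IsC1Family.le_norm_sub_of_eventually_lt (h : IsC1Family c E) (ht : t ∈ Ioc 0 c) {R : ℝ → ℝ}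
    (hR : ContinuousAt R t) (hearly : ∀ᶠ τ in 𝓝[<] t, ∀ y ∈ closure (E τ), R τ < ‖y - x‖)
    {y : Space n} (hy : y ∈ closure (E t)) : R t ≤ ‖y - x‖ := by
  have hinterior : ∀ z ∈ interior (E t), R t ≤ ‖z - x‖ := fun z hz =>
    le_of_tendsto (hR.mono_left nhdsWithin_le_nhds) <| by
      filter_upwards [h.eventually_left_mem_interior ht hz tendsto_const_nhds, hearly] with τ hzτ hτ
      exact (hτ z (interior_subset_closure hzτ)).le
  have hclosed : IsClosed {z | R t ≤ ‖z - x‖} := isClosed_le continuous_const (by fun_prop)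
  exact closure_minimal hinterior hclosed
    (h.closure_subset_closure_interior (Ioc_subset_Icc_self ht) hy)

theorem notMem_interior_of_forall_norm_sub_le {F : Type*} [NormedAddCommGroup F] [NormedSpace ℝ F]
    {A : Set F} {p x : F} (hpx : p ≠ x) (hmin : ∀ y ∈ A, ‖p - x‖ ≤ ‖y - x‖) : p ∉ interior A := by
  intro hp
  obtain ⟨ε, hmem, hε⟩ := (((tendsto_add_smul_nhdsGT_zero p (x - p)).eventually
    (isOpen_interior.mem_nhds hp)).and (Ioo_mem_nhdsGT one_pos)).exists
  have hle := hmin _ (interior_subset hmem)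
  rw [show p + ε • (x - p) - x = (1 - ε) • (p - x) by module, norm_smul,
    Real.norm_of_nonneg (by linarith [hε.2])] at hle
  nlinarith [hε.1, norm_pos_iff.2 (sub_ne_zero.2 hpx)]

/-- A ball around `x` that shrinks faster than the boundary can move stays outside of `E`: at a
first contact the radial motion of the sphere would be slower than the boundary. -/
theorem MovingFamily.notMem_closure_of_forall_lt_norm_sub (h : MovingFamily c E V) {C₀ : ℝ}
    (hC₀ : 0 ≤ C₀) (hV : ∀ t ∈ Icc 0 c, ∀ x ∈ frontier (E t), V t x ≤ C₀) {t₁ t₂ ρ : ℝ}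
    (ht₁ : 0 ≤ t₁) (ht₂ : t₂ ≤ c) (h12 : t₁ ≤ t₂) (hρ : (C₀ + 1) * (t₂ - t₁) < ρ)
    (hball : ∀ y ∈ closure (E t₁), ρ < ‖y - x‖) : x ∉ closure (E t₂) := by
  intro hx
  let R : ℝ → ℝ := fun τ => ρ - (C₀ + 1) * (τ - t₁)
  have hRc : Continuous R := by fun_prop
  have hanti : Antitone R := fun a b hab => by simp only [R]; gcongr
  obtain ⟨t, ht, p, hpE, hpR, hbefore⟩ := h.isC1Family.exists_first_entry hRc hanti ht₁ ht₂ h12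
    (by simp only [R]; linarith) (by simpa [R] using hball) hx
  have htc : t ∈ Ioc 0 c := ⟨ht₁.trans_lt ht.1, ht.2.trans ht₂⟩
  have hearly : ∀ᶠ τ in 𝓝[<] t, ∀ y ∈ closure (E τ), R τ < ‖y - x‖ :=
    mem_of_superset (Ico_mem_nhdsLT ht.1) hbefore
  have hfar : ∀ y ∈ closure (E t), R t ≤ ‖y - x‖ := fun y =>
    h.isC1Family.le_norm_sub_of_eventually_lt htc hRc.continuousAt hearly
  have hpeq : ‖p - x‖ = R t := le_antisymm hpR (hfar p hpE)
  have hRt : 0 < R t := lt_of_lt_of_le (by simp only [R]; linarith) (hanti ht.2)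
  have hpx : p ≠ x := by
    rintro rfl
    simp only [sub_self, norm_zero] at hpeq
    exact hRt.ne hpeq
  have hmin : ∀ y ∈ E t, ‖p - x‖ ≤ ‖y - x‖ := fun y hy => hpeq ▸ hfar y (subset_closure hy)
  have hpf : p ∈ frontier (E t) := ⟨hpE, notMem_interior_of_forall_norm_sub_le hpx hmin⟩
  obtain ⟨ν, -, -, hν, -⟩ := h.exists_trajectory htc hpf
  have hνeq : ν = (R t)⁻¹ • (x - p) := by
    rw [hν.eq_of_forall_norm_sub_le hpx fun y hy => hmin y (interior_subset hy), norm_sub_rev, hpeq]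
  have hνt : p + R t • ν = x := by rw [hνeq, smul_inv_smul₀ hRt.ne']; abel
  have hle := h.inner_le_of_eventually_notMem_interior htc hpf hν
    (γ := fun τ => x - R τ • ν) (w := (C₀ + 1) • ν) (by simp [← hνt]) ?_ ?_
  · rw [real_inner_smul_left, real_inner_self_eq_norm_sq, hν.1] at hle
    linarith [hV t (Ioc_subset_Icc_self htc) p hpf]
  · have hR' : HasDerivAt R (-(C₀ + 1)) t := by
      simpa using (((hasDerivAt_id t).sub_const t₁).const_mul (C₀ + 1)).const_sub ρ
    exact ((hR'.smul_const ν).const_sub x).hasDerivWithinAt.congr_deriv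
      (by rw [neg_smul, neg_neg])
  · filter_upwards [hearly, self_mem_nhdsWithin] with τ hτ hτt hmem
    have hdist := hτ _ (interior_subset_closure hmem)
    rw [sub_sub_cancel_left, norm_neg, norm_smul, hν.1, mul_one,
      Real.norm_of_nonneg (hRt.le.trans (hanti (le_of_lt hτt)))] at hdist
    exact lt_irrefl _ hdist

theorem MovingFamily.exists_mem_closure_norm_sub_le (h : MovingFamily c E V) {C₀ : ℝ}
    (hC₀ : 0 ≤ C₀) (hV : ∀ t ∈ Icc 0 c, ∀ x ∈ frontier (E t), V t x ≤ C₀) {t₁ t₂ : ℝ}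
    (ht₁ : 0 ≤ t₁) (ht₂ : t₂ ≤ c) (h12 : t₁ ≤ t₂) (hx : x ∈ closure (E t₂)) :
    ∃ y ∈ closure (E t₁), ‖y - x‖ ≤ (C₀ + 2) * (t₂ - t₁) := by
  rcases h12.eq_or_lt with rfl | hlt
  · exact ⟨x, hx, by simp⟩
  · by_contra! hall
    exact h.notMem_closure_of_forall_lt_norm_sub hC₀ hV ht₁ ht₂ h12
      (by nlinarith [sub_pos.2 hlt]) hall hx

end MovingFamily

section FirstContact

variable {c t : ℝ} {E G : ℝ → Set (Space n)} {V W : ℝ → Space n → ℝ} {Φ : Space n × ℝ → Space n}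
  {A B : Set (Space n)} {y ν ν' : Space n}

theorem IsC1Family.exists_first_contact_time (hE : IsC1Family c E) (hG : IsC1Family c G)
    (hΦ : Continuous Φ) (hstart : ∀ y ∈ closure (G 0)ᶜ, Φ (y, 0) ∉ closure (E 0)) {ρ : ℝ}
    (hρ : ∀ t ∈ Icc 0 c, ∀ y ∈ closure (G t)ᶜ, Φ (y, t) ∈ closure (E t) → ‖y‖ ≤ ρ)
    (hcontact : ∃ t ∈ Icc 0 c, ∃ y ∈ closure (G t)ᶜ, Φ (y, t) ∈ closure (E t)) :
    ∃ t ∈ Ioc 0 c, (∃ y ∈ closure (G t)ᶜ, Φ (y, t) ∈ closure (E t)) ∧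
      ∀ τ ∈ Ico 0 t, ∀ y ∈ closure (G τ)ᶜ, Φ (y, τ) ∉ closure (E τ) := by
  let K : Set (Space n × ℝ) := {p | p.2 ∈ Icc 0 c ∧ p.1 ∈ closure (G p.2)ᶜ} ∩
    (fun p => (Φ p, p.2)) ⁻¹' {p | p.2 ∈ Icc 0 c ∧ p.1 ∈ closure (E p.2)}
  have hK : IsCompact K := by
    refine ((isCompact_closedBall 0 ρ).prod (isCompact_Icc (a := 0) (b := c))).of_isClosed_subset
      (hG.compl.isClosed_closure_track.inter
        (hE.isClosed_closure_track.preimage (hΦ.prodMk continuous_snd))) ?_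
    rintro ⟨y, t⟩ ⟨⟨ht, hy⟩, -, hΦy⟩
    exact ⟨by rw [mem_closedBall_zero_iff]; exact hρ t ht y hy hΦy, ht⟩
  obtain ⟨t₀, ht₀, y₀, hy₀, hΦy₀⟩ := hcontact
  obtain ⟨⟨y, t⟩, ⟨⟨ht, hy⟩, -, hΦy⟩, hmin⟩ :=
    hK.exists_isMinOn ⟨(y₀, t₀), ⟨ht₀, hy₀⟩, ht₀, hΦy₀⟩ continuous_snd.continuousOn
  refine ⟨t, ⟨lt_of_le_of_ne ht.1 ?_, ht.2⟩, ⟨y, hy, hΦy⟩, fun τ hτ z hz hΦz => ?_⟩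
  · rintro rfl
    exact hstart y hy hΦy
  · have hτc : τ ∈ Icc 0 c := ⟨hτ.1, hτ.2.le.trans ht.2⟩
    exact hτ.2.not_ge (hmin (a := (z, τ)) ⟨⟨hτc, hz⟩, hτc, hΦz⟩)

theorem IsC1Family.notMem_interior_of_eventually_notMem (hE : IsC1Family c E)
    (hG : IsC1Family c G) (ht : t ∈ Ioc 0 c) (hΦ : Continuous Φ)
    (hearly : ∀ᶠ τ in 𝓝[<] t, ∀ y ∈ closure (G τ)ᶜ, Φ (y, τ) ∉ closure (E τ)) :
    ∀ y ∈ interior (G t)ᶜ, Φ (y, t) ∉ interior (E t) := by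
  intro y hy hΦy
  have hcurve : Tendsto (fun τ => Φ (y, τ)) (𝓝[<] t) (𝓝 (Φ (y, t))) :=
    ((by fun_prop : Continuous fun τ => Φ (y, τ)).tendsto t).mono_left nhdsWithin_le_nhds
  obtain ⟨τ, hE', hG', hτ⟩ := ((hE.eventually_left_mem_interior ht hΦy hcurve).and
    ((hG.compl.eventually_left_mem_interior ht hy tendsto_const_nhds).and hearly)).exists
  exact hτ y (interior_subset_closure hG') (interior_subset_closure hE')

theorem mem_frontier_and_mem_frontier_of_contact {X X' : Type*} [TopologicalSpace X]
    [TopologicalSpace X'] (Θ : X ≃ₜ X') {G : Set X} {E : Set X'} {y : X}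
    (hsep : ∀ z ∈ interior Gᶜ, Θ z ∉ interior E) (hy : y ∈ closure (interior Gᶜ))
    (hΘy : Θ y ∈ closure (interior E)) : y ∈ frontier G ∧ Θ y ∈ frontier E := by
  have hdisj : Disjoint (interior Gᶜ) (Θ ⁻¹' interior E) := disjoint_left.2 hsep
  have hopen : IsOpen (Θ ⁻¹' interior E) := isOpen_interior.preimage Θ.continuous
  rw [← frontier_compl]
  refine ⟨⟨closure_mono interior_subset hy, fun hyG => ?_⟩, closure_mono interior_subset hΘy,
    disjoint_left.1 (hdisj.closure_left hopen) hy⟩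
  exact disjoint_left.1 (hdisj.closure_right isOpen_interior) hyG
    (Θ.preimage_closure (interior E) ▸ hΘy)

theorem IsOuterNormal.inner_nonneg_of_interior_separated {φ : Space n → Space n}
    {D : Space n →L[ℝ] Space n} (hφ : HasFDerivAt φ D y) (hν : IsOuterNormal A y ν)
    (hν' : IsOuterNormal B (φ y) ν') (hsep : ∀ z ∈ interior Aᶜ, φ z ∉ interior B) {d : Space n}
    (hd : 0 < inner ℝ d ν) : 0 ≤ inner ℝ (D d) ν' := by
  by_contra! hneg
  have hslope : Tendsto (fun ε : ℝ => ε⁻¹ • (φ (y + ε • d) - φ y)) (𝓝[>] 0) (𝓝 (D d)) :=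
    (hφ.hasLineDerivAt d).tendsto_slope_zero_right
  obtain ⟨ε, hεA, hεB, hε : 0 < ε⟩ := ((hν.eventually_add_smul_mem_interior_compl hd).and
    ((hν'.eventually_mem_interior eventually_mem_nhdsWithin tendsto_id_nhdsGT_zero hslope
      hneg).and self_mem_nhdsWithin)).exists
  rw [smul_inv_smul₀ hε.ne', add_sub_cancel] at hεB
  exact hsep _ hεA hεB

theorem IsOuterNormal.exists_inner_fderiv_eq_mul {φ : Space n → Space n}
    {D : Space n →L[ℝ] Space n} (hφ : HasFDerivAt φ D y) (hν : IsOuterNormal A y ν)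
    (hν' : IsOuterNormal B (φ y) ν') (hsep : ∀ z ∈ interior Aᶜ, φ z ∉ interior B) :
    ∃ μ : ℝ, 0 ≤ μ ∧ ∀ d, inner ℝ (D d) ν' = μ * inner ℝ d ν := by
  have hside : ∀ d, 0 < inner ℝ d ν → 0 ≤ inner ℝ (D d) ν' := fun d =>
    hν.inner_nonneg_of_interior_separated hφ hν' hsep
  have hνν : 0 < inner ℝ ν ν := by
    rw [real_inner_self_eq_norm_sq, hν.1]
    norm_num
  refine ⟨_, hside ν hνν, fun d => ?_⟩
  simpa [real_inner_comm] using eq_mul_inner_of_nonneg_on_halfspace hν.1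
    ((innerSL ℝ ν').comp D : Space n →ₗ[ℝ] ℝ) (by simpa [real_inner_comm] using hside) d

theorem MovingFamily.le_of_contact (hE : MovingFamily c E V) (hG : MovingFamily c G W)
    (ht : t ∈ Ioc 0 c) {Φ' : Space n × ℝ →L[ℝ] Space n} (hΦ : HasFDerivAt Φ Φ' (y, t))
    (hearly : ∀ᶠ τ in 𝓝[<] t, ∀ y ∈ closure (G τ)ᶜ, Φ (y, τ) ∉ closure (E τ))
    (hy : y ∈ frontier (G t)) (hΦy : Φ (y, t) ∈ frontier (E t)) (hν : IsOuterNormal (G t) y ν)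
    (hν' : IsOuterNormal (E t) (Φ (y, t)) ν') {μ : ℝ}
    (hμ : ∀ d, inner ℝ (Φ' (d, 0)) ν' = μ * inner ℝ d ν) :
    μ * W t y + inner ℝ (Φ' (0, 1)) ν' ≤ V t (Φ (y, t)) := by
  obtain ⟨ν₁, γ, v, hν₁, rfl, hγ, hγ', hv⟩ := hG.exists_trajectory ht hy
  obtain rfl := hν.unique hν₁
  have hcurve : HasDerivWithinAt (fun τ => Φ (γ τ, τ)) (Φ' (v, 1)) (Iio t) t :=
    hΦ.comp_hasDerivWithinAt (f := fun τ => (γ τ, τ)) t (hγ'.prodMk (hasDerivWithinAt_id t _))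
  have hle := hE.inner_le_of_eventually_notMem_interior ht hΦy hν' rfl hcurve <| by
    filter_upwards [hearly, hγ] with τ hτ hγτ hmem
    rw [← frontier_compl] at hγτ
    exact hτ _ hγτ.1 (interior_subset_closure hmem)
  rwa [show ((v, 1) : Space n × ℝ) = (v, 0) + (0, 1) by simp, map_add, inner_add_left, hμ,
    hv] at hle

theorem MovingFamily.exists_first_contact (hE : MovingFamily c E V) (hG : MovingFamily c G W)
    (hΦ : Differentiable ℝ Φ)
    (hhomeo : ∀ t ∈ Icc 0 c, ∃ Θ : Space n ≃ₜ Space n, ∀ y, Θ y = Φ (y, t))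
    (hstart : ∀ y ∈ closure (G 0)ᶜ, Φ (y, 0) ∉ closure (E 0)) {ρ : ℝ}
    (hρ : ∀ t ∈ Icc 0 c, ∀ y ∈ closure (G t)ᶜ, Φ (y, t) ∈ closure (E t) → ‖y‖ ≤ ρ)
    (hcontact : ∃ t ∈ Icc 0 c, ∃ y ∈ closure (G t)ᶜ, Φ (y, t) ∈ closure (E t)) :
    ∃ t ∈ Ioc 0 c, ∃ y ∈ frontier (G t), Φ (y, t) ∈ frontier (E t) ∧
      (∀ z ∈ interior (G t)ᶜ, Φ (z, t) ∉ interior (E t)) ∧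
      ∃ ν ν' : Space n, IsOuterNormal (G t) y ν ∧ IsOuterNormal (E t) (Φ (y, t)) ν' ∧
        ∃ μ : ℝ, 0 ≤ μ ∧ (∀ d, inner ℝ (fderiv ℝ Φ (y, t) (d, 0)) ν' = μ * inner ℝ d ν) ∧
          μ * W t y + inner ℝ (fderiv ℝ Φ (y, t) (0, 1)) ν' ≤ V t (Φ (y, t)) := by
  obtain ⟨t, ht, ⟨y, hyG, hyE⟩, hbefore⟩ := hE.isC1Family.exists_first_contact_time hG.isC1Family
    hΦ.continuous hstart hρ hcontact
  have htc := Ioc_subset_Icc_self ht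
  have hearly : ∀ᶠ τ in 𝓝[<] t, ∀ y ∈ closure (G τ)ᶜ, Φ (y, τ) ∉ closure (E τ) :=
    mem_of_superset (Ico_mem_nhdsLT ht.1) hbefore
  have hsep := hE.isC1Family.notMem_interior_of_eventually_notMem hG.isC1Family ht hΦ.continuous
    hearly
  obtain ⟨Θ, hΘ⟩ := hhomeo t htc
  obtain ⟨hyf, hΦyf⟩ := mem_frontier_and_mem_frontier_of_contact Θ
    (by simpa only [hΘ] using hsep)
    (hG.isC1Family.compl.closure_subset_closure_interior htc hyG)
    (by rw [hΘ]; exact hE.isC1Family.closure_subset_closure_interior htc hyE)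
  rw [hΘ] at hΦyf
  obtain ⟨ν, -, -, hν, -⟩ := hG.exists_trajectory ht hyf
  obtain ⟨ν', -, -, hν', -⟩ := hE.exists_trajectory ht hΦyf
  have hΦ' := (hΦ (y, t)).hasFDerivAt
  obtain ⟨μ, hμ0, hμ⟩ := hν.exists_inner_fderiv_eq_mul
    (hΦ'.comp y (hasFDerivAt_prodMk_left y t)) hν' hsep
  exact ⟨t, ht, y, hyf, hΦyf, hsep, ν, ν', hν, hν', μ, hμ0, hμ,
    hE.le_of_contact hG ht hΦ' hearly hyf hΦyf hν hν' hμ⟩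

end FirstContact

section Bump

variable {V : Type*} [NormedAddCommGroup V] {q : ℝ}

/-- The bump `1 / (1 + q² ‖y - p‖²)`, equal to `1` at `p`. Its derivatives are controlled by powers
of `q` on the whole space, and it decays slowly enough to be a barrier on unbounded sets. -/
def bump (q : ℝ) (p y : V) : ℝ := (1 + (q * ‖y - p‖) ^ 2)⁻¹

theorem bump_pos (q : ℝ) (p y : V) : 0 < bump q p y := by
  unfold bump
  positivity

theorem bump_le_one (q : ℝ) (p y : V) : bump q p y ≤ 1 :=
  inv_le_one_of_one_le₀ (by nlinarith only [sq_nonneg (q * ‖y - p‖)])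

theorem bump_mul (q : ℝ) (p y : V) : bump q p y * (1 + (q * ‖y - p‖) ^ 2) = 1 :=
  inv_mul_cancel₀ (by positivity)

theorem mul_bump_le (q : ℝ) (p y : V) : q * ‖y - p‖ * bump q p y ≤ 1 / 2 := by
  nlinarith only [bump_mul q p y, bump_pos q p y, sq_nonneg (q * ‖y - p‖ - 1)]

theorem sq_mul_bump_le (q : ℝ) (p y : V) : (q * ‖y - p‖) ^ 2 * bump q p y ≤ 1 := by
  linarith [bump_mul q p y, bump_pos q p y]

theorem abs_bump_sub_le_one (q : ℝ) (p y y' : V) : |bump q p y - bump q p y'| ≤ 1 := by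
  rw [abs_le]
  constructor <;> linarith [bump_pos q p y, bump_pos q p y', bump_le_one q p y, bump_le_one q p y']

theorem bump_sub_eq (q : ℝ) (p y y' : V) : (bump q p y - bump q p y') * ‖y' - p‖ =
    (‖y' - p‖ - ‖y - p‖) * ((q * ‖y' - p‖) ^ 2 * bump q p y' * bump q p y +
      q * ‖y - p‖ * bump q p y * (q * ‖y' - p‖ * bump q p y')) := by
  have hsub : bump q p y - bump q p y' =
      bump q p y * bump q p y' * ((q * ‖y' - p‖) ^ 2 - (q * ‖y - p‖) ^ 2) := by
    linear_combination bump q p y' * bump_mul q p y - bump q p y * bump_mul q p y'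
  rw [hsub]
  ring

theorem abs_bump_sub_mul_norm_le (hq : 0 ≤ q) (p y y' : V) :
    |bump q p y - bump q p y'| * ‖y' - p‖ ≤ 2 * ‖y - y'‖ := by
  have hb := bump_pos q p y
  have hb' := bump_pos q p y'
  have hradii : |‖y' - p‖ - ‖y - p‖| ≤ ‖y - y'‖ := by
    simpa [norm_sub_rev y' y] using abs_norm_sub_norm_le (y' - p) (y - p)
  have hcoef : (q * ‖y' - p‖) ^ 2 * bump q p y' * bump q p y +
      q * ‖y - p‖ * bump q p y * (q * ‖y' - p‖ * bump q p y') ≤ 1 * 1 + 1 / 2 * (1 / 2) := by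
    gcongr
    exacts [sq_mul_bump_le q p y', bump_le_one q p y, mul_bump_le q p y, mul_bump_le q p y']
  rw [← abs_of_nonneg (norm_nonneg (y' - p)), ← abs_mul, bump_sub_eq, abs_mul, mul_comm,
    abs_of_nonneg (a := (q * ‖y' - p‖) ^ 2 * _ * _ + _) (by positivity)]
  gcongr
  linarith

theorem abs_bump_sq_sub_mul_norm_le (hq : 0 ≤ q) (p y y' : V) :
    |bump q p y ^ 2 - bump q p y' ^ 2| * ‖y' - p‖ ≤ 4 * ‖y - y'‖ := by
  have hsum : |bump q p y + bump q p y'| ≤ 2 := by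
    rw [abs_of_pos (add_pos (bump_pos q p y) (bump_pos q p y'))]
    linarith [bump_le_one q p y, bump_le_one q p y']
  rw [sq_sub_sq, abs_mul, mul_assoc]
  calc _ ≤ 2 * (2 * ‖y - y'‖) :=
        mul_le_mul hsum (abs_bump_sub_mul_norm_le hq p y y') (by positivity) (by norm_num)
    _ = 4 * ‖y - y'‖ := by ring

variable [InnerProductSpace ℝ V]

theorem hasFDerivAt_bump (q : ℝ) (p y : V) :
    HasFDerivAt (bump q p) ((-(2 * q ^ 2) * bump q p y ^ 2) • innerSL ℝ (y - p)) y := by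
  have hsq : HasFDerivAt (fun y => ‖y - p‖ ^ 2) (2 • innerSL ℝ (y - p)) y := by
    simpa using ((hasFDerivAt_id y).sub_const p).norm_sq
  have hden : HasFDerivAt (fun y => 1 + (q * ‖y - p‖) ^ 2) (q ^ 2 • 2 • innerSL ℝ (y - p)) y := by
    simpa only [mul_pow] using (hsq.const_mul (q ^ 2)).const_add 1
  have hne : 1 + (q * ‖y - p‖) ^ 2 ≠ 0 := by positivity
  refine ((hasDerivAt_inv hne).comp_hasFDerivAt y hden).congr_fderiv ?_
  ext v
  simp only [bump, smul_apply, smul_eq_mul, nsmul_eq_mul]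
  push_cast
  field_simp

theorem differentiable_bump (q : ℝ) (p : V) : Differentiable ℝ (bump q p) := fun y =>
  (hasFDerivAt_bump q p y).differentiableAt

theorem norm_fderiv_bump_le (hq : 0 ≤ q) (p y : V) : ‖fderiv ℝ (bump q p) y‖ ≤ q := by
  rw [(hasFDerivAt_bump q p y).fderiv, norm_smul, innerSL_apply_norm, norm_mul, norm_neg,
    Real.norm_of_nonneg (by positivity), Real.norm_of_nonneg (by positivity)]
  have hb := bump_pos q p y
  calc 2 * q ^ 2 * bump q p y ^ 2 * ‖y - p‖
      = 2 * q * (q * ‖y - p‖ * bump q p y) * bump q p y := by ring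
    _ ≤ 2 * q * (1 / 2) * 1 := by
        gcongr
        exacts [mul_bump_le q p y, bump_le_one q p y]
    _ = q := by ring

theorem abs_bump_sub_le_mul (hq : 0 ≤ q) (p y y' : V) :
    |bump q p y - bump q p y'| ≤ q * ‖y - y'‖ :=
  norm_sub_le_of_norm_fderiv_le (differentiable_bump q p) (norm_fderiv_bump_le hq p) y y'

theorem abs_bump_sub_le_rpow (hq : 0 ≤ q) {a : ℝ} (ha : a ∈ Icc (0 : ℝ) 1) (p y y' : V) :
    |bump q p y - bump q p y'| ≤ q ^ a * ‖y - y'‖ ^ a := by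
  rw [← Real.mul_rpow hq (norm_nonneg _)]
  rcases le_total (q * ‖y - y'‖) 1 with h | h
  · refine (abs_bump_sub_le_mul hq p y y').trans ?_
    simpa using Real.rpow_le_rpow_of_exponent_ge' (by positivity) h ha.1 ha.2
  · exact (abs_bump_sub_le_one q p y y').trans (Real.one_le_rpow h ha.1)

theorem norm_fderiv_bump_sub_le (hq : 0 ≤ q) (p y y' : V) :
    ‖fderiv ℝ (bump q p) y - fderiv ℝ (bump q p) y'‖ ≤ 10 * q ^ 2 * ‖y - y'‖ := by
  have hsplit : fderiv ℝ (bump q p) y - fderiv ℝ (bump q p) y' = (-(2 * q ^ 2)) • innerSL ℝ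
      (bump q p y ^ 2 • (y - y') + (bump q p y ^ 2 - bump q p y' ^ 2) • (y' - p)) := by
    rw [(hasFDerivAt_bump q p y).fderiv, (hasFDerivAt_bump q p y').fderiv, mul_smul, mul_smul,
      ← smul_sub, ← map_smul, ← map_smul, ← map_sub]
    congr 2
    module
  have hvec : ‖bump q p y ^ 2 • (y - y') + (bump q p y ^ 2 - bump q p y' ^ 2) • (y' - p)‖ ≤
      1 * ‖y - y'‖ + 4 * ‖y - y'‖ := by
    refine (norm_add_le _ _).trans (add_le_add ?_ ?_)
    · rw [norm_smul, Real.norm_of_nonneg (by positivity)]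
      gcongr
      exact pow_le_one₀ (bump_pos q p y).le (bump_le_one q p y)
    · rw [norm_smul, Real.norm_eq_abs]
      exact abs_bump_sq_sub_mul_norm_le hq p y y'
  rw [hsplit, norm_smul, innerSL_apply_norm, norm_neg, Real.norm_of_nonneg (by positivity)]
  calc 2 * q ^ 2 * _ ≤ 2 * q ^ 2 * (1 * ‖y - y'‖ + 4 * ‖y - y'‖) := by gcongr
    _ = 10 * q ^ 2 * ‖y - y'‖ := by ring

end Bump

section SmallFun

variable {V : Type*} [NormedAddCommGroup V] [NormedSpace ℝ V]

/-- A function which is small, together with its derivatives, as seen from `y₀`, up to the growth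
that `SmallField` allows. -/
structure SmallFun (s N : ℝ) (θ : V → ℝ) (y₀ : V) : Prop where
  diff : Differentiable ℝ θ
  fderiv_le : ∀ y, ‖fderiv ℝ θ y‖ ≤ N
  lip : ∀ y y', ‖fderiv ℝ θ y - fderiv ℝ θ y'‖ ≤ N * ‖y - y'‖
  growth : ∀ z, |θ (y₀ + z)| ≤ N * (1 + ‖z‖ ^ (s / 2))

variable {s M N b : ℝ} {θ : V → ℝ} {X : V → V} {y y' y₀ z : V}

theorem SmallFun.abs_sub_le (hθ : SmallFun s N θ y₀) (y y' : V) : |θ y - θ y'| ≤ N * ‖y - y'‖ :=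
  norm_sub_le_of_norm_fderiv_le hθ.diff hθ.fderiv_le y y'

theorem SmallFun.nonneg (hθ : SmallFun s N θ y₀) : 0 ≤ N :=
  (norm_nonneg _).trans (hθ.fderiv_le y₀)

theorem SmallFun.abs_le (hs : 0 < s) (hθ : SmallFun s N θ y₀) : |θ y₀| ≤ N := by
  simpa [Real.zero_rpow (by positivity : s / 2 ≠ 0)] using hθ.growth 0

theorem SmallFun.abs_le_of_norm_sub_le_one (hs : 0 ≤ s) (hθ : SmallFun s N θ y₀)
    (hy : ‖y - y₀‖ ≤ 1) : |θ y| ≤ 2 * N := by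
  have hgrowth := hθ.growth (y - y₀)
  rw [add_sub_cancel] at hgrowth
  have hrpow : ‖y - y₀‖ ^ (s / 2) ≤ 1 := Real.rpow_le_one (norm_nonneg _) hy (by positivity)
  nlinarith only [hgrowth, hrpow, hθ.nonneg]

theorem BoundedField.nonneg (hX : BoundedField M X) : 0 ≤ M :=
  (norm_nonneg _).trans (hX.norm_le 0)

theorem BoundedField.norm_sub_le (hX : BoundedField M X) (x x' : V) :
    ‖X x - X x'‖ ≤ M * ‖x - x'‖ :=
  norm_sub_le_of_norm_fderiv_le hX.diff hX.fderiv_le x x'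

theorem fderiv_smul_eq (hθ : Differentiable ℝ θ) (hX : Differentiable ℝ X) (y : V) :
    fderiv ℝ (fun y => θ y • X y) y = θ y • fderiv ℝ X y + (fderiv ℝ θ y).smulRight (X y) :=
  ((hθ y).hasFDerivAt.smul (hX y).hasFDerivAt).fderiv

theorem norm_fderiv_smul_le (hX : BoundedField M X) (hθ : Differentiable ℝ θ)
    (hN : ‖fderiv ℝ θ y‖ ≤ N) (hb : |θ y| ≤ b) :
    ‖fderiv ℝ (fun y => θ y • X y) y‖ ≤ M * (N + b) := by
  rw [fderiv_smul_eq hθ hX.diff]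
  refine (norm_add_le _ _).trans ?_
  rw [norm_smul, ContinuousLinearMap.norm_smulRight_apply, Real.norm_eq_abs]
  have hvalue : |θ y| * ‖fderiv ℝ X y‖ ≤ b * M :=
    mul_le_mul hb (hX.fderiv_le y) (norm_nonneg _) ((abs_nonneg _).trans hb)
  have hderiv : ‖fderiv ℝ θ y‖ * ‖X y‖ ≤ N * M :=
    mul_le_mul hN (hX.norm_le y) (norm_nonneg _) ((norm_nonneg _).trans hN)
  linarith

theorem SmallFun.norm_fderiv_smul_sub_le (hs : 0 ≤ s) (hθ : SmallFun s N θ y₀)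
    (hX : BoundedField M X) (hy' : ‖y' - y₀‖ ≤ 1) :
    ‖fderiv ℝ (fun y => θ y • X y) y - fderiv ℝ (fun y => θ y • X y) y'‖ ≤
      5 * M * N * ‖y - y'‖ := by
  have := hX.nonneg
  have hN := hθ.nonneg
  have hsplit : fderiv ℝ (fun y => θ y • X y) y - fderiv ℝ (fun y => θ y • X y) y' =
      (θ y - θ y') • fderiv ℝ X y + θ y' • (fderiv ℝ X y - fderiv ℝ X y') +
      ((fderiv ℝ θ y - fderiv ℝ θ y').smulRight (X y) +
        (fderiv ℝ θ y').smulRight (X y - X y')) := by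
    rw [fderiv_smul_eq hθ.diff hX.diff, fderiv_smul_eq hθ.diff hX.diff]
    ext v : 1
    simp only [sub_apply, add_apply, smul_apply, ContinuousLinearMap.smulRight_apply]
    module
  have hbound : |θ y - θ y'| * ‖fderiv ℝ X y‖ + |θ y'| * ‖fderiv ℝ X y - fderiv ℝ X y'‖ +
      (‖fderiv ℝ θ y - fderiv ℝ θ y'‖ * ‖X y‖ + ‖fderiv ℝ θ y'‖ * ‖X y - X y'‖) ≤
      N * ‖y - y'‖ * M + 2 * N * (M * ‖y - y'‖) + (N * ‖y - y'‖ * M + N * (M * ‖y - y'‖)) := by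
    gcongr
    exacts [hθ.abs_sub_le y y', hX.fderiv_le y, hθ.abs_le_of_norm_sub_le_one hs hy', hX.lip y y',
      hθ.lip y y', hX.norm_le y, hθ.fderiv_le y', hX.norm_sub_le y y']
  rw [hsplit]
  refine (norm_add_le _ _).trans ((add_le_add (norm_add_le _ _) (norm_add_le _ _)).trans ?_)
  simp only [norm_smul, ContinuousLinearMap.norm_smulRight_apply, Real.norm_eq_abs]
  linarith

theorem SmallFun.norm_smul_sub_le (hs : 0 < s) (hθ : SmallFun s N θ y₀) (hX : BoundedField M X)
    (y : V) : ‖θ y • X y - θ y₀ • X y₀‖ ≤ 2 * M * N * ‖y - y₀‖ := by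
  have hN := hθ.nonneg
  have hsplit : θ y • X y - θ y₀ • X y₀ = (θ y - θ y₀) • X y + θ y₀ • (X y - X y₀) := by module
  calc ‖θ y • X y - θ y₀ • X y₀‖ ≤ |θ y - θ y₀| * ‖X y‖ + |θ y₀| * ‖X y - X y₀‖ := by
        rw [hsplit, ← Real.norm_eq_abs, ← Real.norm_eq_abs, ← norm_smul, ← norm_smul]
        exact norm_add_le _ _
    _ ≤ N * ‖y - y₀‖ * M + N * (M * ‖y - y₀‖) := by
        gcongr
        exacts [hθ.abs_sub_le y y₀, hX.norm_le y, hθ.abs_le hs, hX.norm_sub_le y y₀]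
    _ = 2 * M * N * ‖y - y₀‖ := by ring

theorem SmallFun.smallField (hs : 0 < s) (hθ : SmallFun s N θ y₀) (hX : BoundedField M X)
    (hb : ∀ y, |θ y| ≤ b) (hsmall : M * (N + b) ≤ 1 / 2) :
    SmallField s (5 * M * N) (fun y => θ y • X y) y₀ where
  diff := hθ.diff.smul hX.diff
  half y := (norm_fderiv_smul_le hX hθ.diff (hθ.fderiv_le y) (hb y)).trans hsmall
  lip _ _ _ hy' := hθ.norm_fderiv_smul_sub_le hs.le hX hy'
  growth z := by
    refine (norm_fderiv_smul_le hX hθ.diff (hθ.fderiv_le (y₀ + z)) (hθ.growth z)).trans ?_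
    have hMN : 0 ≤ M * N := mul_nonneg hX.nonneg hθ.nonneg
    nlinarith only [hMN, mul_nonneg hMN (by positivity : 0 ≤ ‖z‖ ^ (s / 2))]
  sub z := by
    have hle := hθ.norm_smul_sub_le hs hX (y₀ + z)
    rw [add_sub_cancel_left] at hle
    have hMN : 0 ≤ M * N := mul_nonneg hX.nonneg hθ.nonneg
    nlinarith only [hle, mul_nonneg hMN (norm_nonneg z)]

end SmallFun

section Transversal

/-- The field `X` points outwards along the boundary of `A`, its normal component being at least
`κ`. -/
def Transversal (κ : ℝ) (X : Space n → Space n) (A : Set (Space n)) : Prop :=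
  ∀ p ∈ frontier A, ∀ ν, IsOuterNormal A p ν → κ ≤ inner ℝ (X p) ν

theorem exists_mem_segment_mem_frontier {V : Type*} [AddCommGroup V] [TopologicalSpace V]
    [ContinuousAdd V] [Module ℝ V] [ContinuousSMul ℝ V] {A : Set V} {x y : V}
    (hx : x ∈ closure A) (hy : y ∈ closure Aᶜ) : ∃ p ∈ segment ℝ x y, p ∈ frontier A := by
  by_contra! hno
  rw [closure_compl] at hy
  have hcover : segment ℝ x y ⊆ interior A ∪ (closure A)ᶜ := fun p hp =>
    or_iff_not_imp_left.2 fun hpi hpc => hno p hp ⟨hpc, hpi⟩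
  obtain ⟨p, -, hpi, hpc⟩ := (convex_segment x y).isPreconnected _ _ isOpen_interior
    isClosed_closure.isOpen_compl hcover
    ⟨x, left_mem_segment ℝ x y, (hcover (left_mem_segment ℝ x y)).resolve_right (not_not.2 hx)⟩
    ⟨y, right_mem_segment ℝ x y, (hcover (right_mem_segment ℝ x y)).resolve_left hy⟩
  exact hpc (interior_subset_closure hpi)

variable {r K κ M l D D' : ℝ} {A : Set (Space n)} {X : Space n → Space n} {x y y' : Space n}

theorem UniformlyFlat.exists_inner_sub_le (hA : UniformlyFlat r K A) (hK : 0 ≤ K)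
    (hx : x ∈ closure A) (hy : y ∈ closure Aᶜ) (hxy : ‖x - y‖ < r) :
    ∃ p ∈ frontier A, ∃ ν, FlatAt r K A p ν ∧ ‖y - p‖ ≤ ‖x - y‖ ∧
      inner ℝ (x - y) ν ≤ 2 * K * ‖x - y‖ ^ 2 := by
  obtain ⟨p, hp, hpA⟩ := exists_mem_segment_mem_frontier hx hy
  obtain ⟨ν, hν⟩ := hA p hpA
  have hxp : ‖x - p‖ ≤ ‖x - y‖ := by
    rw [norm_sub_rev, norm_sub_rev x y]
    exact norm_sub_le_of_mem_segment hp
  have hyp : ‖y - p‖ ≤ ‖x - y‖ := by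
    rw [norm_sub_rev, norm_sub_rev x y, norm_sub_rev y x]
    rw [segment_symm] at hp
    exact norm_sub_le_of_mem_segment hp
  refine ⟨p, hpA, ν, hν, hyp, ?_⟩
  have hxν := hν.inner_le_of_mem_closure hx (hxp.trans_lt hxy)
  have hyν := hν.le_inner_of_mem_closure_compl hy (hyp.trans_lt hxy)
  calc inner ℝ (x - y) ν = inner ℝ (x - p) ν - inner ℝ (y - p) ν := by
        rw [← inner_sub_left, sub_sub_sub_cancel_right]
    _ ≤ K * ‖x - p‖ ^ 2 + K * ‖y - p‖ ^ 2 := by linarith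
    _ ≤ K * ‖x - y‖ ^ 2 + K * ‖x - y‖ ^ 2 := by gcongr
    _ = 2 * K * ‖x - y‖ ^ 2 := by ring

theorem neg_norm_le_inner_of_norm_eq_one {V : Type*} [NormedAddCommGroup V]
    [InnerProductSpace ℝ V] {ν : V} (hν : ‖ν‖ = 1) (v : V) : -‖v‖ ≤ inner ℝ v ν := by
  simpa [hν] using (abs_le.1 (abs_real_inner_le_norm v ν)).1

theorem inner_le_norm_of_norm_eq_one {V : Type*} [NormedAddCommGroup V]
    [InnerProductSpace ℝ V] {ν : V} (hν : ‖ν‖ = 1) (v : V) : inner ℝ v ν ≤ ‖v‖ := by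
  simpa [hν] using real_inner_le_norm v ν

theorem Transversal.notMem_closure (htr : Transversal κ X A) (hr : 0 < r) (hK : 0 ≤ K)
    (hA : UniformlyFlat r K A) (hX : BoundedField M X) (hy' : y' ∈ closure Aᶜ) (hl : 0 ≤ l)
    (hxy : ‖x - y' - l • X y‖ ≤ D) (hyy : ‖y - y'‖ ≤ D') (hlr : D + l * M < r)
    (hlt : D + 2 * K * (D + l * M) ^ 2 < l * (κ - M * (D + l * M + D'))) : x ∉ closure A := by
  intro hx
  have hM := hX.nonneg
  have hdist : ‖x - y'‖ ≤ D + l * M := by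
    have htri := norm_add_le (x - y' - l • X y) (l • X y)
    rw [sub_add_cancel, norm_smul, Real.norm_of_nonneg hl] at htri
    exact htri.trans (by gcongr; exact hX.norm_le y)
  obtain ⟨p, hpA, ν, hν, hyp, hle⟩ := hA.exists_inner_sub_le hK hx hy' (hdist.trans_lt hlr)
  have hflat : inner ℝ (x - y') ν ≤ 2 * K * (D + l * M) ^ 2 := hle.trans (by gcongr)
  have hsplit : inner ℝ (x - y') ν = inner ℝ (x - y' - l • X y) ν +
      l * (inner ℝ (X p) ν + inner ℝ (X y - X p) ν) := by
    simp only [inner_sub_left, inner_smul_left, RCLike.conj_to_real]; ring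
  have herror : -D ≤ inner ℝ (x - y' - l • X y) ν := by
    linarith [neg_norm_le_inner_of_norm_eq_one hν.1 (x - y' - l • X y)]
  have hvariation : ‖X y - X p‖ ≤ M * (D + l * M + D') := by
    refine (hX.norm_sub_le y p).trans ?_
    gcongr
    linarith [norm_sub_le_norm_sub_add_norm_sub y y' p]
  have hfield : κ - M * (D + l * M + D') ≤ inner ℝ (X p) ν + inner ℝ (X y - X p) ν := by
    linarith [htr p hpA ν (hν.isOuterNormal hr), neg_norm_le_inner_of_norm_eq_one hν.1 (X y - X p)]
  linarith [mul_le_mul_of_nonneg_left hfield hl]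

end Transversal

section Barrier

theorem abs_sub_one_le_norm_of_inner_add_eq_mul {V : Type*} [NormedAddCommGroup V]
    [InnerProductSpace ℝ V] {D : V →L[ℝ] V} {ν ν' : V} {μ : ℝ} (hν : ‖ν‖ = 1) (hν' : ‖ν'‖ = 1)
    (hμ0 : 0 ≤ μ) (hμ : ∀ v, inner ℝ (v + D v) ν' = μ * inner ℝ v ν) : |μ - 1| ≤ ‖D‖ := by
  have hD : ∀ v, ‖v‖ = 1 → ‖D v‖ ≤ ‖D‖ := fun v hv => by simpa [hv] using D.le_opNorm v
  have hνν' : inner ℝ ν ν' ≤ 1 := by simpa [hν] using inner_le_norm_of_norm_eq_one hν' ν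
  have hupper := hμ ν
  have hlower := hμ ν'
  rw [inner_add_left, real_inner_self_eq_norm_sq, hν] at hupper
  rw [inner_add_left, real_inner_self_eq_norm_sq, hν', real_inner_comm ν ν'] at hlower
  rw [abs_le]
  constructor
  · nlinarith [hD ν' hν', neg_norm_le_inner_of_norm_eq_one hν' (D ν')]
  · linarith [hD ν hν, inner_le_norm_of_norm_eq_one hν' (D ν)]

theorem half_le_inner_of_inner_add_eq_mul {V : Type*} [NormedAddCommGroup V]
    [InnerProductSpace ℝ V] {D : V →L[ℝ] V} {ν ν' w : V} {μ κ M d : ℝ} (hν : ‖ν‖ = 1)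
    (hν' : ‖ν'‖ = 1) (hμ0 : 0 ≤ μ) (hμ : ∀ v, inner ℝ (v + D v) ν' = μ * inner ℝ v ν)
    (hκ : 0 < κ) (hD : ‖D‖ ≤ d) (hd : d * (κ + M) ≤ κ / 2) (hwM : ‖w‖ ≤ M)
    (hwκ : κ ≤ inner ℝ w ν) : κ / 2 ≤ inner ℝ w ν' := by
  have hμd : 1 - d ≤ μ := by
    linarith [(abs_le.1 (abs_sub_one_le_norm_of_inner_add_eq_mul hν hν' hμ0 hμ)).1]
  have hDw : inner ℝ (D w) ν' ≤ d * M :=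
    (inner_le_norm_of_norm_eq_one hν' (D w)).trans ((D.le_opNorm w).trans
      (mul_le_mul hD hwM (norm_nonneg _) ((norm_nonneg _).trans hD)))
  have hμκ : (1 - d) * κ ≤ μ * inner ℝ w ν :=
    (mul_le_mul_of_nonneg_right hμd hκ.le).trans (mul_le_mul_of_nonneg_left hwκ hμ0)
  have hw := hμ w
  rw [inner_add_left] at hw
  linarith

/-- The setting of the comparison argument: a family `E` moving by its curvature and a family `G`
moving with a velocity `W` of absolute value at most `C₀`, both uniformly flat, and a field `X`
transversal to the boundaries of `G`, along which these are to be displaced. -/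
structure ComparisonPair (s r K C₀ κ M c : ℝ) (E G : ℝ → Set (Space n)) (W : ℝ → Space n → ℝ)
    (X : Space n → Space n) : Prop where
  movE : MovingFamily c E fun t x => -fracMeanCurv s (E t) x
  movG : MovingFamily c G W
  flatE : ∀ t ∈ Icc 0 c, UniformlyFlat r K (E t)
  flatG : ∀ t ∈ Icc 0 c, UniformlyFlat r K (G t)
  abs_vel_le : ∀ t ∈ Icc 0 c, ∀ y ∈ frontier (G t), |W t y| ≤ C₀
  field : BoundedField M X
  transversal : ∀ t ∈ Icc 0 c, Transversal κ X (G t)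

variable {s r K C₀ C κ M N d c t : ℝ} {E G : ℝ → Set (Space n)} {W : ℝ → Space n → ℝ}
  {X Y : Space n → Space n} {θ₀ θ₁ : Space n → ℝ} {y ν ν' : Space n}

theorem fderiv_apply_prodMk_zero {V : Type*} [NormedAddCommGroup V] [NormedSpace ℝ V]
    {Φ : V × ℝ → V} {y : V} (hΦ : DifferentiableAt ℝ Φ (y, t)) (v : V) :
    fderiv ℝ Φ (y, t) (v, 0) = fderiv ℝ (fun z => Φ (z, t)) y v := by
  have hcomp : HasFDerivAt (fun z => Φ (z, t))
      ((fderiv ℝ Φ (y, t)).comp (ContinuousLinearMap.inl ℝ V ℝ)) y :=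
    hΦ.hasFDerivAt.comp y (hasFDerivAt_prodMk_left y t)
  rw [hcomp.fderiv]
  rfl

theorem fderiv_apply_zero_prodMk_one {V : Type*} [NormedAddCommGroup V] [NormedSpace ℝ V]
    {Φ : V × ℝ → V} {y : V} (hΦ : DifferentiableAt ℝ Φ (y, t)) :
    fderiv ℝ Φ (y, t) (0, 1) = deriv (fun τ => Φ (y, τ)) t := by
  have hcomp : HasFDerivAt (fun τ => Φ (y, τ))
      ((fderiv ℝ Φ (y, t)).comp (ContinuousLinearMap.inr ℝ V ℝ)) t :=
    hΦ.hasFDerivAt.comp t (hasFDerivAt_prodMk_right y t)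
  rw [← fderiv_apply_one_eq_deriv, hcomp.fderiv]
  rfl

theorem ComparisonPair.exists_le_of_contact (h : ComparisonPair s r K C₀ κ M c E G W X)
    (hs : 0 < s) (hr : 0 < r) (hK : 0 ≤ K) (hC : IsPerturbationConst n s r K C) (hκ : 0 < κ)
    (ht : t ∈ Icc 0 c) (hY : SmallField s N Y y) (hYd : ‖fderiv ℝ Y y‖ ≤ d)
    (hd : d * (κ + M) ≤ κ / 2) (hyG : y ∈ frontier (G t)) (hyE : y + Y y ∈ frontier (E t))
    (hsep : ∀ z ∈ interior (G t)ᶜ, z + Y z ∉ interior (E t)) (hν : IsOuterNormal (G t) y ν)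
    (hν' : IsOuterNormal (E t) (y + Y y) ν') {μ θ : ℝ} (hμ0 : 0 ≤ μ)
    (hμ : ∀ v, inner ℝ (v + fderiv ℝ Y y v) ν' = μ * inner ℝ v ν)
    (hvel : μ * W t y + inner ℝ (θ • X y) ν' ≤ -fracMeanCurv s (E t) (y + Y y)) :
    ∃ k ∈ Icc (κ / 2) M, θ * k + (W t y + fracMeanCurv s (G t) y) ≤ N * (C₀ + C) := by
  obtain ⟨νG, hνG⟩ := h.flatG t ht y hyG
  obtain ⟨νE, hνE⟩ := h.flatE t ht _ hyE
  have hcurv := hC (G t) (E t) Y y νG νE N hνG hνE ((h.flatG t ht).volume_frontier hr hK)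
    ((h.flatE t ht).volume_frontier hr hK) hY hsep
  refine ⟨inner ℝ (X y) ν', ⟨half_le_inner_of_inner_add_eq_mul hν.1 hν'.1 hμ0 hμ hκ hYd hd
    (h.field.norm_le y) (h.transversal t ht y hyG ν hν),
    (inner_le_norm_of_norm_eq_one hν'.1 _).trans (h.field.norm_le y)⟩, ?_⟩
  have hYN : ‖fderiv ℝ Y y‖ ≤ N := by
    simpa [Real.zero_rpow (half_pos hs).ne'] using hY.growth 0
  have hW : |(μ - 1) * W t y| ≤ N * C₀ := by
    rw [abs_mul]
    exact mul_le_mul ((abs_sub_one_le_norm_of_inner_add_eq_mul hν.1 hν'.1 hμ0 hμ).trans hYN)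
      (h.abs_vel_le t ht y hyG) (abs_nonneg _) hY.nonneg
  rw [inner_smul_left, RCLike.conj_to_real] at hvel
  linarith [(abs_le.1 hW).1]

theorem ComparisonPair.notMem_closure_of_barrier (h : ComparisonPair s r K C₀ κ M c E G W X)
    (hs : 0 < s) (hr : 0 < r) (hK : 0 ≤ K) (hC : IsPerturbationConst n s r K C) (hκ : 0 < κ)
    (hθ₀ : Differentiable ℝ θ₀) (hθ₁ : Differentiable ℝ θ₁)
    (hfderiv : ∀ t ∈ Icc 0 c, ∀ y, ‖fderiv ℝ (fun y => (θ₀ y + t * θ₁ y) • X y) y‖ ≤ d)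
    (hd : d * (κ + M) ≤ κ / 2)
    (hstrict : ∀ t ∈ Icc 0 c, ∀ y ∈ frontier (G t), ∃ N,
      SmallField s N (fun y => (θ₀ y + t * θ₁ y) • X y) y ∧ ∀ k ∈ Icc (κ / 2) M,
        N * (C₀ + C) < θ₁ y * k + (W t y + fracMeanCurv s (G t) y))
    (hstart : ∀ y ∈ closure (G 0)ᶜ, y + θ₀ y • X y ∉ closure (E 0)) {ρ : ℝ}
    (hρ : ∀ t ∈ Icc 0 c, ∀ y ∈ closure (G t)ᶜ, y + (θ₀ y + t * θ₁ y) • X y ∈ closure (E t) →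
      ‖y‖ ≤ ρ) (ht : t ∈ Icc 0 c) (hy : y ∈ closure (G t)ᶜ) :
    y + (θ₀ y + t * θ₁ y) • X y ∉ closure (E t) := by
  intro hcon
  have hX := h.field.diff
  have hYdiff : ∀ t : ℝ, Differentiable ℝ fun y => (θ₀ y + t * θ₁ y) • X y := by fun_prop
  have hΦ : Differentiable ℝ fun p : Space n × ℝ => p.1 + (θ₀ p.1 + p.2 * θ₁ p.1) • X p.1 := by
    fun_prop
  have hd_half : d ≤ 1 / 2 := by
    have hd0 := (norm_nonneg _).trans (hfderiv t ht 0)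
    nlinarith [mul_nonneg hd0 h.field.nonneg]
  obtain ⟨t, ht, y, hyG, hyE, hsep, ν, ν', hν, hν', μ, hμ0, hμ, hvel⟩ :=
    h.movE.exists_first_contact h.movG hΦ
      (fun t ht => exists_homeomorph_id_add (hYdiff t) fun y => (hfderiv t ht y).trans hd_half)
      (by simpa using hstart) hρ ⟨t, ht, y, hy, hcon⟩
  have htc := Ioc_subset_Icc_self ht
  simp only [fderiv_apply_prodMk_zero (hΦ _), (hasFDerivAt_id_add (hYdiff t) y).fderiv] at hμ
  have htime : HasDerivAt (fun τ => y + (θ₀ y + τ * θ₁ y) • X y) (θ₁ y • X y) t := by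
    simpa using ((((hasDerivAt_id t).mul_const (θ₁ y)).const_add (θ₀ y)).smul_const
      (X y)).const_add y
  rw [fderiv_apply_zero_prodMk_one (hΦ _), htime.deriv] at hvel
  obtain ⟨N, hN, hNk⟩ := hstrict t htc y hyG
  obtain ⟨k, hk, hle⟩ := h.exists_le_of_contact hs hr hK hC hκ htc hN (hfderiv t htc y) hd hyG hyE
    hsep hν hν' hμ0 hμ hvel
  exact (hNk k hk).not_ge hle

end Barrier

section SmallFunAlgebra

variable {V : Type*} [NormedAddCommGroup V] [NormedSpace ℝ V] {s N N' : ℝ} {θ θ' : V → ℝ} {y₀ : V}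

theorem SmallFun.mono (hθ : SmallFun s N θ y₀) (h : N ≤ N') : SmallFun s N' θ y₀ where
  diff := hθ.diff
  fderiv_le y := (hθ.fderiv_le y).trans h
  lip y y' := (hθ.lip y y').trans (by gcongr)
  growth z := (hθ.growth z).trans (by gcongr)

theorem SmallFun.add (hθ : SmallFun s N θ y₀) (hθ' : SmallFun s N' θ' y₀) :
    SmallFun s (N + N') (fun y => θ y + θ' y) y₀ where
  diff := hθ.diff.add hθ'.diff
  fderiv_le y := by
    rw [fderiv_fun_add (hθ.diff y) (hθ'.diff y)]
    exact norm_add_le_of_le (hθ.fderiv_le y) (hθ'.fderiv_le y)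
  lip y y' := by
    rw [fderiv_fun_add (hθ.diff y) (hθ'.diff y), fderiv_fun_add (hθ.diff y') (hθ'.diff y'),
      add_sub_add_comm, add_mul]
    exact norm_add_le_of_le (hθ.lip y y') (hθ'.lip y y')
  growth z := by
    rw [add_mul]
    exact (abs_add_le _ _).trans (add_le_add (hθ.growth z) (hθ'.growth z))

theorem SmallFun.const_mul (hθ : SmallFun s N θ y₀) (c : ℝ) :
    SmallFun s (|c| * N) (fun y => c * θ y) y₀ where
  diff := hθ.diff.const_mul c
  fderiv_le y := by
    rw [fderiv_const_mul (hθ.diff y), norm_smul, Real.norm_eq_abs]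
    gcongr
    exact hθ.fderiv_le y
  lip y y' := by
    rw [fderiv_const_mul (hθ.diff y), fderiv_const_mul (hθ.diff y'), ← smul_sub, norm_smul,
      Real.norm_eq_abs, mul_assoc]
    gcongr
    exact hθ.lip y y'
  growth z := by
    rw [abs_mul, mul_assoc]
    gcongr
    exact hθ.growth z

theorem smallFun_const (s c : ℝ) (y₀ : V) : SmallFun s |c| (fun _ => c) y₀ where
  diff := differentiable_const c
  fderiv_le y := by simp
  lip y y' := by simpa using by positivity
  growth z := le_mul_of_one_le_right (abs_nonneg c) (by simpa using by positivity)

end SmallFunAlgebra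

section Profile

variable {V : Type*} [NormedAddCommGroup V] {s a ρ : ℝ}

/-- A function equal to `a * ρ` at `p`, below `a` and close to `a` far away, which varies slowly
when `ρ` is small: it prevents contacts at infinity in the comparison argument. With the exponent
`2 / s` its growth over a distance `d` is at most `a * ρ * d ^ (s / 2)`, as `SmallFun` demands. -/
def profile (s a ρ : ℝ) (p y : V) : ℝ := a * (1 - (1 - ρ) * bump (ρ ^ (2 / s)) p y)

/-- A function equal to `1` at `p` and negative away from `p`: the weight of the displacement whose
sign at `p` decides the theorem. -/
def tent (p y : V) : ℝ := 2 * bump 1 p y - 1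

theorem abs_tent_le (p y : V) : |tent p y| ≤ 1 := by
  unfold tent
  rw [abs_le]
  constructor <;> linarith [bump_pos 1 p y, bump_le_one 1 p y]

theorem tent_self (p : V) : tent p p = 1 := by
  norm_num [tent, bump]

theorem norm_sub_le_two_of_tent {p y : V} (h : -(1 / 2) ≤ tent p y) : ‖y - p‖ ≤ 2 := by
  have hb : 1 / 4 ≤ bump 1 p y := by unfold tent at h; linarith
  nlinarith only [hb, bump_mul 1 p y, norm_nonneg (y - p)]

theorem le_profile (ha : 0 ≤ a) (hρ : ρ ≤ 1) (p y : V) : a * ρ ≤ profile s a ρ p y := by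
  unfold profile
  gcongr
  linarith [mul_le_of_le_one_right (sub_nonneg.2 hρ) (bump_le_one (ρ ^ (2 / s)) p y)]

theorem profile_le (ha : 0 ≤ a) (hρ : ρ ≤ 1) (p y : V) : profile s a ρ p y ≤ a :=
  mul_le_of_le_one_right ha (sub_le_self 1 (mul_nonneg (sub_nonneg.2 hρ) (bump_pos _ p y).le))

theorem profile_pos (ha : 0 < a) (hρ : ρ ∈ Ioc 0 1) (p y : V) : 0 < profile s a ρ p y :=
  (mul_pos ha hρ.1).trans_le (le_profile ha.le hρ.2 p y)

theorem profile_ge_of_far (ha : 0 ≤ a) (hρ : ρ ∈ Ioc 0 1) {p y : V}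
    (hy : 3 / ρ ^ (2 / s) + ‖p‖ < ‖y‖) : 7 / 8 * a ≤ profile s a ρ p y := by
  have hq : 0 < ρ ^ (2 / s) := Real.rpow_pos_of_pos hρ.1 _
  have hfar : 3 / ρ ^ (2 / s) ≤ ‖y - p‖ := by linarith [norm_sub_norm_le y p]
  rw [div_le_iff₀ hq, mul_comm] at hfar
  have hpos := bump_pos (ρ ^ (2 / s)) p y
  have hbump : bump (ρ ^ (2 / s)) p y ≤ 1 / 8 := by
    have hsq : 3 ^ 2 ≤ (ρ ^ (2 / s) * ‖y - p‖) ^ 2 := by gcongr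
    nlinarith only [bump_mul (ρ ^ (2 / s)) p y, hpos, hsq]
  unfold profile
  nlinarith only [mul_nonneg ha (by nlinarith only [hρ.1, hpos, hbump] :
    0 ≤ 1 / 8 - (1 - ρ) * bump (ρ ^ (2 / s)) p y)]

theorem tendsto_profile (hs : 0 < s) (p y : V) :
    Tendsto (fun ρ => profile s a ρ p y) (𝓝[>] 0) (𝓝 0) := by
  have hcont : ContinuousAt (fun ρ => profile s a ρ p y) 0 := by
    have hrpow : ContinuousAt (fun ρ : ℝ => ρ ^ (2 / s)) 0 :=
      Real.continuousAt_rpow_const 0 (2 / s) (Or.inr (by positivity))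
    have hbump : ContinuousAt (fun ρ : ℝ => bump (ρ ^ (2 / s)) p y) 0 :=
      (by fun_prop : ContinuousAt (fun ρ : ℝ => 1 + (ρ ^ (2 / s) * ‖y - p‖) ^ 2) 0).inv₀
        (by positivity)
    unfold profile
    fun_prop
  have hzero : profile s a 0 p y = 0 := by
    simp [profile, bump, Real.zero_rpow (by positivity : 2 / s ≠ 0)]
  simpa only [hzero] using hcont.tendsto.mono_left nhdsWithin_le_nhds

variable [InnerProductSpace ℝ V]

theorem differentiable_tent (p : V) : Differentiable ℝ (tent p) :=
  ((differentiable_bump 1 p).const_mul 2).sub_const 1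

theorem differentiable_profile (s a ρ : ℝ) (p : V) : Differentiable ℝ (profile s a ρ p) :=
  (((differentiable_bump _ p).const_mul _).const_sub 1).const_mul a

theorem fderiv_tent (p y : V) : fderiv ℝ (tent p) y = (2 : ℝ) • fderiv ℝ (bump 1 p) y :=
  (((differentiable_bump 1 p y).hasFDerivAt.const_mul 2).sub_const 1).fderiv

theorem fderiv_profile (s a ρ : ℝ) (p y : V) :
    fderiv ℝ (profile s a ρ p) y = (-(a * (1 - ρ))) • fderiv ℝ (bump (ρ ^ (2 / s)) p) y := by
  refine (((((differentiable_bump _ p y).hasFDerivAt.const_mul (1 - ρ)).const_sub 1).const_mul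
    a).congr_fderiv ?_).fderiv
  module

theorem smallFun_tent (s : ℝ) (p y₀ : V) : SmallFun s 20 (tent p) y₀ where
  diff := differentiable_tent p
  fderiv_le y := by
    rw [fderiv_tent, norm_smul, Real.norm_two]
    linarith [norm_fderiv_bump_le zero_le_one p y]
  lip y y' := by
    rw [fderiv_tent, fderiv_tent, ← smul_sub, norm_smul, Real.norm_two]
    linarith [norm_fderiv_bump_sub_le zero_le_one p y y']
  growth z := by
    have hz : 0 ≤ ‖z‖ ^ (s / 2) := by positivity
    linarith [abs_tent_le p (y₀ + z)]

theorem rpow_two_div_le (hs : s ∈ Ioo 0 1) (hρ : ρ ∈ Ioc 0 1) : ρ ^ (2 / s) ≤ ρ := by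
  simpa using Real.rpow_le_rpow_of_exponent_ge hρ.1 hρ.2
    (show (1 : ℝ) ≤ 2 / s by rw [le_div_iff₀ hs.1]; linarith [hs.2])

theorem rpow_two_div_rpow_half (hs : s ≠ 0) (hρ : 0 ≤ ρ) : (ρ ^ (2 / s)) ^ (s / 2) = ρ := by
  rw [← Real.rpow_mul hρ, div_mul_div_cancel₀ hs, div_self two_ne_zero, Real.rpow_one]

theorem profile_le_profile_add (hs : s ∈ Ioo 0 1) (ha : 0 ≤ a) (hρ : ρ ∈ Ioc 0 1) (p y z : V) :
    profile s a ρ p (y + z) ≤ profile s a ρ p y + a * ρ * ‖z‖ ^ (s / 2) := by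
  have hbump : bump (ρ ^ (2 / s)) p y - bump (ρ ^ (2 / s)) p (y + z) ≤ ρ * ‖z‖ ^ (s / 2) := by
    have hle := abs_bump_sub_le_rpow (Real.rpow_nonneg hρ.1.le (2 / s))
      (show s / 2 ∈ Icc (0 : ℝ) 1 from ⟨by linarith [hs.1], by linarith [hs.2]⟩) p y (y + z)
    rw [rpow_two_div_rpow_half hs.1.ne' hρ.1.le, sub_add_cancel_left, norm_neg] at hle
    exact (le_abs_self _).trans hle
  have hgrowth : 0 ≤ ρ * ‖z‖ ^ (s / 2) := mul_nonneg hρ.1.le (by positivity)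
  calc profile s a ρ p (y + z) = profile s a ρ p y +
        a * ((1 - ρ) * (bump (ρ ^ (2 / s)) p y - bump (ρ ^ (2 / s)) p (y + z))) := by
        unfold profile; ring
    _ ≤ profile s a ρ p y + a * ((1 - ρ) * (ρ * ‖z‖ ^ (s / 2))) := by
        have hρ' : 0 ≤ 1 - ρ := sub_nonneg.2 hρ.2
        gcongr
    _ ≤ profile s a ρ p y + a * (ρ * ‖z‖ ^ (s / 2)) := by
        gcongr profile s a ρ p y + a * ?_
        exact mul_le_of_le_one_left hgrowth (sub_le_self 1 hρ.1.le)
    _ = _ := by ring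

theorem smallFun_profile (hs : s ∈ Ioo 0 1) (ha : 0 ≤ a) (hρ : ρ ∈ Ioc 0 1) (p y₀ : V) :
    SmallFun s (10 * profile s a ρ p y₀) (profile s a ρ p) y₀ := by
  have hle : a * ρ ≤ profile s a ρ p y₀ := le_profile ha hρ.2 p y₀
  have haρ : 0 ≤ a * ρ := mul_nonneg ha hρ.1.le
  have hq : 0 ≤ ρ ^ (2 / s) := Real.rpow_nonneg hρ.1.le _
  have hqρ : ρ ^ (2 / s) ≤ ρ := rpow_two_div_le hs hρ
  have hcoeff : ‖-(a * (1 - ρ))‖ ≤ a := by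
    rw [norm_neg, Real.norm_of_nonneg (mul_nonneg ha (sub_nonneg.2 hρ.2))]
    exact mul_le_of_le_one_right ha (sub_le_self 1 hρ.1.le)
  refine ⟨differentiable_profile s a ρ p, fun y => ?_, fun y y' => ?_, fun z => ?_⟩
  · rw [fderiv_profile, norm_smul]
    calc _ ≤ a * ρ := by gcongr; exact (norm_fderiv_bump_le hq p y).trans hqρ
      _ ≤ _ := by linarith
  · rw [fderiv_profile, fderiv_profile, ← smul_sub, norm_smul]
    have hsq : (ρ ^ (2 / s)) ^ 2 ≤ ρ := by nlinarith only [hq, hqρ, hρ.2]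
    calc _ ≤ a * (10 * (ρ ^ (2 / s)) ^ 2 * ‖y - y'‖) := by
          gcongr; exact norm_fderiv_bump_sub_le hq p y y'
      _ ≤ a * (10 * ρ * ‖y - y'‖) := by gcongr
      _ = 10 * (a * ρ) * ‖y - y'‖ := by ring
      _ ≤ _ := by gcongr
  · have hz : 0 ≤ ‖z‖ ^ (s / 2) := by positivity
    rw [abs_of_nonneg (haρ.trans (le_profile ha hρ.2 p _))]
    calc profile s a ρ p (y₀ + z) ≤ profile s a ρ p y₀ + a * ρ * ‖z‖ ^ (s / 2) :=
          profile_le_profile_add hs ha hρ p y₀ z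
      _ ≤ profile s a ρ p y₀ + profile s a ρ p y₀ * ‖z‖ ^ (s / 2) := by gcongr
      _ ≤ _ := by nlinarith only [haρ.trans hle, mul_nonneg (haρ.trans hle) hz]

theorem smallFun_barrier {e A e₁ e₂ : ℝ} (hs : s ∈ Ioo 0 1) (ha : 0 ≤ a) (hρ : ρ ∈ Ioc 0 1)
    (hA : |A| ≤ 2) (he₁ : |e₁| ≤ e) (he₂ : |e₂| ≤ e) (p y₀ : V) :
    SmallFun s (21 * (profile s a ρ p y₀ + e))
      (fun y => A * profile s a ρ p y + e₁ * tent p y + e₂) y₀ := by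
  refine ((((smallFun_profile hs ha hρ p y₀).const_mul A).add
    ((smallFun_tent s p y₀).const_mul e₁)).add (smallFun_const s e₂ y₀)).mono ?_
  have hP := (mul_nonneg ha hρ.1.le).trans (le_profile (s := s) ha hρ.2 p y₀)
  nlinarith only [hP, mul_le_mul_of_nonneg_right hA hP, he₁, he₂]

end Profile

section BarrierConsts

/-- Admissible choices of the constants of the barrier argument: `a` is the height of the profile,
`L` the rate at which it rises, and `c` the length of the time interval. The other constants are
those of `ComparisonPair` and `IsPerturbationConst`. -/
structure BarrierConsts (r K C₀ C κ M a L c : ℝ) : Prop where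
  one_le : 1 ≤ M
  κ_pos : 0 < κ
  a_pos : 0 < a
  c_le : c ≤ 1
  L_nonneg : 0 ≤ L
  le_L : 105 * M * (C₀ + C) + 1 ≤ L * (κ / 2)
  L_mul_c : L * c ≤ 1 / 2
  a_half : M * (28 * a) ≤ 1 / 2
  a_κ : M * (28 * a) * (κ + M) ≤ κ / 2
  a_r : 4 * a * M < r
  a_K : 32 * K * (a * M ^ 2) ≤ κ / 16
  a_M : 4 * a * M ^ 2 ≤ κ / 4
  c_κ : (C₀ + 2) * c ≤ a * κ / 16
  c_M : (C₀ + 2) * c ≤ a * M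

theorem eventually_mul_lt (k : ℝ) {b : ℝ} (hb : 0 < b) : ∀ᶠ x : ℝ in 𝓝[>] 0, k * x < b := by
  have hlim : Tendsto (fun x : ℝ => k * x) (𝓝[>] 0) (𝓝 0) := by
    simpa using tendsto_id_nhdsGT_zero.const_mul k
  exact hlim.eventually_lt_const hb

variable {s r K C₀ C κ M a L c e A e₁ e₂ l ρ t : ℝ}

theorem exists_barrierConsts (K : ℝ) {d : ℝ} (hr : 0 < r) (hC₀ : 0 ≤ C₀) (hC : 0 ≤ C) (hκ : 0 < κ)
    (hM : 1 ≤ M) (hd : 0 < d) :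
    ∃ a L c, 0 < c ∧ (C₀ + 2) * c ≤ d ∧ BarrierConsts r K C₀ C κ M a L c := by
  have : 0 < M := by linarith
  obtain ⟨a, ha_half, ha_κ, ha_r, ha_K, ha_M, ha⟩ :=
    ((eventually_mul_lt (28 * M) (one_half_pos (α := ℝ))).and
    ((eventually_mul_lt (28 * M * (κ + M)) (half_pos hκ)).and
    ((eventually_mul_lt (4 * M) hr).and
    ((eventually_mul_lt (32 * K * M ^ 2) (by positivity : 0 < κ / 16)).and
    ((eventually_mul_lt (4 * M ^ 2) (by positivity : 0 < κ / 4)).and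
    eventually_mem_nhdsWithin))))).exists
  rw [mem_Ioi] at ha
  obtain ⟨L, hL0, hL⟩ : ∃ L, 0 ≤ L ∧ 105 * M * (C₀ + C) + 1 ≤ L * (κ / 2) :=
    ⟨(105 * M * (C₀ + C) + 1) / (κ / 2), by positivity, (div_mul_cancel₀ _ (by positivity)).ge⟩
  obtain ⟨c, hc_le, hLc, hc_κ, hc_M, hc_d, hc⟩ := ((eventually_mul_lt 1 one_pos).and
    ((eventually_mul_lt L (one_half_pos (α := ℝ))).and
    ((eventually_mul_lt (C₀ + 2) (by positivity : 0 < a * κ / 16)).and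
    ((eventually_mul_lt (C₀ + 2) (by positivity : 0 < a * M)).and
    ((eventually_mul_lt (C₀ + 2) hd).and eventually_mem_nhdsWithin))))).exists
  exact ⟨a, L, c, hc, hc_d.le, hM, hκ, ha, by linarith, hL0, hL, hLc.le, by linarith, by linarith,
    by linarith, by linarith, by linarith, hc_κ.le, hc_M.le⟩

theorem BarrierConsts.mul_mem_Icc (h : BarrierConsts r K C₀ C κ M a L c) (ht : t ∈ Icc 0 c) :
    L * t ∈ Icc 0 (1 / 2) :=
  ⟨mul_nonneg h.L_nonneg ht.1, (mul_le_mul_of_nonneg_left ht.2 h.L_nonneg).trans h.L_mul_c⟩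

variable {F G : Set (Space n)} {X : Space n → Space n} {y y' : Space n}

theorem BarrierConsts.notMem_closure_of_half_le (h : BarrierConsts r K C₀ C κ M a L c) (hr : 0 < r)
    (hK : 0 ≤ K) (hG : UniformlyFlat r K G) (hX : BoundedField M X) (htr : Transversal κ X G)
    (hnear : ∀ x ∈ closure F, ∃ x' ∈ closure G, ‖x' - x‖ ≤ (C₀ + 2) * c)
    (hl : l ∈ Icc (a / 2) (3 * a)) (hy : y ∈ closure Gᶜ) : y + l • X y ∉ closure F := by
  intro hx
  obtain ⟨x, hxG, hxx⟩ := hnear _ hx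
  have ha := h.a_pos
  have hM := h.one_le
  have hκ := h.κ_pos
  have hl0 : 0 ≤ l := by linarith [hl.1]
  have hD : 0 ≤ (C₀ + 2) * c := (norm_nonneg _).trans hxx
  have hdist : (C₀ + 2) * c + l * M ≤ 4 * a * M := by
    nlinarith only [h.c_M, hM, hl.2]
  refine htr.notMem_closure hr hK hG hX (y := y) (D := (C₀ + 2) * c) (D' := 0) hy hl0
    (by rwa [sub_sub]) (by simp) (hdist.trans_lt h.a_r) ?_ hxG
  have hcurvature : 2 * K * ((C₀ + 2) * c + l * M) ^ 2 ≤ a * κ / 16 := by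
    calc 2 * K * ((C₀ + 2) * c + l * M) ^ 2 ≤ 2 * K * (4 * a * M) ^ 2 := by gcongr
      _ = a * (32 * K * (a * M ^ 2)) := by ring
      _ ≤ a * (κ / 16) := mul_le_mul_of_nonneg_left h.a_K ha.le
      _ = a * κ / 16 := by ring
  have hvariation : M * ((C₀ + 2) * c + l * M + 0) ≤ κ / 4 := by
    nlinarith only [mul_le_mul_of_nonneg_left hdist (by linarith : 0 ≤ M), h.a_M]
  have hgain : a / 2 * (κ - κ / 4) ≤ l * (κ - M * ((C₀ + 2) * c + l * M + 0)) :=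
    mul_le_mul hl.1 (by linarith) (by linarith) hl0
  nlinarith only [hcurvature, hgain, h.c_κ, mul_pos ha hκ]

theorem BarrierConsts.notMem_closure_of_le (h : BarrierConsts r K C₀ C κ M a L c) (hr : 0 < r)
    (hK : 0 ≤ K) (hG : UniformlyFlat r K G) (hX : BoundedField M X) (htr : Transversal κ X G)
    (hl : l ∈ Ioc 0 a) (hy' : y' ∈ closure Gᶜ) (hyy : ‖y - y'‖ ≤ a * M) :
    y' + l • X y ∉ closure G := by
  have hM := h.one_le
  have hκ := h.κ_pos
  have hlM : l * M ≤ a * M := mul_le_mul_of_nonneg_right hl.2 (by linarith)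
  have haM : 0 < a * M := mul_pos h.a_pos (by linarith)
  have : 0 < l * M := mul_pos hl.1 (by linarith)
  refine htr.notMem_closure hr hK hG hX (y := y) (D := 0) hy' hl.1.le (by simp) hyy
    (by linarith [h.a_r]) ?_
  have hcurvature : 2 * K * (0 + l * M) ^ 2 ≤ l * (κ / 16) := by
    calc 2 * K * (0 + l * M) ^ 2 = l * (2 * K * (l * M ^ 2)) := by ring
      _ ≤ l * (2 * K * (a * M ^ 2)) := by
          have := hl.1
          gcongr
          exact hl.2
      _ ≤ l * (κ / 16) := by
          gcongr
          · exact hl.1.le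
          · nlinarith only [h.a_K,
              mul_nonneg hK (mul_pos h.a_pos (pow_pos (by linarith : 0 < M) 2)).le]
  have hvariation : M * (0 + l * M + a * M) ≤ κ / 4 := by
    nlinarith only [h.a_M, hlM, hM, haM]
  have hgain : l * (3 / 4 * κ) ≤ l * (κ - M * (0 + l * M + a * M)) :=
    mul_le_mul_of_nonneg_left (by linarith) hl.1.le
  nlinarith only [hcurvature, hgain, mul_pos hl.1 hκ]

end BarrierConsts

section Barrier

variable {s r K C₀ C κ M a L c c' e A e₁ e₂ α₁ α₂ α₃ ρ t : ℝ} {E G : ℝ → Set (Space n)}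
  {W : ℝ → Space n → ℝ} {X : Space n → Space n} {p y : Space n}

theorem abs_mul_tent_le {V : Type*} [NormedAddCommGroup V] (he₁ : |e₁| ≤ e) (p y : V) :
    |e₁ * tent p y| ≤ e := by
  rw [abs_mul]
  exact (mul_le_of_le_one_right (abs_nonneg _) (abs_tent_le p y)).trans he₁

theorem abs_barrier_le {V : Type*} [NormedAddCommGroup V] (ha : 0 < a) (hρ : ρ ∈ Ioc 0 1)
    (hA : A ∈ Icc 1 (3 / 2)) (he : e ≤ a / 8) (he₁ : |e₁| ≤ e) (he₂ : |e₂| ≤ e) (p y : V) :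
    |A * profile s a ρ p y + e₁ * tent p y + e₂| ≤ 3 * a := by
  refine (abs_add_three _ _ _).trans ?_
  rw [abs_of_nonneg (mul_nonneg (by linarith [hA.1]) (profile_pos ha hρ p y).le)]
  have hP : A * profile s a ρ p y ≤ 3 / 2 * a :=
    mul_le_mul hA.2 (profile_le ha.le hρ.2 p y) (profile_pos ha hρ p y).le (by norm_num)
  linarith [abs_mul_tent_le he₁ p y]

theorem half_le_barrier_of_far {V : Type*} [NormedAddCommGroup V] {p y : V} (ha : 0 < a)
    (hρ : ρ ∈ Ioc 0 1) (hA : 1 ≤ A) (he : e ≤ a / 8) (he₁ : |e₁| ≤ e) (he₂ : |e₂| ≤ e)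
    (hy : 3 / ρ ^ (2 / s) + ‖p‖ < ‖y‖) :
    a / 2 ≤ A * profile s a ρ p y + e₁ * tent p y + e₂ := by
  have hP : profile s a ρ p y ≤ A * profile s a ρ p y :=
    le_mul_of_one_le_left (profile_pos ha hρ p y).le hA
  linarith [profile_ge_of_far ha.le hρ hy, (abs_le.1 (abs_mul_tent_le he₁ p y)).1, (abs_le.1 he₂).1]

theorem BarrierConsts.smallField_barrier (h : BarrierConsts r K C₀ C κ M a L c)
    (hs : s ∈ Ioo 0 1) (hX : BoundedField M X) (hρ : ρ ∈ Ioc 0 1) (hA : A ∈ Icc 1 (3 / 2))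
    (he : e ≤ a / 8) (he₁ : |e₁| ≤ e) (he₂ : |e₂| ≤ e) (p y₀ : Space n) :
    SmallField s (5 * M * (21 * (profile s a ρ p y₀ + e)))
      (fun y => (A * profile s a ρ p y + e₁ * tent p y + e₂) • X y) y₀ := by
  refine (smallFun_barrier hs h.a_pos.le hρ ?_ he₁ he₂ p y₀).smallField hs.1 hX
    (abs_barrier_le h.a_pos hρ hA he he₁ he₂ p) (le_trans ?_ h.a_half)
  · rw [abs_of_nonneg] <;> linarith [hA.1, hA.2]
  · gcongr
    · exact hX.nonneg
    · linarith [profile_le (s := s) h.a_pos.le hρ.2 p y₀, h.a_pos]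

theorem BarrierConsts.norm_fderiv_barrier_smul_le (h : BarrierConsts r K C₀ C κ M a L c)
    (hs : s ∈ Ioo 0 1) (hX : BoundedField M X) (hρ : ρ ∈ Ioc 0 1) (hA : A ∈ Icc 1 (3 / 2))
    (he : e ≤ a / 8) (he₁ : |e₁| ≤ e) (he₂ : |e₂| ≤ e) (p y : Space n) :
    ‖fderiv ℝ (fun y => (A * profile s a ρ p y + e₁ * tent p y + e₂) • X y) y‖ ≤
      M * (28 * a) := by
  have hθ := smallFun_barrier hs h.a_pos.le hρ
    (by rw [abs_of_nonneg] <;> linarith [hA.1, hA.2] : |A| ≤ 2) he₁ he₂ p y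
  refine (norm_fderiv_smul_le hX hθ.diff (hθ.fderiv_le y)
    (abs_barrier_le h.a_pos hρ hA he he₁ he₂ p y)).trans ?_
  gcongr
  · exact hX.nonneg
  · linarith [profile_le (s := s) h.a_pos.le hρ.2 p y, h.a_pos]

theorem BarrierConsts.lt_of_strict (h : BarrierConsts r K C₀ C κ M a L c) {P B H k : ℝ}
    (hP : 0 < P) (hk : κ / 2 ≤ k) (hstrict : 105 * M * (C₀ + C) * e ≤ B * k + H) :
    5 * M * (21 * (P + e)) * (C₀ + C) < (L * P + B) * k + H := by
  have hLk : (105 * M * (C₀ + C) + 1) * P ≤ L * k * P :=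
    mul_le_mul_of_nonneg_right (h.le_L.trans (mul_le_mul_of_nonneg_left hk h.L_nonneg)) hP.le
  linarith

theorem ComparisonPair.notMem_closure_of_profile (h : ComparisonPair s r K C₀ κ M c' E G W X)
    (hB : BarrierConsts r K C₀ C κ M a L c) (hs : s ∈ Ioo 0 1) (hr : 0 < r) (hK : 0 ≤ K)
    (hC : IsPerturbationConst n s r K C) (hc' : c' ≤ c)
    (hnear : ∀ t ∈ Icc 0 c', ∀ x ∈ closure (E t), ∃ x' ∈ closure (G t), ‖x' - x‖ ≤ (C₀ + 2) * c)
    (he : e ≤ a / 8) (he₁ : ∀ t ∈ Icc 0 c', |α₁ + t * α₂| ≤ e) (he₂ : ∀ t ∈ Icc 0 c', |t * α₃| ≤ e)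
    (hstrict : ∀ t ∈ Icc 0 c', ∀ y ∈ frontier (G t), ∀ k ∈ Icc (κ / 2) M,
      105 * M * (C₀ + C) * e ≤ (α₂ * tent p y + α₃) * k + (W t y + fracMeanCurv s (G t) y))
    (hρ : ρ ∈ Ioc 0 1)
    (hstart : ∀ y ∈ closure (G 0)ᶜ,
      y + (profile s a ρ p y + α₁ * tent p y) • X y ∉ closure (E 0))
    (ht : t ∈ Icc 0 c') (hy : y ∈ closure (G t)ᶜ) :
    y + ((1 + L * t) * profile s a ρ p y + (α₁ + t * α₂) * tent p y + t * α₃) • X y ∉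
      closure (E t) := by
  have ha := hB.a_pos
  have hA : ∀ t ∈ Icc 0 c', 1 + L * t ∈ Icc 1 (3 / 2) := fun t ht => by
    have hLt := hB.mul_mem_Icc ⟨ht.1, ht.2.trans hc'⟩
    exact ⟨by linarith [hLt.1], by linarith [hLt.2]⟩
  have hθ : ∀ (t : ℝ) y, (profile s a ρ p y + α₁ * tent p y) +
      t * (L * profile s a ρ p y + (α₂ * tent p y + α₃)) =
      (1 + L * t) * profile s a ρ p y + (α₁ + t * α₂) * tent p y + t * α₃ := fun t y => by ring
  have hP := differentiable_profile s a ρ p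
  have htent := differentiable_tent p
  have hmain := h.notMem_closure_of_barrier (d := M * (28 * a))
    (θ₀ := fun y => profile s a ρ p y + α₁ * tent p y)
    (θ₁ := fun y => L * profile s a ρ p y + (α₂ * tent p y + α₃))
    (ρ := 3 / ρ ^ (2 / s) + ‖p‖) (t := t) (y := y)
    hs.1 hr hK hC hB.κ_pos (by fun_prop) (by fun_prop)
  simp only [hθ] at hmain
  refine hmain (fun t ht => hB.norm_fderiv_barrier_smul_le hs h.field hρ (hA t ht) he (he₁ t ht)
    (he₂ t ht) p) hB.a_κ (fun t ht y hy => ⟨_, hB.smallField_barrier hs h.field hρ (hA t ht) he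
    (he₁ t ht) (he₂ t ht) p y, fun k hk => hB.lt_of_strict (profile_pos ha hρ p y) hk.1
    (hstrict t ht y hy k hk)⟩) hstart (fun t ht y hy hcon => ?_) ht hy
  by_contra! hfar
  exact hB.notMem_closure_of_half_le hr hK (h.flatG t ht) h.field (h.transversal t ht) (hnear t ht)
    ⟨half_le_barrier_of_far ha hρ (hA t ht).1 he (he₁ t ht) (he₂ t ht) hfar,
      (abs_le.1 (abs_barrier_le ha hρ (hA t ht) he (he₁ t ht) (he₂ t ht) p y)).2⟩ hy hcon

theorem ComparisonPair.notMem_interior_of_strict (h : ComparisonPair s r K C₀ κ M c' E G W X)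
    (hB : BarrierConsts r K C₀ C κ M a L c) (hs : s ∈ Ioo 0 1) (hr : 0 < r) (hK : 0 ≤ K)
    (hC : IsPerturbationConst n s r K C) (hc' : c' ≤ c)
    (hnear : ∀ t ∈ Icc 0 c', ∀ x ∈ closure (E t), ∃ x' ∈ closure (G t), ‖x' - x‖ ≤ (C₀ + 2) * c)
    (he : e ≤ a / 8) (he₁ : ∀ t ∈ Icc 0 c', |α₁ + t * α₂| ≤ e) (he₂ : ∀ t ∈ Icc 0 c', |t * α₃| ≤ e)
    (hstrict : ∀ t ∈ Icc 0 c', ∀ y ∈ frontier (G t), ∀ k ∈ Icc (κ / 2) M,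
      105 * M * (C₀ + C) * e ≤ (α₂ * tent p y + α₃) * k + (W t y + fracMeanCurv s (G t) y))
    (hstart : ∀ ρ ∈ Ioc (0 : ℝ) 1, ∀ y ∈ closure (G 0)ᶜ,
      y + (profile s a ρ p y + α₁ * tent p y) • X y ∉ closure (E 0))
    (ht : t ∈ Icc 0 c') (hy : y ∈ closure (G t)ᶜ) :
    y + ((α₁ + t * α₂) * tent p y + t * α₃) • X y ∉ interior (E t) := by
  intro hcon
  have hlim : Tendsto (fun ρ => y + ((1 + L * t) * profile s a ρ p y +
      (α₁ + t * α₂) * tent p y + t * α₃) • X y) (𝓝[>] 0)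
      (𝓝 (y + ((α₁ + t * α₂) * tent p y + t * α₃) • X y)) := by
    simpa only [mul_zero, zero_add] using
      (((((tendsto_profile (a := a) hs.1 p y).const_mul (1 + L * t)).add_const
        ((α₁ + t * α₂) * tent p y)).add_const (t * α₃)).smul_const (X y)).const_add y
  obtain ⟨ρ, hmem, hρ⟩ := ((hlim.eventually (isOpen_interior.mem_nhds hcon)).and
    (Ioc_mem_nhdsGT zero_lt_one)).exists
  exact h.notMem_closure_of_profile hB hs hr hK hC hc' hnear he he₁ he₂ hstrict hρ (hstart ρ hρ)
    ht hy (interior_subset_closure hmem)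

end Barrier

section ShortTime

theorem IsC1Family.comp {T c : ℝ} {E : ℝ → Set (Space n)} {φ : ℝ → ℝ} (h : IsC1Family T E)
    (hφ : ContDiff ℝ 1 φ) (hmaps : MapsTo φ (Icc 0 c) (Icc 0 T)) :
    IsC1Family c fun t => E (φ t) := by
  intro t ht x
  obtain ⟨u, hu, hgrad, hsign⟩ := h (φ t) (hmaps ht) x
  refine ⟨fun p => u (p.1, φ p.2), hu.comp (by fun_prop), hgrad, ?_⟩
  have hcont : Continuous fun p : Space n × ℝ => (p.1, φ p.2) := by
    have := hφ.continuous
    fun_prop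
  have hmapsTo : MapsTo (fun p : Space n × ℝ => (p.1, φ p.2)) (univ ×ˢ Icc 0 c) (univ ×ˢ Icc 0 T) :=
    fun p hp => ⟨mem_univ _, hmaps hp.2⟩
  exact ((hcont.continuousWithinAt (x := (x, t))).tendsto_nhdsWithin hmapsTo).eventually hsign

theorem MovingFamily.comp {T c : ℝ} {E : ℝ → Set (Space n)} {V : ℝ → Space n → ℝ} {φ : ℝ → ℝ}
    (h : MovingFamily T E V) (hφ : ContDiff ℝ 1 φ) (hmaps : MapsTo φ (Icc 0 c) (Icc 0 T)) :
    MovingFamily c (fun t => E (φ t)) fun t x => deriv φ t * V (φ t) x where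
  isC1Family := h.isC1Family.comp hφ hmaps
  motion t ht x hx := by
    obtain ⟨ν, γ, v, hν, hγt, hγ, hγ', hv⟩ := h.motion (φ t) (hmaps ht) x hx
    have hφ' : HasDerivWithinAt φ (deriv φ t) (Icc 0 c) t :=
      ((hφ.differentiable one_ne_zero) t).hasDerivAt.hasDerivWithinAt
    refine ⟨ν, γ ∘ φ, deriv φ t • v, hν, hγt,
      (hφ'.continuousWithinAt.tendsto_nhdsWithin hmaps).eventually hγ,
      hγ'.scomp t hφ' hmaps, ?_⟩
    rw [inner_smul_left, RCLike.conj_to_real, hv]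

theorem MovingFamily.shift {T b c : ℝ} {E : ℝ → Set (Space n)} {V : ℝ → Space n → ℝ}
    (h : MovingFamily T E V) (hb : 0 ≤ b) (hc : b + c ≤ T) :
    MovingFamily c (fun t => E (b + t)) fun t => V (b + t) := by
  simpa only [deriv_const_add_id, one_mul] using
    h.comp (φ := fun t => b + t) (by fun_prop) fun t ht =>
      ⟨add_nonneg hb ht.1, (add_le_add_right ht.2 b).trans hc⟩

theorem MovingFamily.const {T t : ℝ} {E : ℝ → Set (Space n)} {V : ℝ → Space n → ℝ}
    (h : MovingFamily T E V) (ht : t ∈ Icc 0 T) (c : ℝ) :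
    MovingFamily c (fun _ => E t) fun _ _ => 0 := by
  simpa only [deriv_const, zero_mul] using
    h.comp (c := c) (φ := fun _ => t) contDiff_const fun _ _ => ht

theorem exists_pos_le_of_le_tent {A : Set (Space n)} {f : Space n → ℝ}
    (hf : ContinuousOn f (frontier A)) (hpos : ∀ y ∈ frontier A, 0 < f y) (p : Space n) :
    ∃ m > 0, ∀ y ∈ frontier A, -(1 / 2) ≤ tent p y → m ≤ f y := by
  have hmem : ∀ y ∈ frontier A, -(1 / 2) ≤ tent p y → y ∈ frontier A ∩ Metric.closedBall p 2 :=
    fun y hy hty => ⟨hy, mem_closedBall_iff_norm.2 (norm_sub_le_two_of_tent hty)⟩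
  have hcompact : IsCompact (frontier A ∩ Metric.closedBall p 2) :=
    (isCompact_closedBall p 2).inter_left isClosed_frontier
  obtain hempty | hne := (frontier A ∩ Metric.closedBall p 2).eq_empty_or_nonempty
  · exact ⟨1, one_pos, fun y hy hty => absurd (hmem y hy hty) (hempty ▸ notMem_empty y)⟩
  · obtain ⟨z, hz, hmin⟩ := hcompact.exists_isMinOn hne (hf.mono inter_subset_left)
    exact ⟨f z, hpos z hz.1, fun y hy hty => hmin (hmem y hy hty)⟩

theorem tendsto_sub_nhdsGT_zero {τ : ℝ} (hτ : 0 < τ) :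
    Tendsto (fun h : ℝ => τ - h) (𝓝[>] 0) (𝓝[Icc 0 τ \ {τ}] τ) := by
  refine tendsto_nhdsWithin_iff.2 ⟨by simpa using tendsto_id_nhdsGT_zero.const_sub τ, ?_⟩
  filter_upwards [Ioo_mem_nhdsGT hτ] with h hh
  exact ⟨⟨by linarith [hh.2], by linarith [hh.1]⟩, by simpa using hh.1.ne'⟩

theorem inner_le_inner_of_eventually_notMem_interior {τ : ℝ} {F : Set (Space n)}
    {γ z : ℝ → Space n} {ν v w : Space n} (hτ : 0 < τ) (hν : IsOuterNormal F (γ τ) ν)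
    (hγ : HasDerivWithinAt γ v (Icc 0 τ) τ) (hz : Tendsto z (𝓝[>] 0) (𝓝 w))
    (hno : ∀ᶠ h in 𝓝[>] 0, γ (τ - h) + h • z h ∉ interior F) : inner ℝ v ν ≤ inner ℝ w ν := by
  by_contra! hneg
  have hslope := (hasDerivWithinAt_iff_tendsto_slope.1 hγ).comp (tendsto_sub_nhdsGT_zero hτ)
  have hmem := hν.eventually_mem_interior (l := 𝓝[>] (0 : ℝ)) (ε := fun h : ℝ => h)
    eventually_mem_nhdsWithin tendsto_id_nhdsGT_zero (hz.sub hslope)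
    (by rw [inner_sub_left]; linarith)
  obtain ⟨h, hin, hout, hh⟩ := (hmem.and (hno.and self_mem_nhdsWithin)).exists
  refine hout ?_
  convert hin using 1
  rw [Function.comp_apply, slope_def_module, sub_sub_cancel_left, smul_sub, smul_smul, inv_neg,
    mul_neg, mul_inv_cancel₀ (ne_of_gt hh)]
  module

theorem MovingFamily.le_inner_of_eventually_notMem_interior {τ : ℝ} {F : ℝ → Set (Space n)}
    {V : ℝ → Space n → ℝ} (hF : MovingFamily τ F V) (hτ : 0 < τ) {Z : ℝ × Space n → Space n}
    (hZ : Continuous Z) (hno : ∀ᶠ h in 𝓝[>] 0, ∀ y ∈ closure (F (τ - h))ᶜ,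
      y + h • Z (h, y) ∉ interior (F τ)) {p : Space n} (hp : p ∈ frontier (F τ)) :
    ∃ ν, IsOuterNormal (F τ) p ν ∧ V τ p ≤ inner ℝ (Z (0, p)) ν := by
  obtain ⟨ν, γ, v, hν, rfl, hγ, hγ', hv⟩ := hF.motion τ (right_mem_Icc.2 hτ.le) p hp
  have hback : Tendsto (fun h : ℝ => τ - h) (𝓝[>] 0) (𝓝[Icc 0 τ] τ) :=
    (tendsto_sub_nhdsGT_zero hτ).mono_right (nhdsWithin_mono _ sdiff_subset)
  have hz : Tendsto (fun h => Z (h, γ (τ - h))) (𝓝[>] 0) (𝓝 (Z (0, γ τ))) :=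
    (hZ.tendsto _).comp
      (tendsto_id_nhdsGT_zero.prodMk_nhds (hγ'.continuousWithinAt.tendsto.comp hback))
  refine ⟨ν, hν, hv ▸ inner_le_inner_of_eventually_notMem_interior hτ hν hγ' hz ?_⟩
  filter_upwards [hno, hback.eventually hγ] with h hout hfront
  exact hout _ (by rw [closure_compl]; exact hfront.2)

variable {s r K C₀ C κ M a L c τ h ε : ℝ} {F : ℝ → Set (Space n)} {X : Space n → Space n}
  {p : Space n}

/-- A fractional mean curvature flow on `[0, τ]` with uniformly flat boundaries, curvature bounded
by `C₀`, and a field `X` transversal to all its boundaries. Such a flow can be compared with its own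
time shifts. -/
structure TransversalFlow (s r K C₀ κ M τ : ℝ) (F : ℝ → Set (Space n)) (X : Space n → Space n) :
    Prop where
  mov : MovingFamily τ F fun t x => -fracMeanCurv s (F t) x
  flat : ∀ t ∈ Icc 0 τ, UniformlyFlat r K (F t)
  abs_curv_le : ∀ t ∈ Icc 0 τ, ∀ y ∈ frontier (F t), |fracMeanCurv s (F t) y| ≤ C₀
  field : BoundedField M X
  transversal : ∀ t ∈ Icc 0 τ, Transversal κ X (F t)

theorem TransversalFlow.exists_mem_closure_norm_sub_le
    (hF : TransversalFlow s r K C₀ κ M τ F X) (hC₀ : 0 ≤ C₀) (hτ : τ ≤ c) {t₁ t₂ : ℝ}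
    (ht₁ : 0 ≤ t₁) (ht₂ : t₂ ≤ τ) (h12 : t₁ ≤ t₂) {x : Space n} (hx : x ∈ closure (F t₂)) :
    ∃ x' ∈ closure (F t₁), ‖x' - x‖ ≤ (C₀ + 2) * c := by
  obtain ⟨x', hx', hdist⟩ := hF.mov.exists_mem_closure_norm_sub_le hC₀
    (fun t ht y hy => neg_le.1 (abs_le.1 (hF.abs_curv_le t ht y hy)).1) ht₁ ht₂ h12 hx
  exact ⟨x', hx', hdist.trans (mul_le_mul_of_nonneg_left (by linarith) (by linarith))⟩

theorem TransversalFlow.comparisonPair_const (hF : TransversalFlow s r K C₀ κ M τ F X)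
    (hC₀ : 0 ≤ C₀) (hh : h ∈ Icc 0 τ) :
    ComparisonPair s r K C₀ κ M h F (fun _ => F 0) (fun _ _ => 0) X := by
  have h0 : (0 : ℝ) ∈ Icc 0 τ := ⟨le_rfl, hh.1.trans hh.2⟩
  exact {
    movE := by simpa only [zero_add] using hF.mov.shift (c := h) le_rfl (by linarith [hh.2])
    movG := hF.mov.const h0 h
    flatE := fun t ht => hF.flat t ⟨ht.1, ht.2.trans hh.2⟩
    flatG := fun _ _ => hF.flat 0 h0
    abs_vel_le := fun _ _ _ _ => by rwa [abs_zero]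
    field := hF.field
    transversal := fun _ _ => hF.transversal 0 h0 }

theorem TransversalFlow.comparisonPair_shift (hF : TransversalFlow s r K C₀ κ M τ F X)
    (hh : 0 ≤ h) :
    ComparisonPair s r K C₀ κ M (τ - h) (fun t => F (h + t)) F
      (fun t x => -fracMeanCurv s (F t) x) X := by
  have hsub : ∀ t ∈ Icc 0 (τ - h), t ∈ Icc 0 τ := fun t ht => ⟨ht.1, by linarith [ht.2]⟩
  exact {
    movE := hF.mov.shift hh (by linarith)
    movG := by simpa only [zero_add] using hF.mov.shift (c := τ - h) le_rfl (by linarith)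
    flatE := fun t ht => hF.flat _ ⟨by linarith [ht.1], by linarith [ht.2]⟩
    flatG := fun t ht => hF.flat t (hsub t ht)
    abs_vel_le := fun t ht y hy => by rw [abs_neg]; exact hF.abs_curv_le t (hsub t ht) y hy
    field := hF.field
    transversal := fun t ht => hF.transversal t (hsub t ht) }

/- Where `tent` is below `-1/2`, the displacement `-ε * tent` points outwards and wins; elsewhere,
the curvature is at least `ε * (M + D)` by compactness. -/
theorem le_neg_mul_tent_mul_add {D k H : ℝ} {y : Space n} (hε : 0 < ε) (hκ : 0 < κ) (hD : 0 ≤ D)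
    (hh : h ≤ 1) (hhD : D * h ≤ κ / 4) (hk : k ∈ Icc (κ / 2) M) (hH : 0 ≤ H)
    (hnear : -(1 / 2) ≤ tent p y → (M + D) * ε ≤ H) :
    D * (h * ε) ≤ -ε * tent p y * k + H := by
  obtain ⟨hk, hkM⟩ := hk
  obtain hty | hty := le_total (-(1 / 2)) (tent p y)
  · have htk : tent p y * k ≤ 1 * M :=
      mul_le_mul (abs_le.1 (abs_tent_le p y)).2 hkM (by linarith) zero_le_one
    have hDh : D * (h * ε) ≤ D * (1 * ε) := by gcongr
    nlinarith [hnear hty]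
  · have htk : 1 / 2 * (κ / 2) ≤ -tent p y * k :=
      mul_le_mul (by linarith) hk (by linarith) (by linarith)
    nlinarith [mul_le_mul_of_nonneg_right hhD hε.le]

theorem TransversalFlow.notMem_interior_initial (hF : TransversalFlow s r K C₀ κ M τ F X)
    (hB : BarrierConsts r K C₀ C κ M a L c) (hs : s ∈ Ioo 0 1) (hr : 0 < r) (hK : 0 ≤ K)
    (hC₀ : 0 ≤ C₀) (hC_nonneg : 0 ≤ C) (hC : IsPerturbationConst n s r K C) (hτ : τ ≤ c)
    (hε : 0 < ε) (hεa : ε ≤ a / 16) (hpos : ∀ y ∈ frontier (F 0), 0 < fracMeanCurv s (F 0) y)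
    (hnear : ∀ y ∈ frontier (F 0), -(1 / 2) ≤ tent p y →
      (M + 105 * M * (C₀ + C)) * ε ≤ fracMeanCurv s (F 0) y)
    (hh : h ∈ Ioo 0 τ) (hhC : 105 * M * (C₀ + C) * h ≤ κ / 4) {y : Space n}
    (hy : y ∈ closure (F 0)ᶜ) : y + (-(h * ε) * tent p y) • X y ∉ interior (F h) := by
  have hM := hB.one_le
  have ha := hB.a_pos
  have hh1 : h ≤ 1 := hh.2.le.trans (hτ.trans hB.c_le)
  have h0 : (0 : ℝ) ∈ Icc 0 τ := ⟨le_rfl, (hh.1.trans hh.2).le⟩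
  have hpair := hF.comparisonPair_const hC₀ ⟨hh.1.le, hh.2.le⟩
  have hcmp := hpair.notMem_interior_of_strict (e := h * ε) (α₁ := 0) (α₂ := -ε) (α₃ := 0) (p := p)
    hB hs hr hK hC (hh.2.le.trans hτ)
    (fun t ht x hx => hF.exists_mem_closure_norm_sub_le hC₀ hτ le_rfl (ht.2.trans hh.2.le) ht.1 hx)
    (by nlinarith) (fun t ht => ?_) (fun t _ => ?_) (fun t _ y hy k hk => ?_)
    (fun ρ hρ y hy => ?_) (right_mem_Icc.2 hh.1.le) hy
  · convert hcmp using 4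
    ring
  · rw [zero_add, mul_neg, abs_neg, abs_of_nonneg (mul_nonneg ht.1 hε.le)]
    exact mul_le_mul_of_nonneg_right ht.2 hε.le
  · rw [mul_zero, abs_zero]
    exact mul_nonneg hh.1.le hε.le
  · rw [add_zero, zero_add]
    exact le_neg_mul_tent_mul_add hε hB.κ_pos (by positivity) hh1 hhC hk (hpos y hy).le (hnear y hy)
  · rw [zero_mul, add_zero]
    exact hB.notMem_closure_of_le hr hK (hF.flat 0 h0) hF.field (hF.transversal 0 h0)
      ⟨profile_pos ha hρ p y, profile_le ha.le hρ.2 p y⟩ hy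
      (by rw [sub_self, norm_zero]; positivity)

theorem TransversalFlow.notMem_interior_late (hF : TransversalFlow s r K C₀ κ M τ F X)
    (hB : BarrierConsts r K C₀ C κ M a L c) (hs : s ∈ Ioo 0 1) (hr : 0 < r) (hK : 0 ≤ K)
    (hC₀ : 0 ≤ C₀) (hC : IsPerturbationConst n s r K C) (hτ : τ ≤ c)
    (hε : 0 < ε) (hεa : ε ≤ a / 16) (hh : h ∈ Ioo 0 τ) (hinitial : ∀ y ∈ closure (F 0)ᶜ,
      y + (-(h * ε) * tent p y) • X y ∉ interior (F h)) {y : Space n}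
    (hy : y ∈ closure (F (τ - h))ᶜ) :
    y + (-(h * ε) * tent p y + (τ - h) * (h * ε * L)) • X y ∉ interior (F τ) := by
  have ha := hB.a_pos
  have hhε : 0 < h * ε := mul_pos hh.1 hε
  have hhεa : h * ε ≤ a / 16 :=
    (mul_le_of_le_one_left hε.le (hh.2.le.trans (hτ.trans hB.c_le))).trans hεa
  have hhτ : h ∈ Icc 0 τ := ⟨hh.1.le, hh.2.le⟩
  have hpair := hF.comparisonPair_shift hh.1.le
  have hcmp := hpair.notMem_interior_of_strict (e := h * ε) (α₁ := -(h * ε)) (α₂ := 0)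
    (α₃ := h * ε * L) (p := p) hB hs hr hK hC (by linarith [hh.1])
    (fun t ht x hx => hF.exists_mem_closure_norm_sub_le hC₀ hτ ht.1 (by linarith [ht.2])
      (by linarith [hh.1]) hx) (by linarith)
    (fun t _ => by rw [mul_zero, add_zero, abs_neg, abs_of_pos hhε]) (fun t ht => ?_)
    (fun t _ y _ k hk => ?_) (fun ρ hρ y hy => ?_) (right_mem_Icc.2 (by linarith [hh.2])) hy
  · simpa only [mul_zero, add_zero, add_sub_cancel] using hcmp
  · have hLt := hB.mul_mem_Icc (t := t) ⟨ht.1, by linarith [ht.2, hh.1]⟩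
    rw [show t * (h * ε * L) = h * ε * (L * t) by ring, abs_of_nonneg (mul_nonneg hhε.le hLt.1)]
    exact mul_le_of_le_one_right hhε.le (by linarith [hLt.2])
  · rw [zero_mul, zero_add, neg_add_cancel, add_zero, mul_assoc (h * ε), mul_comm (h * ε)]
    refine mul_le_mul_of_nonneg_right ?_ hhε.le
    linarith [hB.le_L, mul_le_mul_of_nonneg_left hk.1 hB.L_nonneg]
  · rw [show h + 0 = h from add_zero h, add_comm (profile s a ρ p y), add_smul, ← add_assoc]
    refine hB.notMem_closure_of_le hr hK (hF.flat h hhτ) hF.field (hF.transversal h hhτ)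
      ⟨profile_pos ha hρ p y, profile_le ha.le hρ.2 p y⟩
      (by rw [closure_compl]; exact hinitial y hy) ?_
    rw [sub_add_cancel_left, norm_neg, norm_smul, Real.norm_eq_abs]
    refine mul_le_mul ((abs_mul_tent_le (e := h * ε) ?_ p y).trans (by linarith))
      (hF.field.norm_le y) (norm_nonneg _) ha.le
    rw [abs_neg, abs_of_pos hhε]

theorem TransversalFlow.fracMeanCurv_pos (hF : TransversalFlow s r K C₀ κ M τ F X)
    (hB : BarrierConsts r K C₀ C κ M a L c) (hs : s ∈ Ioo 0 1) (hr : 0 < r) (hK : 0 ≤ K)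
    (hC₀ : 0 ≤ C₀) (hC_nonneg : 0 ≤ C) (hC : IsPerturbationConst n s r K C) (hτ0 : 0 < τ)
    (hτ : τ ≤ c) (hpos : ∀ y ∈ frontier (F 0), 0 < fracMeanCurv s (F 0) y)
    (hp : p ∈ frontier (F τ)) :
    0 < fracMeanCurv s (F τ) p := by
  have hκ := hB.κ_pos
  obtain ⟨m, hm, hmle⟩ := exists_pos_le_of_le_tent
    ((hF.flat 0 ⟨le_rfl, hτ0.le⟩).continuousOn_fracMeanCurv hs hr hK) hpos p
  obtain ⟨ε, hεm, hεa, hε⟩ := ((eventually_mul_lt (M + 105 * M * (C₀ + C)) hm).and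
    ((eventually_mul_lt 16 hB.a_pos).and eventually_mem_nhdsWithin)).exists
  rw [mem_Ioi] at hε
  have hXc := hF.field.diff.continuous
  have htc := (differentiable_tent p).continuous
  obtain ⟨ν, hν, hle⟩ := hF.mov.le_inner_of_eventually_notMem_interior hτ0
    (Z := fun q => (ε * (-tent p q.2 + (τ - q.1) * L)) • X q.2) (by fun_prop) (by
      filter_upwards [eventually_mul_lt (105 * M * (C₀ + C)) (by positivity : 0 < κ / 4),
        Ioo_mem_nhdsGT hτ0] with h hhC hh y hy
      convert hF.notMem_interior_late hB hs hr hK hC₀ hC hτ hε (by linarith) hh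
        (fun y hy => hF.notMem_interior_initial hB hs hr hK hC₀ hC_nonneg hC hτ hε (by linarith)
          hpos (fun y hy hty => hεm.le.trans (hmle y hy hty)) hh hhC.le hy) hy using 3
      rw [smul_smul]
      ring_nf) hp
  rw [tent_self, sub_zero, inner_smul_left, RCLike.conj_to_real] at hle
  have hLτ := hB.mul_mem_Icc ⟨hτ0.le, hτ⟩
  have hXν := hF.transversal τ (right_mem_Icc.2 hτ0.le) p hp ν hν
  have hspeed : ε * (1 / 2 * κ) ≤ ε * ((1 - L * τ) * inner ℝ (X p) ν) :=
    mul_le_mul_of_nonneg_left (mul_le_mul (by linarith [hLτ.2]) hXν hκ.le (by linarith [hLτ.2]))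
      hε.le
  nlinarith only [hle, hspeed, mul_pos hε hκ]

end ShortTime

section PositiveCurvature

theorem volume_real_ball_div_eight (n : ℕ) (ρ : ℝ) :
    volume.real (Metric.ball (0 : Space n) (ρ / 8)) =
      (1 / 8) ^ n * volume.real (Metric.ball (0 : Space n) ρ) := by
  rw [div_eq_inv_mul, measureReal_def, Measure.addHaar_ball_mul_of_pos volume 0 (by norm_num),
    ENNReal.toReal_mul, ENNReal.toReal_ofReal (by positivity), finrank_euclideanSpace_fin,
    one_div, measureReal_def]

variable {s T r K C₀ ρ δ τ t : ℝ} {E F : ℝ → Set (Space n)} {V : ℝ → Space n → ℝ} {p ν : Space n}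

theorem MovingFamily.inner_le_of_mem_closure (hF : MovingFamily τ F V) (hK : 0 ≤ K)
    (hC₀ : 0 ≤ C₀) (hV : ∀ t ∈ Icc 0 τ, ∀ x ∈ frontier (F t), V t x ≤ C₀) (hρr : 2 * ρ < r)
    (hρK : 4 * K * ρ ^ 2 ≤ δ / 2) (hδρ : δ ≤ ρ) (hτ : (C₀ + 2) * τ ≤ δ / 2) (ht : t ∈ Icc 0 τ)
    (hν : FlatAt r K (F t) p ν) {y : Space n} (hy : y ∈ closure (F τ)) (hyp : ‖y - p‖ < ρ) :
    inner ℝ (y - p) ν ≤ δ := by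
  obtain ⟨y', hy', hdist⟩ := hF.exists_mem_closure_norm_sub_le hC₀ hV ht.1 le_rfl ht.2 hy
  have hdist' : ‖y - y'‖ ≤ δ / 2 := by
    rw [norm_sub_rev]
    exact hdist.trans ((mul_le_mul_of_nonneg_left (by linarith [ht.1]) (by linarith)).trans hτ)
  have hy'p : ‖y' - p‖ ≤ 2 * ρ := by
    linarith [norm_sub_le_norm_sub_add_norm_sub y' y p, norm_sub_rev y y', norm_nonneg (y - p)]
  have hflat : inner ℝ (y' - p) ν ≤ 4 * K * ρ ^ 2 :=
    calc inner ℝ (y' - p) ν ≤ K * ‖y' - p‖ ^ 2 :=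
          hν.inner_le_of_mem_closure hy' (hy'p.trans_lt hρr)
      _ ≤ K * (2 * ρ) ^ 2 := by gcongr
      _ = 4 * K * ρ ^ 2 := by ring
  have hsplit : inner ℝ (y - p) ν = inner ℝ (y - y') ν + inner ℝ (y' - p) ν := by
    rw [← inner_add_left, sub_add_sub_cancel]
  linarith [inner_le_norm_of_norm_eq_one hν.1 (y - y')]

theorem MovingFamily.transversal_outField (hF : MovingFamily τ F V) (hr : 0 < r) (hK : 0 ≤ K)
    (hC₀ : 0 ≤ C₀) (hflat : ∀ t ∈ Icc 0 τ, UniformlyFlat r K (F t))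
    (hV : ∀ t ∈ Icc 0 τ, ∀ x ∈ frontier (F t), |V t x| ≤ C₀) (hρ : 0 < ρ) (hρr : 2 * ρ < r)
    (hρK : 4 * K * ρ ^ 2 ≤ (1 / 8) ^ n / 32 * ρ / 2)
    (hτ : (C₀ + 2) * τ ≤ (1 / 8) ^ n / 32 * ρ / 2) (ht : t ∈ Icc 0 τ) :
    Transversal (ρ / 16 * volume.real (Metric.ball (0 : Space n) (ρ / 8)))
      (outField ρ hρ (interior (F τ))) (F t) := by
  intro p hp ν hν
  obtain ⟨ν', hν'⟩ := hflat t ht p hp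
  obtain rfl : ν = ν' := hν.unique (hν'.isOuterNormal hr)
  set δ : ℝ := (1 / 8) ^ n / 32 * ρ with hδ
  have hδ0 : 0 < δ := by positivity
  have hδρ : δ ≤ ρ / 32 := by
    have hpow : ((1 : ℝ) / 8) ^ n ≤ 1 := pow_le_one₀ (by norm_num) (by norm_num)
    nlinarith
  have habove : ∀ y, ‖y - p‖ < ρ → δ < inner ℝ (y - p) ν → y ∉ interior (F τ) :=
    fun y hyp hlt hy => hlt.not_ge <| hF.inner_le_of_mem_closure hK hC₀
      (fun t ht x hx => (abs_le.1 (hV t ht x hx)).2) hρr hρK (by linarith) hτ ht hν'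
      (interior_subset_closure hy) hyp
  have hbelow : ∀ y, ‖y - p‖ < ρ → inner ℝ (y - p) ν < -δ → y ∈ interior (F τ) := by
    intro y hyp hlt
    by_contra hy
    have hle := hF.compl.inner_le_of_mem_closure hK hC₀
      (fun t ht x hx => neg_le.1 (abs_le.1 (hV t ht x (frontier_compl (F t) ▸ hx))).1) hρr hρK
      (by linarith) hτ ht hν'.compl (by rwa [closure_compl]) hyp
    rw [inner_neg_right] at hle
    linarith
  refine le_trans ?_
    (le_inner_outField hρ isOpen_interior.measurableSet hν.1 hδ0.le (by linarith) hbelow habove)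
  have hpos : 0 ≤ (1 / 8 : ℝ) ^ n * ρ * volume.real (Metric.ball (0 : Space n) ρ) := by
    positivity
  rw [volume_real_ball_div_eight, hδ]
  linarith

theorem UniformlyFlat.nullMeasurableSet {A : Set (Space n)} (hA : UniformlyFlat r K A)
    (hr : 0 < r) (hK : 0 ≤ K) : NullMeasurableSet A :=
  nullMeasurableSet_of_null_frontier (hA.volume_frontier hr hK)

theorem forall_mem_Icc_of_step {P : ℝ → Prop} {c : ℝ} (hc : 0 < c) (h0 : P 0)
    (hstep : ∀ t₀ ∈ Icc 0 T, ∀ τ ∈ Ioc 0 c, t₀ + τ ≤ T → P t₀ → P (t₀ + τ)) (ht : t ∈ Icc 0 T) :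
    P t := by
  have hmul : ∀ k : ℕ, ∀ t ∈ Icc 0 T, t ≤ k * c → P t := by
    intro k
    induction k with
    | zero =>
      intro t ht htk
      obtain rfl : t = 0 := le_antisymm (by simpa using htk) ht.1
      exact h0
    | succ k ih =>
      intro t ht htk
      rw [Nat.cast_succ, add_one_mul] at htk
      obtain hle | hlt := le_or_gt t (k * c)
      · exact ih t ht hle
      · have hkc : (k : ℝ) * c ∈ Icc 0 T := ⟨by positivity, hlt.le.trans ht.2⟩
        simpa only [add_sub_cancel] using hstep _ hkc (t - k * c)
          ⟨by linarith, by linarith⟩ (by linarith [ht.2]) (ih _ hkc le_rfl)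
  obtain ⟨k, hk⟩ := exists_nat_ge (t / c)
  exact hmul k t ht ((div_le_iff₀ hc).1 hk)

theorem exists_transversalFlow_shift (hs : s ∈ Ioo 0 1) (hr : 0 < r) (hK : 0 ≤ K)
    (hE : MovingFamily T E fun t x => -fracMeanCurv s (E t) x)
    (hflat : ∀ t ∈ Icc 0 T, UniformlyFlat r K (E t)) :
    ∃ C₀ κ M d, 0 ≤ C₀ ∧ 0 < κ ∧ 1 ≤ M ∧ 0 < d ∧ ∀ t₀ τ, 0 ≤ t₀ → t₀ + τ ≤ T →
      (C₀ + 2) * τ ≤ d → ∃ X, TransversalFlow s r K C₀ κ M τ (fun t => E (t₀ + t)) X := by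
  obtain ⟨C₀, hC₀, hcurv⟩ := exists_abs_fracMeanCurv_le n hs hr hK
  have hq : (0 : ℝ) < (1 / 8) ^ n / 32 := by positivity
  obtain ⟨ρ, hρr, hρK, hρ⟩ := ((eventually_mul_lt 2 hr).and
    ((eventually_mul_lt (8 * K) hq).and eventually_mem_nhdsWithin)).exists
  rw [mem_Ioi] at hρ
  obtain ⟨M, hM, hfield⟩ := exists_boundedField_outField n hρ
  have hvol : 0 < volume.real (Metric.ball (0 : Space n) (ρ / 8)) :=
    ENNReal.toReal_pos (Metric.measure_ball_pos volume 0 (by positivity)).ne'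
      measure_ball_lt_top.ne
  refine ⟨C₀, _, M, (1 / 8) ^ n / 32 * ρ / 2, hC₀, mul_pos (by positivity : 0 < ρ / 16) hvol, hM,
    by positivity, fun t₀ τ ht₀ hT hτ => ⟨outField ρ hρ (interior (E (t₀ + τ))), ?_⟩⟩
  have hsub : ∀ t ∈ Icc 0 τ, t₀ + t ∈ Icc 0 T := fun t ht =>
    ⟨add_nonneg ht₀ ht.1, (add_le_add_right ht.2 t₀).trans hT⟩
  have hF := hE.shift ht₀ hT
  have hFflat : ∀ t ∈ Icc 0 τ, UniformlyFlat r K (E (t₀ + t)) := fun t ht => hflat _ (hsub t ht)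
  have hFcurv : ∀ t ∈ Icc 0 τ, ∀ x ∈ frontier (E (t₀ + t)),
      |fracMeanCurv s (E (t₀ + t)) x| ≤ C₀ := fun t ht x hx => by
    obtain ⟨ν, hν⟩ := hFflat t ht x hx
    exact hcurv _ x ν hν ((hFflat t ht).nullMeasurableSet hr hK)
  exact {
    mov := hF
    flat := hFflat
    abs_curv_le := hFcurv
    field := hfield _ isOpen_interior.measurableSet
    transversal := fun t ht => hF.transversal_outField hr hK hC₀ hFflat
      (fun t ht x hx => by rw [abs_neg]; exact hFcurv t ht x hx) hρ hρr (by nlinarith) hτ ht }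

theorem MovingFamily.fracMeanCurv_pos
    (hE : MovingFamily T E fun t x => -fracMeanCurv s (E t) x) (hs : s ∈ Ioo 0 1) (hr : 0 < r)
    (hK : 0 ≤ K) (hflat : ∀ t ∈ Icc 0 T, UniformlyFlat r K (E t))
    (hpos : ∀ x ∈ frontier (E 0), 0 < fracMeanCurv s (E 0) x) (ht : t ∈ Icc 0 T) :
    ∀ x ∈ frontier (E t), 0 < fracMeanCurv s (E t) x := by
  obtain ⟨C₀, κ, M, d, hC₀, hκ, hM, hd, hflow⟩ := exists_transversalFlow_shift hs hr hK hE hflat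
  obtain ⟨C, hC_nonneg, hC⟩ := exists_isPerturbationConst n hs hr hK
  obtain ⟨a, L, c, hc, hcd, hB⟩ := exists_barrierConsts K hr hC₀ hC_nonneg hκ hM hd
  refine forall_mem_Icc_of_step (P := fun t => ∀ x ∈ frontier (E t), 0 < fracMeanCurv s (E t) x)
    hc hpos (fun t₀ ht₀ τ hτ hT hpos₀ x hx => ?_) ht
  obtain ⟨X, hX⟩ := hflow t₀ τ ht₀.1 hT
    ((mul_le_mul_of_nonneg_left hτ.2 (by linarith)).trans hcd)
  exact hX.fracMeanCurv_pos hB hs hr hK hC₀ hC_nonneg hC hτ.1 hτ.2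
    (by simpa only [add_zero] using hpos₀) hx

theorem IsFracMeanCurvFlow.movingFamily (h : IsFracMeanCurvFlow s T E) :
    MovingFamily T E fun t x => -fracMeanCurv s (E t) x :=
  ⟨h.isC1Family, h.motion⟩

theorem UniformlyC2.exists_uniformlyFlat (h : UniformlyC2 T E) :
    ∃ r K, 0 < r ∧ 0 ≤ K ∧ ∀ t ∈ Icc 0 T, UniformlyFlat r K (E t) := by
  obtain ⟨r, C, hr, hC2⟩ := h
  exact ⟨r, |C|, hr, abs_nonneg C, fun t ht x hx => (hC2 t ht x hx).imp fun _ hν => hν.flatAt⟩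

theorem UniformlyFlat.strictlyPositiveCurv_iff {A : Set (Space n)} (hA : UniformlyFlat r K A)
    (hs : s ∈ Ioo 0 1) (hr : 0 < r) (hK : 0 ≤ K) :
    StrictlyPositiveCurv s A ↔ ∀ x ∈ frontier A, 0 < fracMeanCurv s A x := by
  refine forall₂_congr fun x hx => ⟨fun ⟨H, hH, hlim⟩ => ?_, fun hpos => ?_⟩
  · rwa [fracMeanCurv, hlim.limUnder_eq]
  · obtain ⟨ν, hν⟩ := hA x hx
    have hlim := hν.hasFracMeanCurv hs hr hK (hA.nullMeasurableSet hr hK)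
    rw [fracMeanCurv, hlim.limUnder_eq] at hpos
    exact ⟨_, hpos, hlim⟩

end PositiveCurvature

end FracFlow

end

theorem mainTheorem9_general (n : ℕ) (s T : ℝ) (hs : s ∈ Set.Ioo (0 : ℝ) 1)
    (E : ℝ → Set (FracFlow.Space n)) (hflow : FracFlow.IsFracMeanCurvFlow s T E)
    (hC2 : FracFlow.UniformlyC2 T E) (hpos : FracFlow.StrictlyPositiveCurv s (E 0)) :
    ∀ t ∈ Set.Icc (0 : ℝ) T, FracFlow.StrictlyPositiveCurv s (E t) := by
  intro t ht
  obtain ⟨r, K, hr, hK, hflat⟩ := hC2.exists_uniformlyFlat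
  have hflat₀ := hflat 0 ⟨le_rfl, ht.1.trans ht.2⟩
  rw [(hflat t ht).strictlyPositiveCurv_iff hs hr hK]
  rw [hflat₀.strictlyPositiveCurv_iff hs hr hK] at hpos
  exact hflow.movingFamily.fracMeanCurv_pos hs hr hK hflat hpos ht

theorem mainTheorem9 (n : ℕ) (s T : ℝ) (hs : s ∈ Set.Ioo (0 : ℝ) 1) (hT : 0 < T)
    (E : ℝ → Set (FracFlow.Space n))
    (hflow : FracFlow.IsFracMeanCurvFlow s T E)
    (hdiff : DifferentiableOn ℝ
      (fun p : FracFlow.Space n × ℝ => FracFlow.fracMeanCurv s (E p.2) p.1)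
      (FracFlow.boundaryTrack T E))
    (hC2 : FracFlow.UniformlyC2 T E)
    (hpos : FracFlow.StrictlyPositiveCurv s (E 0)) :
    ∀ t ∈ Set.Icc (0 : ℝ) T, FracFlow.StrictlyPositiveCurv s (E t) :=
  mainTheorem9_general n s T hs E hflow hC2 hpos
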